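/- Let $k$ be a field and $H$ a bialgebra over $k$. Write $\mathfrak{M}^H$ for the monoidal category of right $H$-comodules, ${}_H\mathfrak{M}$ for the monoidal category of left $H$-modules, and $\mathbf{Vec}$ for the category of $k$-vector spaces. All categories and functors below are $k$-linear, vector spaces may be infinite-dimensional, and "left exact" means preserving finite limits. Let $C$ be a left $H$-module coalgebra, i.e. a coalgebra with a left $H$-module structure such that $\Delta(hc)=h_{(1)}c_{(1)}\otimes h_{(2)}c_{(2)}$ and $\varepsilon(hc)=\varepsilon(h)\varepsilon(c)$. The category $\mathfrak{M}^C$ of right $C$-comodules is a left $\mathfrak{M}^H$-module category: $X\otimes M$ has the coaction $x\otimes m\mapsto x_{(0)}\otimes m_{(0)}\otimes x_{(1)}m_{(1)}$. Let ${}^C_H\mathfrak{M}$ be the category of left $C$-comodules in ${}_H\mathfrak{M}$, i.e. left $H$-modules with an $H$-linear left $C$-coaction. It is a right ${}_H\mathfrak{M}$-module category: on $N\otimes X$, $H$ acts diagonally and the coaction is that of $N$. The category $\mathbf{Vec}$ is a left $\mathfrak{M}^H$-module category through the forgetful functor $\mathfrak{M}^H\to\mathbf{Vec}$. A lax left $\mathcal{C}$-module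 functor $F:\mathcal{M}\to\mathcal{N}$ is a functor with a natural transformation $X\otimes F(M)\to F(X\otimes M)$ compatible with the associativity and unit constraints. A lax right module functor is defined similarly. It is strong if this transformation is invertible. Two module categories are equivalent if there are linear module functors between them, in both directions, whose two composites are isomorphic, as module functors, to the identities. For left $\mathfrak{M}^H$-module categories $\mathcal{M},\mathcal{N}$, let $\mathscr{L}^{\mathrm{lax}}_{\mathfrak{M}^H}(\mathcal{M},\mathcal{N})$ be the category of lax left $\mathfrak{M}^H$-module functors $\mathcal{M}\to\mathcal{N}$ whose underlying functor is linear, left exact and preserves small coproducts. Its morphisms are the natural transformations compatible with the module structures (module natural transformations). Consider the following 2-categories. * $\mathfrak{M}^H\text{-}\mathbf{Mod}$: its 0-cells are the left $\mathfrak{M}^H$-module categories equivalent to $\mathfrak{M}^C$ for some left $H$-module coalgebra $C$, and its category of 1-cells from $\mathcal{M}$ to $\mathcal{N}$ is $\mathscr{L}^{\mathrm{lax}}_{\mathfrak{M}^H}(\mathcal{M},\mathcal{N})$. * $\mathbf{Mod}\text{-}{}_H\mathfrak{M}$: its 0-cells are the right ${}_H\mathfrak{M}$-module categories equivalent to ${}^C_H\mathfrak{M}$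 for some left $H$-module coalgebra $C$. Its 1-cells are the left exact, linear, strong right ${}_H\mathfrak{M}$-module functors, and its 2-cells are the module natural transformations. Write $(-)^{\mathrm{op}}$ for reversing 1-cells but not 2-cells. For $X\in{}_H\mathfrak{M}$, the functor $(-)\otimes X:\mathbf{Vec}\to\mathbf{Vec}$ is a lax $\mathfrak{M}^H$-module functor by $$Y\otimes(V\otimes X)\to(Y\otimes V)\otimes X,\qquad y\otimes(v\otimes x)\mapsto(y_{(0)}\otimes v)\otimes y_{(1)}x .$$ For a left $\mathfrak{M}^H$-module category $\mathcal{M}$, let $\mathcal{M}^*=\mathscr{L}^{\mathrm{lax}}_{\mathfrak{M}^H}(\mathcal{M},\mathbf{Vec})$, with the right ${}_H\mathfrak{M}$-action $T\otimes X=((-)\otimes X)\circ T$. For a 1-cell $F:\mathcal{M}\to\mathcal{N}$, let $F^*:\mathcal{N}^*\to\mathcal{M}^*$, $T\mapsto T\circ F$, with its canonical strong module structure. For a 2-cell $\alpha:F\Rightarrow G$, let $\alpha^*=((T\alpha)_T):F^*\Rightarrow G^*$. Theorem. If $\mathcal{M}$ is a 0-cell of $\mathfrak{M}^H\text{-}\mathbf{Mod}$,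 then $\mathcal{M}^*$ is a 0-cell of $\mathbf{Mod}\text{-}{}_H\mathfrak{M}$. If $F$ is a 1-cell of $\mathfrak{M}^H\text{-}\mathbf{Mod}$, then $F^*$ is left exact, so that it is a 1-cell of $\mathbf{Mod}\text{-}{}_H\mathfrak{M}$. The resulting 2-functor $$(-)^*:\mathfrak{M}^H\text{-}\mathbf{Mod}\to(\mathbf{Mod}\text{-}{}_H\mathfrak{M})^{\mathrm{op}},\qquad \mathcal{M}\mapsto\mathcal{M}^*=\mathscr{L}^{\mathrm{lax}}_{\mathfrak{M}^H}(\mathcal{M},\mathbf{Vec}),$$ is a 2-equivalence: for all 0-cells $\mathcal{M},\mathcal{N}$ the functor $F\mapsto F^*$ from the category of 1-cells $\mathcal{M}\to\mathcal{N}$ to the category of 1-cells $\mathcal{N}^*\to\mathcal{M}^*$ is an equivalence, and every 0-cell of $\mathbf{Mod}\text{-}{}_H\mathfrak{M}$ is equivalent, inside that 2-category, to $\mathcal{M}^*$ for some 0-cell $\mathcal{M}$. -/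

import Mathlib

universe u v₁ v₂ v₃ v₄ v₅ w₁ w₂ w₃ w₄ w₅

open CategoryTheory MonoidalCategory Limits
open scoped TensorProduct

noncomputable section

namespace HopfDual

/-! ### Module coalgebras over a bialgebra -/

section ModuleCoalgebra

variable (k : Type u) [Field k] (H : Type u) [Ring H] [Bialgebra k H]

/-- The action `H ⊗ C → C` as a linear map. -/
def actMap (C : Type u) [AddCommGroup C] [Module k C] [Module H C] [IsScalarTower k H C] :
    H ⊗[k] C →ₗ[k] C :=
  TensorProduct.lift (Algebra.lsmul k k C).toLinearMap

@[simp] lemma actMap_tmul (C : Type u) [AddCommGroup C] [Module k C] [Module H C]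
    [IsScalarTower k H C] (h : H) (c : C) : actMap k H C (h ⊗ₜ[k] c) = h • c := rfl

/-- `C` is a left `H`-module coalgebra:
`Δ(h c) = h₍₁₎ c₍₁₎ ⊗ h₍₂₎ c₍₂₎` and `ε(h c) = ε(h) ε(c)`. -/
class IsModuleCoalgebra (C : Type u) [AddCommGroup C] [Module k C] [Coalgebra k C]
    [Module H C] [IsScalarTower k H C] : Prop where
  comul_smul (h : H) (c : C) :
    Coalgebra.comul (R := k) (h • c) =
      TensorProduct.map (actMap k H C) (actMap k H C)
        (TensorProduct.tensorTensorTensorComm k H H C C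
          (Coalgebra.comul (R := k) h ⊗ₜ[k] Coalgebra.comul (R := k) c))
  counit_smul (h : H) (c : C) :
    Coalgebra.counit (R := k) (h • c) =
      Coalgebra.counit (R := k) h * Coalgebra.counit (R := k) c

/-- A bialgebra is a left module coalgebra over itself. -/
instance : IsModuleCoalgebra k H H where
  comul_smul h c := by
    rw [smul_eq_mul, Bialgebra.comul_mul]
    generalize Coalgebra.comul (R := k) h = s
    generalize Coalgebra.comul (R := k) c = t
    induction s with
    | zero => simp
    | add x y hx hy => simp only [add_mul, TensorProduct.add_tmul, map_add, hx, hy]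
    | tmul a b =>
      induction t with
      | zero => simp
      | add x y hx hy => simp only [mul_add, TensorProduct.tmul_add, map_add, hx, hy]
      | tmul c d => simp
  counit_smul h c := by simp

/-- Bundled left `H`-module coalgebras. -/
structure ModuleCoalg where
  carrier : Type u
  [addCommGroup : AddCommGroup carrier]
  [module : Module k carrier]
  [coalgebra : Coalgebra k carrier]
  [action : Module H carrier]
  [tower : IsScalarTower k H carrier]
  [isModuleCoalgebra : IsModuleCoalgebra k H carrier]

attribute [instance] ModuleCoalg.addCommGroup ModuleCoalg.module ModuleCoalg.coalgebra
  ModuleCoalg.action ModuleCoalg.tower ModuleCoalg.isModuleCoalgebra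

end ModuleCoalgebra

/-! ### Right comodules -/

section RightComodules

/-- Right comodules over a coalgebra `C`. -/
structure RComod (k : Type u) [Field k] (C : Type u) [AddCommGroup C] [Module k C]
    [Coalgebra k C] where
  V : Type u
  [addCommGroup : AddCommGroup V]
  [module : Module k V]
  coact : V →ₗ[k] V ⊗[k] C
  coassoc : TensorProduct.assoc k V C C ∘ₗ coact.rTensor C ∘ₗ coact =
    (Coalgebra.comul (R := k) (A := C)).lTensor V ∘ₗ coact
  counit : TensorProduct.rid k V ∘ₗ (Coalgebra.counit (R := k) (A := C)).lTensor V ∘ₗ coact =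
    LinearMap.id

attribute [instance] RComod.addCommGroup RComod.module

namespace RComod

variable {k : Type u} [Field k] {C : Type u} [AddCommGroup C] [Module k C] [Coalgebra k C]

/-- The space of colinear maps between two right comodules. -/
def colin (X Y : RComod k C) : Submodule k (X.V →ₗ[k] Y.V) where
  carrier := {f | Y.coact ∘ₗ f = f.rTensor C ∘ₗ X.coact}
  zero_mem' := by simp
  add_mem' {f g} hf hg := by
    simp only [Set.mem_ofPred_eq] at *
    rw [LinearMap.comp_add, hf, hg, LinearMap.rTensor_add, LinearMap.add_comp]
  smul_mem' c f hf := by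
    simp only [Set.mem_ofPred_eq] at *
    rw [LinearMap.comp_smul, hf, LinearMap.rTensor_smul, LinearMap.smul_comp]

/-- The category of right `C`-comodules and colinear maps. -/
instance : Category (RComod k C) where
  Hom X Y := colin X Y
  id X := ⟨LinearMap.id, by simp [colin]⟩
  comp {X Y Z} f g := ⟨g.1 ∘ₗ f.1, by
    have hf : Y.coact ∘ₗ f.1 = f.1.rTensor C ∘ₗ X.coact := f.2
    have hg : Z.coact ∘ₗ g.1 = g.1.rTensor C ∘ₗ Y.coact := g.2
    change Z.coact ∘ₗ g.1 ∘ₗ f.1 = (g.1 ∘ₗ f.1).rTensor C ∘ₗ X.coact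
    rw [← LinearMap.comp_assoc, hg, LinearMap.comp_assoc, hf, LinearMap.rTensor_comp,
      LinearMap.comp_assoc]⟩

/-- The linear map underlying a morphism of comodules. -/
def lin {X Y : RComod k C} (f : X ⟶ Y) : X.V →ₗ[k] Y.V := f.1

lemma lin_comm {X Y : RComod k C} (f : X ⟶ Y) (x : X.V) :
    Y.coact (lin f x) = (lin f).rTensor C (X.coact x) := LinearMap.congr_fun f.2 x

@[ext] lemma hom_ext {X Y : RComod k C} {f g : X ⟶ Y} (h : lin f = lin g) : f = g :=
  Subtype.ext h

@[simp] lemma lin_id (X : RComod k C) : lin (𝟙 X) = LinearMap.id := rfl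

@[simp] lemma lin_comp {X Y Z : RComod k C} (f : X ⟶ Y) (g : Y ⟶ Z) :
    lin (f ≫ g) = lin g ∘ₗ lin f := rfl

/-- Build a morphism of comodules. -/
def mkHom {X Y : RComod k C} (f : X.V →ₗ[k] Y.V)
    (h : ∀ x, Y.coact (f x) = f.rTensor C (X.coact x)) : X ⟶ Y :=
  ⟨f, LinearMap.ext h⟩

@[simp] lemma lin_mkHom {X Y : RComod k C} (f : X.V →ₗ[k] Y.V) (h) :
    lin (mkHom (X := X) (Y := Y) f h) = f := rfl

/-- Build an isomorphism of comodules. -/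
def mkIso {X Y : RComod k C} (e : X.V ≃ₗ[k] Y.V)
    (h : ∀ x, Y.coact (e x) = e.toLinearMap.rTensor C (X.coact x)) : X ≅ Y where
  hom := mkHom e.toLinearMap h
  inv := mkHom e.symm.toLinearMap fun y => by
    obtain ⟨x, rfl⟩ := e.surjective y
    change X.coact (e.symm (e x)) = e.symm.toLinearMap.rTensor C (Y.coact (e x))
    rw [h, ← LinearMap.comp_apply, ← LinearMap.rTensor_comp]
    simp
  hom_inv_id := by ext x; simp
  inv_hom_id := by ext x; simp

@[simp] lemma lin_mkIso_hom {X Y : RComod k C} (e : X.V ≃ₗ[k] Y.V) (h) :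
    lin (mkIso (X := X) (Y := Y) e h).hom = e.toLinearMap := rfl

@[simp] lemma lin_mkIso_inv {X Y : RComod k C} (e : X.V ≃ₗ[k] Y.V) (h) :
    lin (mkIso (X := X) (Y := Y) e h).inv = e.symm.toLinearMap := rfl

instance : Preadditive (RComod k C) where
  homGroup X Y := inferInstanceAs (AddCommGroup (colin X Y))
  add_comp _ _ _ _ _ _ := Subtype.ext (LinearMap.comp_add _ _ _)
  comp_add _ _ _ _ _ _ := Subtype.ext (LinearMap.add_comp _ _ _)

instance : Linear k (RComod k C) where
  homModule X Y := inferInstanceAs (Module k (colin X Y))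
  smul_comp _ _ _ _ _ _ := Subtype.ext (LinearMap.comp_smul _ _ _)
  comp_smul _ _ _ _ _ _ := Subtype.ext (LinearMap.smul_comp _ _ _)

end RComod

end RightComodules

/-! ### The action of right `H`-comodules on right `C`-comodules -/

section ComoduleAction

variable {k : Type u} [Field k] {H : Type u} [Ring H] [Bialgebra k H]
variable {C : Type u} [AddCommGroup C] [Module k C] [Module H C] [IsScalarTower k H C]

/-- The linear map `(x ⊗ h) ⊗ (m ⊗ c) ↦ (x ⊗ m) ⊗ h c`. -/
def mix (k H C X M : Type u) [Field k] [Ring H] [Bialgebra k H] [AddCommGroup C] [Module k C]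
    [Module H C] [IsScalarTower k H C] [AddCommGroup X] [Module k X]
    [AddCommGroup M] [Module k M] :
    (X ⊗[k] H) ⊗[k] (M ⊗[k] C) →ₗ[k] (X ⊗[k] M) ⊗[k] C :=
  (actMap k H C).lTensor (X ⊗[k] M) ∘ₗ
    (TensorProduct.tensorTensorTensorComm k X H M C).toLinearMap

@[simp] lemma mix_tmul (X M : Type u) [AddCommGroup X] [Module k X]
    [AddCommGroup M] [Module k M] (x : X) (h : H) (m : M) (c : C) :
    mix k H C X M ((x ⊗ₜ h) ⊗ₜ (m ⊗ₜ c)) = (x ⊗ₜ m) ⊗ₜ (h • c) := rfl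

/-- The coaction `x ⊗ m ↦ x₍₀₎ ⊗ m₍₀₎ ⊗ x₍₁₎ m₍₁₎` on `X ⊗ M`. -/
def tensorCoact {X M : Type u} [AddCommGroup X] [Module k X]
    [AddCommGroup M] [Module k M] (ρ : X →ₗ[k] X ⊗[k] H) (σ : M →ₗ[k] M ⊗[k] C) :
    X ⊗[k] M →ₗ[k] (X ⊗[k] M) ⊗[k] C :=
  mix k H C X M ∘ₗ TensorProduct.map ρ σ

@[simp] lemma tensorCoact_tmul {X M : Type u} [AddCommGroup X] [Module k X]
    [AddCommGroup M] [Module k M] (ρ : X →ₗ[k] X ⊗[k] H) (σ : M →ₗ[k] M ⊗[k] C)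
    (x : X) (m : M) : tensorCoact ρ σ (x ⊗ₜ m) = mix k H C X M (ρ x ⊗ₜ σ m) := rfl

variable [Coalgebra k C] [IsModuleCoalgebra k H C]

/-- The right `C`-comodule `X ⊗ M` for a right `H`-comodule `X` and a right `C`-comodule `M`. -/
def tensorComod (X : RComod k H) (M : RComod k C) : RComod k C where
  V := X.V ⊗[k] M.V
  coact := tensorCoact X.coact M.coact
  coassoc := by
    ext x m
    have hx := LinearMap.congr_fun X.coassoc x
    have hm := LinearMap.congr_fun M.coassoc m
    simp only [LinearMap.comp_apply, LinearEquiv.coe_coe] at hx hm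
    simp only [TensorProduct.AlgebraTensorModule.curry_apply, LinearMap.restrictScalars_self,
      TensorProduct.curry_apply, LinearMap.comp_apply, LinearEquiv.coe_coe, tensorCoact_tmul]
    let Ω : (X.V ⊗[k] (H ⊗[k] H)) ⊗[k] (M.V ⊗[k] (C ⊗[k] C)) →ₗ[k]
        (X.V ⊗[k] M.V) ⊗[k] (C ⊗[k] C) :=
      (TensorProduct.map (actMap k H C) (actMap k H C) ∘ₗ
        (TensorProduct.tensorTensorTensorComm k H H C C).toLinearMap).lTensor (X.V ⊗[k] M.V) ∘ₗ
      (TensorProduct.tensorTensorTensorComm k X.V (H ⊗[k] H) M.V (C ⊗[k] C)).toLinearMap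
    have key₁ : ∀ (s : X.V ⊗[k] H) (t : M.V ⊗[k] C),
        TensorProduct.assoc k _ C C ((tensorCoact X.coact M.coact).rTensor C
          (mix k H C X.V M.V (s ⊗ₜ t))) =
        Ω (TensorProduct.assoc k _ H H (X.coact.rTensor H s) ⊗ₜ
          TensorProduct.assoc k _ C C (M.coact.rTensor C t)) := by
      intro s t
      induction s with
      | zero => simp
      | add x y hx hy => simp only [TensorProduct.add_tmul, map_add, hx, hy]
      | tmul a h =>
        induction t with
        | zero => simp
        | add x y hx hy => simp only [TensorProduct.tmul_add, map_add, hx, hy]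
        | tmul b c =>
          simp only [mix_tmul, LinearMap.rTensor_tmul, tensorCoact_tmul]
          generalize X.coact a = s
          generalize M.coact b = t
          induction s with
          | zero => simp
          | add x y hx hy => simp only [TensorProduct.add_tmul, map_add, hx, hy]
          | tmul a h =>
            induction t with
            | zero => simp
            | add x y hx hy =>
              simp only [TensorProduct.tmul_add, TensorProduct.add_tmul, map_add, hx, hy]
            | tmul b c => simp [Ω]
    have key₂ : ∀ (s : X.V ⊗[k] H) (t : M.V ⊗[k] C),
        (Coalgebra.comul (R := k) (A := C)).lTensor _ (mix k H C X.V M.V (s ⊗ₜ t)) =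
        Ω ((Coalgebra.comul (R := k) (A := H)).lTensor _ s ⊗ₜ
          (Coalgebra.comul (R := k) (A := C)).lTensor _ t) := by
      intro s t
      induction s with
      | zero => simp
      | add x y hx hy => simp only [TensorProduct.add_tmul, map_add, hx, hy]
      | tmul a h =>
        induction t with
        | zero => simp
        | add x y hx hy => simp only [TensorProduct.tmul_add, map_add, hx, hy]
        | tmul b c => simp [Ω, IsModuleCoalgebra.comul_smul]
    rw [key₁, key₂, hx, hm]
  counit := by
    ext x m
    have hx := LinearMap.congr_fun X.counit x
    have hm := LinearMap.congr_fun M.counit m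
    simp only [LinearMap.comp_apply, LinearEquiv.coe_coe, LinearMap.id_apply] at hx hm
    simp only [TensorProduct.AlgebraTensorModule.curry_apply, LinearMap.restrictScalars_self,
      TensorProduct.curry_apply, LinearMap.comp_apply, LinearEquiv.coe_coe, LinearMap.id_apply,
      tensorCoact_tmul]
    have key : ∀ (s : X.V ⊗[k] H) (t : M.V ⊗[k] C),
        TensorProduct.rid k (X.V ⊗[k] M.V) ((Coalgebra.counit (R := k) (A := C)).lTensor _
          (mix k H C X.V M.V (s ⊗ₜ t))) =
        TensorProduct.rid k X.V ((Coalgebra.counit (R := k) (A := H)).lTensor _ s) ⊗ₜ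
        TensorProduct.rid k M.V ((Coalgebra.counit (R := k) (A := C)).lTensor _ t) := by
      intro s t
      induction s with
      | zero => simp
      | add x y hx hy => simp only [TensorProduct.add_tmul, map_add, hx, hy]
      | tmul a b =>
        induction t with
        | zero => simp
        | add x y hx hy => simp only [TensorProduct.tmul_add, map_add, hx, hy]
        | tmul c d =>
          simp [IsModuleCoalgebra.counit_smul, TensorProduct.smul_tmul', smul_smul, mul_comm]
    rw [key, hx, hm]

end ComoduleAction

section ComoduleMonoidal

variable {k : Type u} [Field k] {H : Type u} [Ring H] [Bialgebra k H]
variable {C : Type u} [AddCommGroup C] [Module k C] [Coalgebra k C]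
  [Module H C] [IsScalarTower k H C] [IsModuleCoalgebra k H C]

@[simp] lemma tensorComod_coact_tmul (X : RComod k H) (M : RComod k C) (x : X.V) (m : M.V) :
    (tensorComod X M).coact (x ⊗ₜ[k] m) =
      mix k H C X.V M.V (X.coact x ⊗ₜ M.coact m) := rfl

/-- The tensor product of morphisms, as a morphism of comodules. -/
def tensorComodMap {X X' : RComod k H} {M M' : RComod k C} (f : X ⟶ X') (g : M ⟶ M') :
    tensorComod X M ⟶ tensorComod X' M' :=
  RComod.mkHom (TensorProduct.map (RComod.lin f) (RComod.lin g)) fun t => by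
    change (tensorCoact X'.coact M'.coact ∘ₗ TensorProduct.map (RComod.lin f) (RComod.lin g)) t =
      ((TensorProduct.map (RComod.lin f) (RComod.lin g)).rTensor C ∘ₗ
        tensorCoact X.coact M.coact) t
    congr 1
    ext x m
    simp only [TensorProduct.AlgebraTensorModule.curry_apply, LinearMap.restrictScalars_self,
      TensorProduct.curry_apply, LinearMap.comp_apply, TensorProduct.map_tmul, tensorCoact_tmul,
      RComod.lin_comm]
    generalize X.coact x = s
    generalize M.coact m = t
    induction s with
    | zero => simp
    | add x y hx hy => simp only [TensorProduct.add_tmul, map_add, hx, hy]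
    | tmul a h =>
      induction t with
      | zero => simp
      | add x y hx hy => simp only [TensorProduct.tmul_add, map_add, hx, hy]
      | tmul b c => simp

@[simp] lemma lin_tensorComodMap {X X' : RComod k H} {M M' : RComod k C} (f : X ⟶ X')
    (g : M ⟶ M') :
    RComod.lin (tensorComodMap f g) = TensorProduct.map (RComod.lin f) (RComod.lin g) := rfl

/-- The associativity isomorphism `(X ⊗ Y) ⊗ M ≅ X ⊗ (Y ⊗ M)`. -/
def tensorComodAssoc (X Y : RComod k H) (M : RComod k C) :
    tensorComod (tensorComod X Y) M ≅ tensorComod X (tensorComod Y M) :=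
  RComod.mkIso (TensorProduct.assoc k X.V Y.V M.V) fun t => by
    change ((tensorComod X (tensorComod Y M)).coact ∘ₗ
        (TensorProduct.assoc k X.V Y.V M.V).toLinearMap) t =
      ((TensorProduct.assoc k X.V Y.V M.V).toLinearMap.rTensor C ∘ₗ
        (tensorComod (tensorComod X Y) M).coact) t
    congr 1
    refine TensorProduct.ext_threefold fun x y m => ?_
    change mix k H C X.V (Y.V ⊗[k] M.V)
        (X.coact x ⊗ₜ mix k H C Y.V M.V (Y.coact y ⊗ₜ M.coact m)) =
      (TensorProduct.assoc k X.V Y.V M.V).toLinearMap.rTensor C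
        (mix k H C (X.V ⊗[k] Y.V) M.V
          (mix k H H X.V Y.V (X.coact x ⊗ₜ Y.coact y) ⊗ₜ M.coact m))
    generalize X.coact x = r
    generalize Y.coact y = s
    generalize M.coact m = t
    induction r with
    | zero => simp
    | add x y hx hy => simp only [TensorProduct.add_tmul, map_add, hx, hy]
    | tmul a h =>
      induction s with
      | zero => simp
      | add x y hx hy =>
        simp only [TensorProduct.add_tmul, TensorProduct.tmul_add, map_add, hx, hy]
      | tmul b h' =>
        induction t with
        | zero => simp
        | add x y hx hy => simp only [TensorProduct.tmul_add, map_add, hx, hy]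
        | tmul c d => simp [mul_smul]

variable (k H) in
/-- The trivial right `H`-comodule `k`, with coaction `r ↦ r ⊗ 1`. -/
def unitComod : RComod k H where
  V := k
  coact := (TensorProduct.mk k k H).flip 1
  coassoc := by
    ext
    simp [Algebra.TensorProduct.one_def]
  counit := by
    ext
    simp

/-- The unit isomorphism `k ⊗ M ≅ M`. -/
def tensorComodUnit (M : RComod k C) : tensorComod (unitComod k H) M ≅ M :=
  RComod.mkIso (TensorProduct.lid k M.V) fun t => by
    change (M.coact ∘ₗ (TensorProduct.lid k M.V).toLinearMap) t =
      ((TensorProduct.lid k M.V).toLinearMap.rTensor C ∘ₗ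
        (tensorComod (unitComod k H) M).coact) t
    congr 1
    refine TensorProduct.ext' fun r m => ?_
    change M.coact (r • m) = (TensorProduct.lid k M.V).toLinearMap.rTensor C
      (mix k H C k M.V ((r ⊗ₜ 1) ⊗ₜ M.coact m))
    rw [map_smul]
    generalize M.coact m = s
    induction s with
    | zero => simp
    | add x y hx hy => simp only [TensorProduct.tmul_add, map_add, smul_add, hx, hy]
    | tmul a c => simp [TensorProduct.smul_tmul']

/-- The unit isomorphism `X ⊗ k ≅ X`. -/
def tensorComodRightUnit (X : RComod k H) : tensorComod X (unitComod k H) ≅ X :=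
  RComod.mkIso (TensorProduct.rid k X.V) fun t => by
    change (X.coact ∘ₗ (TensorProduct.rid k X.V).toLinearMap) t =
      ((TensorProduct.rid k X.V).toLinearMap.rTensor H ∘ₗ
        (tensorComod X (unitComod k H)).coact) t
    congr 1
    refine TensorProduct.ext' fun x r => ?_
    change X.coact (r • x) = (TensorProduct.rid k X.V).toLinearMap.rTensor H
      (mix k H H X.V k (X.coact x ⊗ₜ (r ⊗ₜ 1)))
    rw [map_smul]
    generalize X.coact x = s
    induction s with
    | zero => simp
    | add x y hx hy => simp only [TensorProduct.add_tmul, map_add, smul_add, hx, hy]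
    | tmul a c => simp [TensorProduct.smul_tmul']

instance : MonoidalCategoryStruct (RComod k H) where
  tensorObj X Y := tensorComod X Y
  whiskerLeft X _ _ f := tensorComodMap (𝟙 X) f
  whiskerRight f Y := tensorComodMap f (𝟙 Y)
  tensorHom f g := tensorComodMap f g
  tensorUnit := unitComod k H
  associator X Y Z := tensorComodAssoc X Y Z
  leftUnitor X := tensorComodUnit X
  rightUnitor X := tensorComodRightUnit X

/-- The monoidal category of right `H`-comodules. -/
instance : MonoidalCategory (RComod k H) where
  tensorHom_def f g := by
    apply RComod.hom_ext
    refine TensorProduct.ext' fun x y => rfl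
  id_tensorHom_id X Y := by
    apply RComod.hom_ext
    refine TensorProduct.ext' fun x y => rfl
  tensorHom_comp_tensorHom f g f' g' := by
    apply RComod.hom_ext
    refine TensorProduct.ext' fun x y => rfl
  whiskerLeft_id X Y := by
    apply RComod.hom_ext
    refine TensorProduct.ext' fun x y => rfl
  id_whiskerRight X Y := by
    apply RComod.hom_ext
    refine TensorProduct.ext' fun x y => rfl
  associator_naturality f g h := by
    apply RComod.hom_ext
    refine TensorProduct.ext_threefold fun x y z => rfl
  leftUnitor_naturality {X Y} f := by
    apply RComod.hom_ext
    refine TensorProduct.ext' fun r x => ?_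
    exact ((RComod.lin f).map_smul r x).symm
  rightUnitor_naturality {X Y} f := by
    apply RComod.hom_ext
    refine TensorProduct.ext' fun x r => ?_
    exact ((RComod.lin f).map_smul r x).symm
  pentagon X Y Z W := by
    apply RComod.hom_ext
    refine TensorProduct.ext_fourfold fun x y z w => rfl
  triangle X Y := by
    apply RComod.hom_ext
    refine TensorProduct.ext_threefold fun x r y => ?_
    exact (TensorProduct.smul_tmul (show k from r) x y).symm

/-- The category of right `C`-comodules, for a left `H`-module coalgebra `C`, is a left module
category over the monoidal category of right `H`-comodules. -/
instance : MonoidalLeftAction (RComod k H) (RComod k C) where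
  actionObj X M := tensorComod X M
  actionHomLeft f M := tensorComodMap f (𝟙 M)
  actionHomRight X _ _ g := tensorComodMap (𝟙 X) g
  actionHom f g := tensorComodMap f g
  actionAssocIso X Y M := tensorComodAssoc X Y M
  actionUnitIso M := tensorComodUnit M
  actionHom_def f g := by
    apply RComod.hom_ext
    refine TensorProduct.ext' fun x y => rfl
  actionHomRight_id X M := by
    apply RComod.hom_ext
    refine TensorProduct.ext' fun x y => rfl
  id_actionHomLeft X M := by
    apply RComod.hom_ext
    refine TensorProduct.ext' fun x y => rfl
  actionHom_comp f f' g g' := by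
    apply RComod.hom_ext
    refine TensorProduct.ext' fun x y => rfl
  actionAssocIso_hom_naturality f g h := by
    apply RComod.hom_ext
    refine TensorProduct.ext_threefold fun x y z => rfl
  actionUnitIso_hom_naturality f := by
    apply RComod.hom_ext
    refine TensorProduct.ext' fun r x => ?_
    exact (RComod.lin f).map_smul r x
  whiskerLeft_actionHomLeft X Y Z f M := by
    apply RComod.hom_ext
    refine TensorProduct.ext_threefold fun x y z => rfl
  whiskerRight_actionHomLeft X f M := by
    apply RComod.hom_ext
    refine TensorProduct.ext_threefold fun x y z => rfl
  associator_actionHom X Y Z M := by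
    apply RComod.hom_ext
    refine TensorProduct.ext_fourfold fun x y z w => rfl
  leftUnitor_actionHom X M := by
    apply RComod.hom_ext
    refine TensorProduct.ext_threefold fun r x m => ?_
    exact (TensorProduct.smul_tmul' (show k from r) x m).symm
  rightUnitor_actionHom X M := by
    apply RComod.hom_ext
    refine TensorProduct.ext_threefold fun x r m => ?_
    exact TensorProduct.smul_tmul (show k from r) x m

/-- The category `Vec` of vector spaces is a left module category over the monoidal category of
right `H`-comodules, through the forgetful functor. -/
instance : MonoidalLeftAction (RComod k H) (ModuleCat.{u} k) where
  actionObj X V := ModuleCat.of k (X.V ⊗[k] V)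
  actionHomLeft f V := ModuleCat.ofHom (TensorProduct.map (RComod.lin f) LinearMap.id)
  actionHomRight X _ _ g := ModuleCat.ofHom (TensorProduct.map LinearMap.id g.hom)
  actionHom f g := ModuleCat.ofHom (TensorProduct.map (RComod.lin f) g.hom)
  actionAssocIso X Y V := (TensorProduct.assoc k X.V Y.V V).toModuleIso
  actionUnitIso V := (TensorProduct.lid k V).toModuleIso
  actionHom_def f g := by
    apply ModuleCat.hom_ext
    refine TensorProduct.ext' fun x y => rfl
  actionHomRight_id X M := by
    apply ModuleCat.hom_ext
    refine TensorProduct.ext' fun x y => rfl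
  id_actionHomLeft X M := by
    apply ModuleCat.hom_ext
    refine TensorProduct.ext' fun x y => rfl
  actionHom_comp f f' g g' := by
    apply ModuleCat.hom_ext
    refine TensorProduct.ext' fun x y => rfl
  actionAssocIso_hom_naturality f g h := by
    apply ModuleCat.hom_ext
    refine TensorProduct.ext_threefold fun x y z => rfl
  actionUnitIso_hom_naturality f := by
    apply ModuleCat.hom_ext
    refine TensorProduct.ext' fun r x => ?_
    exact f.hom.map_smul r x
  whiskerLeft_actionHomLeft X Y Z f M := by
    apply ModuleCat.hom_ext
    refine TensorProduct.ext_threefold fun x y z => rfl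
  whiskerRight_actionHomLeft X f M := by
    apply ModuleCat.hom_ext
    refine TensorProduct.ext_threefold fun x y z => rfl
  associator_actionHom X Y Z M := by
    apply ModuleCat.hom_ext
    refine TensorProduct.ext_fourfold fun x y z w => rfl
  leftUnitor_actionHom X M := by
    apply ModuleCat.hom_ext
    refine TensorProduct.ext_threefold fun r x m => ?_
    exact (TensorProduct.smul_tmul' (show k from r) x m).symm
  rightUnitor_actionHom X M := by
    apply ModuleCat.hom_ext
    refine TensorProduct.ext_threefold fun x r m => ?_
    exact TensorProduct.smul_tmul (show k from r) x m

end ComoduleMonoidal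

/-! ### The monoidal category of left `H`-modules -/

section HModules

variable {k : Type u} [Field k] {H : Type u} [Ring H] [Bialgebra k H]

section

variable {V W U V' W' : Type u} [AddCommGroup V] [Module k V] [AddCommGroup W] [Module k W]
  [AddCommGroup U] [Module k U] [AddCommGroup V'] [Module k V'] [AddCommGroup W'] [Module k W']

/-- The diagonal action `h (v ⊗ w) = h₍₁₎ v ⊗ h₍₂₎ w` of `H` on `V ⊗ W`. -/
def tensorAct (ρ : H →ₐ[k] Module.End k V) (σ : H →ₐ[k] Module.End k W) :
    H →ₐ[k] Module.End k (V ⊗[k] W) :=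
  Module.endTensorEndAlgHom.comp
    ((Algebra.TensorProduct.map ρ σ).comp (Bialgebra.comulAlgHom k H))

/-- The linear map `h ↦ h v`. -/
def orb (ρ : H →ₐ[k] Module.End k V) (v : V) : H →ₗ[k] V :=
  LinearMap.applyₗ v ∘ₗ ρ.toLinearMap

@[simp] lemma orb_apply (ρ : H →ₐ[k] Module.End k V) (v : V) (h : H) : orb ρ v h = ρ h v := rfl

lemma tensorAct_tmul (ρ : H →ₐ[k] Module.End k V) (σ : H →ₐ[k] Module.End k W) (h : H)
    (v : V) (w : W) :
    tensorAct ρ σ h (v ⊗ₜ w) =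
      TensorProduct.map (orb ρ v) (orb σ w) (Coalgebra.comul (R := k) h) := by
  change Module.endTensorEndAlgHom (R := k) (S := k) (A := k)
    (Algebra.TensorProduct.map ρ σ (Coalgebra.comul (R := k) h)) (v ⊗ₜ w) = _
  generalize Coalgebra.comul (R := k) h = s
  induction s with
  | zero => simp
  | add x y hx hy => simp only [map_add, LinearMap.add_apply, hx, hy]
  | tmul a b => rfl

lemma orb_tensorAct (ρ : H →ₐ[k] Module.End k V) (σ : H →ₐ[k] Module.End k W)
    (v : V) (w : W) :
    orb (tensorAct ρ σ) (v ⊗ₜ w) =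
      TensorProduct.map (orb ρ v) (orb σ w) ∘ₗ Coalgebra.comul (R := k) (A := H) :=
  LinearMap.ext fun h => tensorAct_tmul ρ σ h v w

lemma tensorAct_map {ρ : H →ₐ[k] Module.End k V} {σ : H →ₐ[k] Module.End k W}
    {ρ' : H →ₐ[k] Module.End k V'} {σ' : H →ₐ[k] Module.End k W'}
    {f : V →ₗ[k] V'} {g : W →ₗ[k] W'} (hf : ∀ h v, f (ρ h v) = ρ' h (f v))
    (hg : ∀ h w, g (σ h w) = σ' h (g w)) (h : H) (t : V ⊗[k] W) :
    TensorProduct.map f g (tensorAct ρ σ h t) =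
      tensorAct ρ' σ' h (TensorProduct.map f g t) := by
  induction t with
  | zero => simp
  | add x y hx hy => simp only [map_add, hx, hy]
  | tmul v w =>
    rw [TensorProduct.map_tmul, tensorAct_tmul, tensorAct_tmul]
    generalize Coalgebra.comul (R := k) h = s
    induction s with
    | zero => simp
    | add x y hx hy => simp only [map_add, hx, hy]
    | tmul a b => simp [hf, hg]

lemma tensorAct_assoc (ρ : H →ₐ[k] Module.End k V) (σ : H →ₐ[k] Module.End k W)
    (τ : H →ₐ[k] Module.End k U) (h : H) (t : (V ⊗[k] W) ⊗[k] U) :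
    TensorProduct.assoc k V W U (tensorAct (tensorAct ρ σ) τ h t) =
      tensorAct ρ (tensorAct σ τ) h (TensorProduct.assoc k V W U t) := by
  suffices (TensorProduct.assoc k V W U).toLinearMap ∘ₗ tensorAct (tensorAct ρ σ) τ h =
      tensorAct ρ (tensorAct σ τ) h ∘ₗ (TensorProduct.assoc k V W U).toLinearMap from
    LinearMap.congr_fun this t
  refine TensorProduct.ext_threefold fun v w x => ?_
  change TensorProduct.assoc k V W U (tensorAct (tensorAct ρ σ) τ h ((v ⊗ₜ w) ⊗ₜ x)) =
    tensorAct ρ (tensorAct σ τ) h (v ⊗ₜ (w ⊗ₜ x))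
  rw [tensorAct_tmul, tensorAct_tmul, orb_tensorAct, orb_tensorAct]
  have e₁ : ∀ s : H ⊗[k] H, TensorProduct.assoc k V W U (TensorProduct.map
      (TensorProduct.map (orb ρ v) (orb σ w) ∘ₗ Coalgebra.comul (R := k) (A := H)) (orb τ x) s) =
      TensorProduct.map (orb ρ v) (TensorProduct.map (orb σ w) (orb τ x))
        (TensorProduct.assoc k H H H ((Coalgebra.comul (R := k) (A := H)).rTensor H s)) := by
    intro s
    induction s with
    | zero => simp
    | add x y hx hy => simp only [map_add, hx, hy]
    | tmul a b =>
      simp only [TensorProduct.map_tmul, LinearMap.comp_apply, LinearMap.rTensor_tmul]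
      generalize Coalgebra.comul (R := k) a = s
      induction s with
      | zero => simp
      | add x y hx hy => simp only [map_add, TensorProduct.add_tmul, hx, hy]
      | tmul a b => simp
  have e₂ : ∀ s : H ⊗[k] H, TensorProduct.map (orb ρ v)
      (TensorProduct.map (orb σ w) (orb τ x) ∘ₗ Coalgebra.comul (R := k) (A := H)) s =
      TensorProduct.map (orb ρ v) (TensorProduct.map (orb σ w) (orb τ x))
        ((Coalgebra.comul (R := k) (A := H)).lTensor H s) := by
    intro s
    induction s with
    | zero => simp
    | add x y hx hy => simp only [map_add, hx, hy]
    | tmul a b => simp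
  rw [e₁, e₂, Coalgebra.coassoc_apply]

variable (k H) in
/-- The trivial action of `H` on `k` through the counit. -/
def trivAct : H →ₐ[k] Module.End k k :=
  (Algebra.ofId k (Module.End k k)).comp (Bialgebra.counitAlgHom k H)

@[simp] lemma trivAct_apply (h : H) (r : k) :
    trivAct k H h r = Coalgebra.counit (R := k) h * r := rfl

lemma tensorAct_lid (σ : H →ₐ[k] Module.End k W) (h : H) (t : k ⊗[k] W) :
    TensorProduct.lid k W (tensorAct (trivAct k H) σ h t) =
      σ h (TensorProduct.lid k W t) := by
  induction t with
  | zero => simp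
  | add x y hx hy => simp only [map_add, hx, hy]
  | tmul r w =>
    rw [tensorAct_tmul]
    have e : ∀ s : H ⊗[k] H, TensorProduct.lid k W
        (TensorProduct.map (orb (trivAct k H) r) (orb σ w) s) =
        r • orb σ w (TensorProduct.lid k H
          ((Coalgebra.counit (R := k) (A := H)).rTensor H s)) := by
      intro s
      induction s with
      | zero => simp
      | add x y hx hy => simp only [map_add, smul_add, hx, hy]
      | tmul a b => simp [smul_smul, mul_comm]
    rw [e, Coalgebra.rTensor_counit_comul]
    simp

lemma tensorAct_rid (σ : H →ₐ[k] Module.End k W) (h : H) (t : W ⊗[k] k) :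
    TensorProduct.rid k W (tensorAct σ (trivAct k H) h t) =
      σ h (TensorProduct.rid k W t) := by
  induction t with
  | zero => simp
  | add x y hx hy => simp only [map_add, hx, hy]
  | tmul w r =>
    rw [tensorAct_tmul]
    have e : ∀ s : H ⊗[k] H, TensorProduct.rid k W
        (TensorProduct.map (orb σ w) (orb (trivAct k H) r) s) =
        r • orb σ w (TensorProduct.rid k H
          ((Coalgebra.counit (R := k) (A := H)).lTensor H s)) := by
      intro s
      induction s with
      | zero => simp
      | add x y hx hy => simp only [map_add, smul_add, hx, hy]
      | tmul a b => simp [smul_smul, mul_comm]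
    rw [e, Coalgebra.lTensor_counit_comul]
    simp

end

/-- Left `H`-modules, given as `k`-vector spaces with an algebra map `H → End_k(V)`. -/
structure HMod (k : Type u) [Field k] (H : Type u) [Ring H] [Bialgebra k H] where
  V : Type u
  [addCommGroup : AddCommGroup V]
  [module : Module k V]
  act : H →ₐ[k] Module.End k V

attribute [instance] HMod.addCommGroup HMod.module

namespace HMod

/-- The category of left `H`-modules and `H`-linear maps. -/
instance : Category (HMod k H) where
  Hom X Y := {f : X.V →ₗ[k] Y.V // ∀ h x, f (X.act h x) = Y.act h (f x)}
  id X := ⟨LinearMap.id, fun _ _ => rfl⟩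
  comp f g := ⟨g.1 ∘ₗ f.1, fun h x => by
    rw [LinearMap.comp_apply, f.2, g.2, LinearMap.comp_apply]⟩

/-- The `k`-linear map underlying an `H`-linear map. -/
def lin {X Y : HMod k H} (f : X ⟶ Y) : X.V →ₗ[k] Y.V := f.1

lemma lin_comm {X Y : HMod k H} (f : X ⟶ Y) (h : H) (x : X.V) :
    lin f (X.act h x) = Y.act h (lin f x) := f.2 h x

@[ext] lemma hom_ext {X Y : HMod k H} {f g : X ⟶ Y} (h : lin f = lin g) : f = g :=
  Subtype.ext h

@[simp] lemma lin_id (X : HMod k H) : lin (𝟙 X) = LinearMap.id := rfl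

@[simp] lemma lin_comp {X Y Z : HMod k H} (f : X ⟶ Y) (g : Y ⟶ Z) :
    lin (f ≫ g) = lin g ∘ₗ lin f := rfl

/-- Build a morphism of `H`-modules. -/
def mkHom {X Y : HMod k H} (f : X.V →ₗ[k] Y.V) (h : ∀ h x, f (X.act h x) = Y.act h (f x)) :
    X ⟶ Y := ⟨f, h⟩

@[simp] lemma lin_mkHom {X Y : HMod k H} (f : X.V →ₗ[k] Y.V) (h) :
    lin (mkHom (X := X) (Y := Y) f h) = f := rfl

/-- Build an isomorphism of `H`-modules. -/
def mkIso {X Y : HMod k H} (e : X.V ≃ₗ[k] Y.V) (h : ∀ h x, e (X.act h x) = Y.act h (e x)) :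
    X ≅ Y where
  hom := mkHom e.toLinearMap h
  inv := mkHom e.symm.toLinearMap fun a y => by
    apply e.injective
    change e (e.symm (Y.act a y)) = e (X.act a (e.symm y))
    rw [h, e.apply_symm_apply, e.apply_symm_apply]
  hom_inv_id := by ext x; simp
  inv_hom_id := by ext x; simp

@[simp] lemma lin_mkIso_hom {X Y : HMod k H} (e : X.V ≃ₗ[k] Y.V) (h) :
    lin (mkIso (X := X) (Y := Y) e h).hom = e.toLinearMap := rfl

@[simp] lemma lin_mkIso_inv {X Y : HMod k H} (e : X.V ≃ₗ[k] Y.V) (h) :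
    lin (mkIso (X := X) (Y := Y) e h).inv = e.symm.toLinearMap := rfl

/-- The tensor product of `H`-modules, with the diagonal action. -/
def tensor (X Y : HMod k H) : HMod k H where
  V := X.V ⊗[k] Y.V
  act := tensorAct X.act Y.act

/-- The tensor product of `H`-linear maps. -/
def tensorMap {X X' Y Y' : HMod k H} (f : X ⟶ X') (g : Y ⟶ Y') : tensor X Y ⟶ tensor X' Y' :=
  mkHom (TensorProduct.map (lin f) (lin g)) (tensorAct_map (lin_comm f) (lin_comm g))

instance : MonoidalCategoryStruct (HMod k H) where
  tensorObj X Y := tensor X Y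
  whiskerLeft X _ _ f := tensorMap (𝟙 X) f
  whiskerRight f Y := tensorMap f (𝟙 Y)
  tensorHom f g := tensorMap f g
  tensorUnit := { V := k, act := trivAct k H }
  associator X Y Z := mkIso (TensorProduct.assoc k X.V Y.V Z.V)
    (tensorAct_assoc X.act Y.act Z.act)
  leftUnitor X := mkIso (TensorProduct.lid k X.V) (tensorAct_lid X.act)
  rightUnitor X := mkIso (TensorProduct.rid k X.V) (tensorAct_rid X.act)

/-- The monoidal category of left `H`-modules. -/
instance : MonoidalCategory (HMod k H) where
  tensorHom_def f g := by
    apply hom_ext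
    refine TensorProduct.ext' fun x y => rfl
  id_tensorHom_id X Y := by
    apply hom_ext
    refine TensorProduct.ext' fun x y => rfl
  tensorHom_comp_tensorHom f g f' g' := by
    apply hom_ext
    refine TensorProduct.ext' fun x y => rfl
  whiskerLeft_id X Y := by
    apply hom_ext
    refine TensorProduct.ext' fun x y => rfl
  id_whiskerRight X Y := by
    apply hom_ext
    refine TensorProduct.ext' fun x y => rfl
  associator_naturality f g h := by
    apply hom_ext
    refine TensorProduct.ext_threefold fun x y z => rfl
  leftUnitor_naturality {X Y} f := by
    apply hom_ext
    refine TensorProduct.ext' fun r x => ?_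
    exact ((lin f).map_smul r x).symm
  rightUnitor_naturality {X Y} f := by
    apply hom_ext
    refine TensorProduct.ext' fun x r => ?_
    exact ((lin f).map_smul r x).symm
  pentagon X Y Z W := by
    apply hom_ext
    refine TensorProduct.ext_fourfold fun x y z w => rfl
  triangle X Y := by
    apply hom_ext
    refine TensorProduct.ext_threefold fun x r y => ?_
    exact (TensorProduct.smul_tmul (show k from r) x y).symm

end HMod

end HModules

/-! ### Left `C`-comodules in the category of left `H`-modules -/

section LeftComodules

/-- Left `C`-comodules in the monoidal category of left `H`-modules, for a left `H`-module
coalgebra `C`: left `H`-modules with a left `C`-coaction which is `H`-linear, that is,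
`(h v)₍₋₁₎ ⊗ (h v)₍₀₎ = h₍₁₎ v₍₋₁₎ ⊗ h₍₂₎ v₍₀₎`. -/
structure LHComod (k : Type u) [Field k] (H : Type u) [Ring H] [Bialgebra k H]
    (C : Type u) [AddCommGroup C] [Module k C] [Coalgebra k C] [Module H C]
    [IsScalarTower k H C] extends HMod k H where
  coact : V →ₗ[k] C ⊗[k] V
  coassoc : TensorProduct.assoc k C C V ∘ₗ
      (Coalgebra.comul (R := k) (A := C)).rTensor V ∘ₗ coact =
    coact.lTensor C ∘ₗ coact
  counit : TensorProduct.lid k V ∘ₗ (Coalgebra.counit (R := k) (A := C)).rTensor V ∘ₗ coact =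
    LinearMap.id
  coact_act (h : H) (v : V) :
    coact (act h v) = tensorAct (Algebra.lsmul k k C) act h (coact v)

namespace LHComod

variable {k : Type u} [Field k] {H : Type u} [Ring H] [Bialgebra k H]
  {C : Type u} [AddCommGroup C] [Module k C] [Coalgebra k C] [Module H C] [IsScalarTower k H C]

/-- The space of `H`-linear and `C`-colinear maps. -/
def homs (X Y : LHComod k H C) : Submodule k (X.V →ₗ[k] Y.V) where
  carrier := {f | (∀ h x, f (X.act h x) = Y.act h (f x)) ∧
    ∀ x, Y.coact (f x) = f.lTensor C (X.coact x)}
  zero_mem' := by simp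
  add_mem' {f g} hf hg := by
    simp only [Set.mem_ofPred_eq] at *
    refine ⟨fun h x => ?_, fun x => ?_⟩
    · simp [hf.1, hg.1]
    · simp [hf.2, hg.2, LinearMap.lTensor_add]
  smul_mem' c f hf := by
    simp only [Set.mem_ofPred_eq] at *
    refine ⟨fun h x => ?_, fun x => ?_⟩
    · simp [hf.1]
    · simp [hf.2, LinearMap.lTensor_smul]

/-- The category of left `C`-comodules in the category of left `H`-modules. -/
instance : Category (LHComod k H C) where
  Hom X Y := homs X Y
  id X := ⟨LinearMap.id, fun _ _ => rfl, by simp⟩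
  comp {X Y Z} f g := ⟨g.1 ∘ₗ f.1, fun h x => by
      rw [LinearMap.comp_apply, f.2.1, g.2.1, LinearMap.comp_apply], fun x => by
      rw [LinearMap.comp_apply, g.2.2, f.2.2, LinearMap.lTensor_comp, LinearMap.comp_apply]⟩

/-- The `k`-linear map underlying a morphism. -/
def lin {X Y : LHComod k H C} (f : X ⟶ Y) : X.V →ₗ[k] Y.V := f.1

lemma lin_act {X Y : LHComod k H C} (f : X ⟶ Y) (h : H) (x : X.V) :
    lin f (X.act h x) = Y.act h (lin f x) := f.2.1 h x

lemma lin_coact {X Y : LHComod k H C} (f : X ⟶ Y) (x : X.V) :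
    Y.coact (lin f x) = (lin f).lTensor C (X.coact x) := f.2.2 x

@[ext] lemma hom_ext {X Y : LHComod k H C} {f g : X ⟶ Y} (h : lin f = lin g) : f = g :=
  Subtype.ext h

@[simp] lemma lin_id (X : LHComod k H C) : lin (𝟙 X) = LinearMap.id := rfl

@[simp] lemma lin_comp {X Y Z : LHComod k H C} (f : X ⟶ Y) (g : Y ⟶ Z) :
    lin (f ≫ g) = lin g ∘ₗ lin f := rfl

/-- Build a morphism. -/
def mkHom {X Y : LHComod k H C} (f : X.V →ₗ[k] Y.V)
    (h₁ : ∀ h x, f (X.act h x) = Y.act h (f x))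
    (h₂ : ∀ x, Y.coact (f x) = f.lTensor C (X.coact x)) : X ⟶ Y := ⟨f, h₁, h₂⟩

@[simp] lemma lin_mkHom {X Y : LHComod k H C} (f : X.V →ₗ[k] Y.V) (h₁ h₂) :
    lin (mkHom (X := X) (Y := Y) f h₁ h₂) = f := rfl

/-- Build an isomorphism. -/
def mkIso {X Y : LHComod k H C} (e : X.V ≃ₗ[k] Y.V)
    (h₁ : ∀ h x, e (X.act h x) = Y.act h (e x))
    (h₂ : ∀ x, Y.coact (e x) = e.toLinearMap.lTensor C (X.coact x)) : X ≅ Y where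
  hom := mkHom e.toLinearMap h₁ h₂
  inv := mkHom e.symm.toLinearMap
    (fun a y => by
      apply e.injective
      change e (e.symm (Y.act a y)) = e (X.act a (e.symm y))
      rw [h₁, e.apply_symm_apply, e.apply_symm_apply])
    (fun y => by
      obtain ⟨x, rfl⟩ := e.surjective y
      change X.coact (e.symm (e x)) = e.symm.toLinearMap.lTensor C (Y.coact (e x))
      rw [h₂, ← LinearMap.comp_apply, ← LinearMap.lTensor_comp]
      simp)
  hom_inv_id := by ext x; simp
  inv_hom_id := by ext x; simp

@[simp] lemma lin_mkIso_hom {X Y : LHComod k H C} (e : X.V ≃ₗ[k] Y.V) (h₁ h₂) :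
    lin (mkIso (X := X) (Y := Y) e h₁ h₂).hom = e.toLinearMap := rfl

@[simp] lemma lin_mkIso_inv {X Y : LHComod k H C} (e : X.V ≃ₗ[k] Y.V) (h₁ h₂) :
    lin (mkIso (X := X) (Y := Y) e h₁ h₂).inv = e.symm.toLinearMap := rfl

instance : Preadditive (LHComod k H C) where
  homGroup X Y := inferInstanceAs (AddCommGroup (homs X Y))
  add_comp _ _ _ _ _ _ := Subtype.ext (LinearMap.comp_add _ _ _)
  comp_add _ _ _ _ _ _ := Subtype.ext (LinearMap.add_comp _ _ _)

instance : Linear k (LHComod k H C) where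
  homModule X Y := inferInstanceAs (Module k (homs X Y))
  smul_comp _ _ _ _ _ _ := Subtype.ext (LinearMap.comp_smul _ _ _)
  comp_smul _ _ _ _ _ _ := Subtype.ext (LinearMap.smul_comp _ _ _)

/-- The object `N ⊗ X`, with the coaction of `N` and the diagonal action of `H`. -/
def tensor (N : LHComod k H C) (X : HMod k H) : LHComod k H C where
  toHMod := HMod.tensor N.toHMod X
  coact := (TensorProduct.assoc k C N.V X.V).toLinearMap ∘ₗ N.coact.rTensor X.V
  coassoc := by
    refine TensorProduct.ext' fun n x => ?_
    have hn := LinearMap.congr_fun N.coassoc n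
    simp only [LinearMap.comp_apply, LinearEquiv.coe_coe] at hn
    change TensorProduct.assoc k C C (N.V ⊗[k] X.V) ((Coalgebra.comul (R := k)).rTensor
      (N.V ⊗[k] X.V) (TensorProduct.assoc k C N.V X.V (N.coact n ⊗ₜ x))) =
      ((TensorProduct.assoc k C N.V X.V).toLinearMap ∘ₗ N.coact.rTensor X.V).lTensor C
        (TensorProduct.assoc k C N.V X.V (N.coact n ⊗ₜ x))
    have e₁ : ∀ s : C ⊗[k] N.V, TensorProduct.assoc k C C (N.V ⊗[k] X.V)
        ((Coalgebra.comul (R := k)).rTensor (N.V ⊗[k] X.V)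
          (TensorProduct.assoc k C N.V X.V (s ⊗ₜ x))) =
        ((TensorProduct.assoc k C N.V X.V).toLinearMap.lTensor C)
          (TensorProduct.assoc k C (C ⊗[k] N.V) X.V
          (TensorProduct.assoc k C C N.V ((Coalgebra.comul (R := k)).rTensor N.V s) ⊗ₜ x)) := by
      intro s
      induction s with
      | zero => simp
      | add x y hx hy => simp only [map_add, TensorProduct.add_tmul, hx, hy]
      | tmul a b =>
        simp only [TensorProduct.assoc_tmul, LinearMap.rTensor_tmul]
        generalize Coalgebra.comul (R := k) a = s
        induction s with
        | zero => simp
        | add x y hx hy => simp only [map_add, TensorProduct.add_tmul, hx, hy]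
        | tmul a b => simp
    have e₂ : ∀ s : C ⊗[k] N.V,
        ((TensorProduct.assoc k C N.V X.V).toLinearMap ∘ₗ N.coact.rTensor X.V).lTensor C
          (TensorProduct.assoc k C N.V X.V (s ⊗ₜ x)) =
        ((TensorProduct.assoc k C N.V X.V).toLinearMap.lTensor C)
          (TensorProduct.assoc k C (C ⊗[k] N.V) X.V (N.coact.lTensor C s ⊗ₜ x)) := by
      intro s
      induction s with
      | zero => simp
      | add x y hx hy => simp only [map_add, TensorProduct.add_tmul, hx, hy]
      | tmul a b => simp
    rw [e₁, e₂, hn]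
  counit := by
    refine TensorProduct.ext' fun n x => ?_
    have hn := LinearMap.congr_fun N.counit n
    simp only [LinearMap.comp_apply, LinearEquiv.coe_coe, LinearMap.id_apply] at hn
    change TensorProduct.lid k (N.V ⊗[k] X.V) ((Coalgebra.counit (R := k)).rTensor
      (N.V ⊗[k] X.V) (TensorProduct.assoc k C N.V X.V (N.coact n ⊗ₜ x))) = n ⊗ₜ x
    have e : ∀ s : C ⊗[k] N.V, TensorProduct.lid k (N.V ⊗[k] X.V)
        ((Coalgebra.counit (R := k)).rTensor (N.V ⊗[k] X.V)
          (TensorProduct.assoc k C N.V X.V (s ⊗ₜ x))) =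
        TensorProduct.lid k N.V ((Coalgebra.counit (R := k)).rTensor N.V s) ⊗ₜ x := by
      intro s
      induction s with
      | zero => simp
      | add x y hx hy => simp only [map_add, TensorProduct.add_tmul, hx, hy]
      | tmul a b => simp [TensorProduct.smul_tmul']
    rw [e, hn]
  coact_act h t := by
    suffices ∀ t : N.V ⊗[k] X.V, TensorProduct.assoc k C N.V X.V
        (TensorProduct.map N.coact LinearMap.id (tensorAct N.act X.act h t)) =
        tensorAct (Algebra.lsmul k k C) (tensorAct N.act X.act) h
          (TensorProduct.assoc k C N.V X.V (TensorProduct.map N.coact LinearMap.id t)) from this t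
    intro t
    rw [tensorAct_map (ρ' := tensorAct (Algebra.lsmul k k C) N.act) (σ' := X.act)
      (fun h v => N.coact_act h v) (fun _ _ => rfl), tensorAct_assoc]

/-- The tensor product of morphisms. -/
def tensorMap {N N' : LHComod k H C} {X X' : HMod k H} (f : N ⟶ N') (g : X ⟶ X') :
    tensor N X ⟶ tensor N' X' :=
  mkHom (TensorProduct.map (lin f) (HMod.lin g)) (tensorAct_map (lin_act f) (HMod.lin_comm g))
    fun t => by
      change ((tensor N' X').coact ∘ₗ TensorProduct.map (lin f) (HMod.lin g)) t =
        ((TensorProduct.map (lin f) (HMod.lin g)).lTensor C ∘ₗ (tensor N X).coact) t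
      congr 1
      refine TensorProduct.ext' fun n x => ?_
      change TensorProduct.assoc k C N'.V X'.V (N'.coact (lin f n) ⊗ₜ HMod.lin g x) =
        (TensorProduct.map (lin f) (HMod.lin g)).lTensor C
          (TensorProduct.assoc k C N.V X.V (N.coact n ⊗ₜ x))
      rw [lin_coact]
      generalize N.coact n = s
      induction s with
      | zero => simp
      | add x y hx hy => simp only [map_add, TensorProduct.add_tmul, hx, hy]
      | tmul a b => simp

/-- The category of left `C`-comodules in the category of left `H`-modules is a right module
category over the monoidal category of left `H`-modules. -/
instance : MonoidalRightAction (HMod k H) (LHComod k H C) where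
  actionObj N X := tensor N X
  actionHomLeft f X := tensorMap f (𝟙 X)
  actionHomRight N _ _ g := tensorMap (𝟙 N) g
  actionHom f g := tensorMap f g
  actionAssocIso N X Y := (mkIso (X := tensor (tensor N X) Y) (Y := tensor N (X ⊗ Y))
    (TensorProduct.assoc k N.V X.V Y.V) (tensorAct_assoc N.act X.act Y.act) fun t => by
      change ((tensor N (X ⊗ Y)).coact ∘ₗ (TensorProduct.assoc k N.V X.V Y.V).toLinearMap) t =
        ((TensorProduct.assoc k N.V X.V Y.V).toLinearMap.lTensor C ∘ₗ
          (tensor (tensor N X) Y).coact) t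
      congr 1
      refine TensorProduct.ext_threefold fun n x y => ?_
      change TensorProduct.assoc k C N.V (X.V ⊗[k] Y.V) (N.coact n ⊗ₜ (x ⊗ₜ y)) =
        (TensorProduct.assoc k N.V X.V Y.V).toLinearMap.lTensor C
          (TensorProduct.assoc k C (N.V ⊗[k] X.V) Y.V
            (TensorProduct.assoc k C N.V X.V (N.coact n ⊗ₜ x) ⊗ₜ y))
      generalize N.coact n = s
      induction s with
      | zero => simp
      | add x y hx hy => simp only [map_add, TensorProduct.add_tmul, hx, hy]
      | tmul a b => simp).symm
  actionUnitIso N := mkIso (X := tensor N (𝟙_ (HMod k H))) (Y := N)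
    (TensorProduct.rid k N.V) (tensorAct_rid N.act) fun t => by
      change (N.coact ∘ₗ (TensorProduct.rid k N.V).toLinearMap) t =
        ((TensorProduct.rid k N.V).toLinearMap.lTensor C ∘ₗ
          (tensor N (𝟙_ (HMod k H))).coact) t
      congr 1
      refine TensorProduct.ext' fun n r => ?_
      change N.coact (r • n) = (TensorProduct.rid k N.V).toLinearMap.lTensor C
        (TensorProduct.assoc k C N.V k (N.coact n ⊗ₜ r))
      rw [map_smul]
      generalize N.coact n = s
      induction s with
      | zero => simp
      | add x y hx hy => simp only [map_add, TensorProduct.add_tmul, smul_add, hx, hy]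
      | tmul a b => simp
  actionHom_def f g := by
    apply hom_ext
    refine TensorProduct.ext' fun x y => rfl
  actionHomRight_id X M := by
    apply hom_ext
    refine TensorProduct.ext' fun x y => rfl
  id_actionHomLeft X M := by
    apply hom_ext
    refine TensorProduct.ext' fun x y => rfl
  actionHom_comp f f' g g' := by
    apply hom_ext
    refine TensorProduct.ext' fun x y => rfl
  actionAssocIso_hom_naturality {N N' _ _ _ _} f g h := by
    rw [← Iso.inv_comp_eq, ← Category.assoc, ← Iso.eq_comp_inv]
    apply hom_ext
    refine TensorProduct.ext_threefold fun x y z => rfl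
  actionUnitIso_hom_naturality f := by
    apply hom_ext
    refine TensorProduct.ext' fun x r => ?_
    exact (lin f).map_smul r x
  actionHomRight_whiskerRight {X Y} f Z N := by
    rw [← Iso.inv_comp_eq, Iso.eq_comp_inv]
    apply hom_ext
    refine TensorProduct.ext_threefold fun x y z => rfl
  whiskerRight_actionHomLeft X Y Z f N := by
    rw [← Iso.inv_comp_eq, Iso.eq_comp_inv]
    apply hom_ext
    refine TensorProduct.ext_threefold fun x y z => rfl
  actionHom_associator X Y Z N := by
    apply hom_ext
    exact TensorProduct.ext (LinearMap.ext fun n => TensorProduct.ext_threefold fun x y z => rfl)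
  actionHom_leftUnitor X N := by
    rw [← Iso.inv_comp_eq]
    apply hom_ext
    refine TensorProduct.ext_threefold fun n r x => ?_
    exact (TensorProduct.smul_tmul (show k from r) n x).symm
  actionHom_rightUnitor X N := by
    rw [← Iso.inv_comp_eq]
    apply hom_ext
    refine TensorProduct.ext_threefold fun n x r => ?_
    exact TensorProduct.tmul_smul (show k from r) n x

end LHComod

end LeftComodules

/-! ### Lax module functors and equivalences of module categories -/

section Linear

variable (k : Type u) [Field k]

/-- `F` is a `k`-linear functor. -/
structure IsLinearFunctor {M : Type w₁} [Category.{v₁} M] [Preadditive M] [Linear k M]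
    {N : Type w₂} [Category.{v₂} N] [Preadditive N] [Linear k N] (F : M ⥤ N) : Prop where
  additive : F.Additive
  linear : F.Linear k

/-- `F` is `k`-linear, left exact and preserves small coproducts. -/
structure IsTypeL {M : Type w₁} [Category.{v₁} M] [Preadditive M] [Linear k M]
    {N : Type w₂} [Category.{v₂} N] [Preadditive N] [Linear k N] (F : M ⥤ N) : Prop extends
    IsLinearFunctor k F where
  leftExact : PreservesFiniteLimits F
  coproducts (J : Type u) : PreservesColimitsOfShape (Discrete J) F

variable {M : Type w₁} [Category.{v₁} M] [Preadditive M] [Linear k M]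
  {N : Type w₂} [Category.{v₂} N] [Preadditive N] [Linear k N]
  {P : Type w₃} [Category.{v₃} P] [Preadditive P] [Linear k P]

lemma IsLinearFunctor.id : IsLinearFunctor k (𝟭 M) where
  additive := inferInstance
  linear := inferInstance

variable {k} in
lemma IsLinearFunctor.comp {F : M ⥤ N} {G : N ⥤ P} (hF : IsLinearFunctor k F)
    (hG : IsLinearFunctor k G) : IsLinearFunctor k (F ⋙ G) := by
  have := hF.additive
  have := hG.additive
  have := hF.linear
  have := hG.linear
  exact ⟨inferInstance, inferInstance⟩

lemma IsTypeL.id : IsTypeL k (𝟭 M) where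
  toIsLinearFunctor := .id k
  leftExact := inferInstance
  coproducts _ := inferInstance

variable {k} in
lemma IsTypeL.comp {F : M ⥤ N} {G : N ⥤ P} (hF : IsTypeL k F)
    (hG : IsTypeL k G) : IsTypeL k (F ⋙ G) where
  toIsLinearFunctor := hF.toIsLinearFunctor.comp hG.toIsLinearFunctor
  leftExact := by
    have := hF.leftExact
    have := hG.leftExact
    exact comp_preservesFiniteLimits F G
  coproducts J := by
    have := hF.coproducts J
    have := hG.coproducts J
    infer_instance

end Linear

section LeftModules

open MonoidalLeftAction Functor.LaxLeftLinear

/-- Lax left `𝒜`-module functors. -/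
structure LaxModFun (𝒜 : Type w₁) [Category.{v₁} 𝒜] [MonoidalCategory 𝒜]
    (M : Type w₂) [Category.{v₂} M] [MonoidalLeftAction 𝒜 M]
    (N : Type w₃) [Category.{v₃} N] [MonoidalLeftAction 𝒜 N] where
  functor : M ⥤ N
  [lax : functor.LaxLeftLinear 𝒜]

attribute [instance] LaxModFun.lax

namespace LaxModFun

variable {𝒜 : Type w₁} [Category.{v₁} 𝒜] [MonoidalCategory 𝒜]
  {M : Type w₂} [Category.{v₂} M] [MonoidalLeftAction 𝒜 M]
  {N : Type w₃} [Category.{v₃} N] [MonoidalLeftAction 𝒜 N]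
  {P : Type w₄} [Category.{v₄} P] [MonoidalLeftAction 𝒜 P]

/-- Morphisms of lax module functors: natural transformations compatible with the structure
morphisms. -/
def IsModuleNat (F G : LaxModFun 𝒜 M N) (α : F.functor ⟶ G.functor) : Prop :=
  ∀ (X : 𝒜) (m : M),
    X ⊴ₗ α.app m ≫ μₗ G.functor X m = μₗ F.functor X m ≫ α.app (X ⊙ₗ m)

/-- The category of lax left `𝒜`-module functors from `M` to `N`. -/
instance : Category (LaxModFun 𝒜 M N) where
  Hom F G := {α : F.functor ⟶ G.functor // IsModuleNat F G α}
  id F := ⟨𝟙 _, fun X m => by simp⟩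
  comp {F G K} α β := ⟨α.1 ≫ β.1, fun X m => by
    rw [NatTrans.comp_app, NatTrans.comp_app, actionHomRight_comp, Category.assoc, β.2,
      ← Category.assoc, α.2, Category.assoc]⟩

/-- The identity module functor. -/
def id : LaxModFun 𝒜 M M where
  functor := 𝟭 M
  lax := { μₗ X m := 𝟙 (X ⊙ₗ m) }

/-- The composite of two lax module functors. -/
def comp (F : LaxModFun 𝒜 M N) (G : LaxModFun 𝒜 N P) : LaxModFun 𝒜 M P where
  functor := F.functor ⋙ G.functor
  lax :=
    { μₗ X m := μₗ G.functor X (F.functor.obj m) ≫ G.functor.map (μₗ F.functor X m)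
      μₗ_naturality_left f m := by
        simp only [Functor.comp_obj, Functor.comp_map, μₗ_naturality_left_assoc,
          ← Functor.map_comp, μₗ_naturality_left, Category.assoc]
      μₗ_naturality_right X _ _ f := by
        simp only [Functor.comp_obj, Functor.comp_map, μₗ_naturality_right_assoc,
          ← Functor.map_comp, μₗ_naturality_right, Category.assoc]
      μₗ_associativity X Y m := by
        simp only [Functor.comp_obj, Functor.comp_map, Category.assoc, ← Functor.map_comp,
          μₗ_associativity, actionHomRight_comp, μₗ_naturality_right_assoc]
        simp only [Functor.map_comp, μₗ_associativity_assoc]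
      μₗ_unitality m := by
        simp only [Functor.comp_obj, Functor.comp_map, Category.assoc, ← Functor.map_comp,
          ← μₗ_unitality] }

end LaxModFun

/-- `M` and `N` are equivalent as `k`-linear left `𝒜`-module categories. -/
def LeftModEquivalent (k : Type u) [Field k] (𝒜 : Type w₁) [Category.{v₁} 𝒜] [MonoidalCategory 𝒜]
    (M : Type w₂) [Category.{v₂} M] [Preadditive M] [Linear k M] [MonoidalLeftAction 𝒜 M]
    (N : Type w₃) [Category.{v₃} N] [Preadditive N] [Linear k N] [MonoidalLeftAction 𝒜 N] :
    Prop :=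
  ∃ (F : LaxModFun 𝒜 M N) (G : LaxModFun 𝒜 N M),
    IsLinearFunctor k F.functor ∧ IsLinearFunctor k G.functor ∧
      Nonempty (F.comp G ≅ LaxModFun.id) ∧ Nonempty (G.comp F ≅ LaxModFun.id)

/-- Lax left `𝒜`-module functors whose underlying functor is `k`-linear, left exact and preserves
small coproducts. -/
structure LLax (k : Type u) [Field k] (𝒜 : Type w₁) [Category.{v₁} 𝒜] [MonoidalCategory 𝒜]
    (M : Type w₂) [Category.{v₂} M] [Preadditive M] [Linear k M] [MonoidalLeftAction 𝒜 M]
    (N : Type w₃) [Category.{v₃} N] [Preadditive N] [Linear k N] [MonoidalLeftAction 𝒜 N]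
    extends LaxModFun 𝒜 M N where
  typeL : IsTypeL k functor

namespace LLax

variable {k : Type u} [Field k] {𝒜 : Type w₁} [Category.{v₁} 𝒜] [MonoidalCategory 𝒜]
  {M : Type w₂} [Category.{v₂} M] [Preadditive M] [Linear k M] [MonoidalLeftAction 𝒜 M]
  {N : Type w₃} [Category.{v₃} N] [Preadditive N] [Linear k N] [MonoidalLeftAction 𝒜 N]
  {P : Type w₄} [Category.{v₄} P] [Preadditive P] [Linear k P] [MonoidalLeftAction 𝒜 P]

/-- `LLax k 𝒜 M N` as a full subcategory of the category of lax module functors. -/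
instance : Category (LLax k 𝒜 M N) where
  Hom F G := F.toLaxModFun ⟶ G.toLaxModFun
  id F := 𝟙 F.toLaxModFun
  comp α β := CategoryStruct.comp (obj := LaxModFun 𝒜 M N) α β

/-- The underlying natural transformation of a morphism of module functors. -/
def nat {F G : LLax k 𝒜 M N} (α : F ⟶ G) : F.functor ⟶ G.functor := α.1

lemma nat_comm {F G : LLax k 𝒜 M N} (α : F ⟶ G) (X : 𝒜) (m : M) :
    X ⊴ₗ (nat α).app m ≫ μₗ G.functor X m = μₗ F.functor X m ≫ (nat α).app (X ⊙ₗ m) :=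
  α.2 X m

/-- Build a morphism of module functors. -/
def mkHom {F G : LLax k 𝒜 M N} (α : F.functor ⟶ G.functor)
    (h : LaxModFun.IsModuleNat F.toLaxModFun G.toLaxModFun α) : F ⟶ G := ⟨α, h⟩

@[ext] lemma hom_ext {F G : LLax k 𝒜 M N} {α β : F ⟶ G}
    (h : ∀ m, (nat α).app m = (nat β).app m) : α = β :=
  Subtype.ext (NatTrans.ext (funext h))

@[simp] lemma nat_mkHom {F G : LLax k 𝒜 M N} (α : F.functor ⟶ G.functor) (h) :
    nat (mkHom (F := F) (G := G) α h) = α := rfl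

@[simp] lemma nat_id (F : LLax k 𝒜 M N) : nat (𝟙 F) = 𝟙 F.functor := rfl

@[simp] lemma nat_comp {F G K : LLax k 𝒜 M N} (α : F ⟶ G) (β : G ⟶ K) :
    nat (α ≫ β) = nat α ≫ nat β := rfl

/-- Build an isomorphism of module functors. -/
def mkIso {F G : LLax k 𝒜 M N} (e : F.functor ≅ G.functor)
    (h : LaxModFun.IsModuleNat F.toLaxModFun G.toLaxModFun e.hom) : F ≅ G where
  hom := mkHom e.hom h
  inv := mkHom e.inv fun X m => by
    have := h X m
    rw [← cancel_mono (e.hom.app (X ⊙ₗ m)), Category.assoc, Category.assoc, ← this,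
      ← actionHomRight_comp_assoc]
    simp
  hom_inv_id := by
    ext m
    exact e.hom_inv_id_app m
  inv_hom_id := by
    ext m
    exact e.inv_hom_id_app m

@[simp] lemma nat_mkIso_hom {F G : LLax k 𝒜 M N} (e : F.functor ≅ G.functor) (h) :
    nat (mkIso (F := F) (G := G) e h).hom = e.hom := rfl

@[simp] lemma nat_mkIso_inv {F G : LLax k 𝒜 M N} (e : F.functor ≅ G.functor) (h) :
    nat (mkIso (F := F) (G := G) e h).inv = e.inv := rfl

variable (k 𝒜 M) in
/-- The identity module functor. -/
def id : LLax k 𝒜 M M where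
  toLaxModFun := LaxModFun.id
  typeL := IsTypeL.id k

/-- The composite of module functors. -/
def comp (F : LLax k 𝒜 M N) (G : LLax k 𝒜 N P) : LLax k 𝒜 M P where
  toLaxModFun := F.toLaxModFun.comp G.toLaxModFun
  typeL := F.typeL.comp G.typeL

@[simp] lemma id_functor : (id k 𝒜 M).functor = 𝟭 M := rfl

@[simp] lemma comp_functor (F : LLax k 𝒜 M N) (G : LLax k 𝒜 N P) :
    (F.comp G).functor = F.functor ⋙ G.functor := rfl

@[simp] lemma id_μ (X : 𝒜) (m : M) : μₗ (id k 𝒜 M).functor X m = 𝟙 (X ⊙ₗ m) := rfl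

@[simp] lemma comp_μ (F : LLax k 𝒜 M N) (G : LLax k 𝒜 N P) (X : 𝒜) (m : M) :
    μₗ (F.comp G).functor X m =
      μₗ G.functor X (F.functor.obj m) ≫ G.functor.map (μₗ F.functor X m) := rfl

/-- Whiskering `F ⋙ α`. -/
def whiskerL (F : LLax k 𝒜 M N) {G G' : LLax k 𝒜 N P} (α : G ⟶ G') :
    F.comp G ⟶ F.comp G' :=
  mkHom (F.functor.whiskerLeft (nat α)) fun X m => by
    have := nat_comm α X (F.functor.obj m)
    change X ⊴ₗ (nat α).app (F.functor.obj m) ≫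
      μₗ G'.functor X (F.functor.obj m) ≫ G'.functor.map (μₗ F.functor X m) =
      (μₗ G.functor X (F.functor.obj m) ≫ G.functor.map (μₗ F.functor X m)) ≫
        (nat α).app (F.functor.obj (X ⊙ₗ m))
    rw [← Category.assoc, this, Category.assoc, Category.assoc, (nat α).naturality]

/-- Whiskering `α ⋙ G`. -/
def whiskerR {F F' : LLax k 𝒜 M N} (α : F ⟶ F') (G : LLax k 𝒜 N P) :
    F.comp G ⟶ F'.comp G :=
  mkHom (Functor.whiskerRight (nat α) G.functor) fun X m => by
    have := nat_comm α X m
    change X ⊴ₗ G.functor.map ((nat α).app m) ≫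
      μₗ G.functor X (F'.functor.obj m) ≫ G.functor.map (μₗ F'.functor X m) =
      (μₗ G.functor X (F.functor.obj m) ≫ G.functor.map (μₗ F.functor X m)) ≫
        G.functor.map ((nat α).app (X ⊙ₗ m))
    rw [μₗ_naturality_right_assoc, Category.assoc, ← Functor.map_comp, ← Functor.map_comp, this]

@[simp] lemma nat_whiskerL_app (F : LLax k 𝒜 M N) {G G' : LLax k 𝒜 N P} (α : G ⟶ G') (m : M) :
    (nat (whiskerL F α)).app m = (nat α).app (F.functor.obj m) := rfl

@[simp] lemma nat_whiskerR_app {F F' : LLax k 𝒜 M N} (α : F ⟶ F') (G : LLax k 𝒜 N P) (m : M) :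
    (nat (whiskerR α G)).app m = G.functor.map ((nat α).app m) := rfl

/-- The associator, with identity components. -/
def assoc {Q : Type w₅} [Category.{v₅} Q] [Preadditive Q] [Linear k Q] [MonoidalLeftAction 𝒜 Q]
    (F : LLax k 𝒜 M N) (G : LLax k 𝒜 N P) (K : LLax k 𝒜 P Q) :
    (F.comp G).comp K ≅ F.comp (G.comp K) :=
  mkIso (Functor.associator F.functor G.functor K.functor) fun X m => by
    change X ⊴ₗ 𝟙 _ ≫ (μₗ K.functor X _ ≫ K.functor.map (μₗ G.functor X _)) ≫
      K.functor.map (G.functor.map (μₗ F.functor X m)) =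
      (μₗ K.functor X _ ≫ K.functor.map (μₗ G.functor X _ ≫
        G.functor.map (μₗ F.functor X m))) ≫ 𝟙 _
    simp

/-- The left unitor, with identity components. -/
def leftUnitor (F : LLax k 𝒜 M N) : (id k 𝒜 M).comp F ≅ F :=
  mkIso (Functor.leftUnitor F.functor) fun X m => by
    change X ⊴ₗ 𝟙 _ ≫ μₗ F.functor X m = (μₗ F.functor X m ≫ F.functor.map (𝟙 _)) ≫ 𝟙 _
    simp

/-- The right unitor, with identity components. -/
def rightUnitor (F : LLax k 𝒜 M N) : F.comp (id k 𝒜 N) ≅ F :=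
  mkIso (Functor.rightUnitor F.functor) fun X m => by
    change X ⊴ₗ 𝟙 _ ≫ μₗ F.functor X m = (𝟙 _ ≫ μₗ F.functor X m) ≫ 𝟙 _
    simp

section

variable {Q : Type w₅} [Category.{v₅} Q] [Preadditive Q] [Linear k Q] [MonoidalLeftAction 𝒜 Q]
  (F : LLax k 𝒜 M N) (G : LLax k 𝒜 N P) (K : LLax k 𝒜 P Q) (m : M)

@[simp] lemma nat_assoc_hom_app : (nat (assoc F G K).hom).app m = 𝟙 _ := rfl
@[simp] lemma nat_assoc_inv_app : (nat (assoc F G K).inv).app m = 𝟙 _ := rfl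
@[simp] lemma nat_leftUnitor_hom_app : (nat (leftUnitor F).hom).app m = 𝟙 _ := rfl
@[simp] lemma nat_leftUnitor_inv_app : (nat (leftUnitor F).inv).app m = 𝟙 _ := rfl
@[simp] lemma nat_rightUnitor_hom_app : (nat (rightUnitor F).hom).app m = 𝟙 _ := rfl
@[simp] lemma nat_rightUnitor_inv_app : (nat (rightUnitor F).inv).app m = 𝟙 _ := rfl

end

end LLax

end LeftModules

section RightModules

open MonoidalRightAction Functor.LaxRightLinear

/-- Lax right `𝒜`-module functors. -/
structure LaxRModFun (𝒜 : Type w₁) [Category.{v₁} 𝒜] [MonoidalCategory 𝒜]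
    (M : Type w₂) [Category.{v₂} M] [MonoidalRightAction 𝒜 M]
    (N : Type w₃) [Category.{v₃} N] [MonoidalRightAction 𝒜 N] where
  functor : M ⥤ N
  [lax : functor.LaxRightLinear 𝒜]

attribute [instance] LaxRModFun.lax

namespace LaxRModFun

variable {𝒜 : Type w₁} [Category.{v₁} 𝒜] [MonoidalCategory 𝒜]
  {M : Type w₂} [Category.{v₂} M] [MonoidalRightAction 𝒜 M]
  {N : Type w₃} [Category.{v₃} N] [MonoidalRightAction 𝒜 N]
  {P : Type w₄} [Category.{v₄} P] [MonoidalRightAction 𝒜 P]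

/-- Morphisms of lax module functors: natural transformations compatible with the structure
morphisms. -/
def IsModuleNat (F G : LaxRModFun 𝒜 M N) (α : F.functor ⟶ G.functor) : Prop :=
  ∀ (m : M) (X : 𝒜),
    α.app m ⊵ᵣ X ≫ μᵣ G.functor m X = μᵣ F.functor m X ≫ α.app (m ⊙ᵣ X)

/-- The category of lax right `𝒜`-module functors from `M` to `N`. -/
instance : Category (LaxRModFun 𝒜 M N) where
  Hom F G := {α : F.functor ⟶ G.functor // IsModuleNat F G α}
  id F := ⟨𝟙 _, fun X m => by simp⟩
  comp {F G K} α β := ⟨α.1 ≫ β.1, fun m X => by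
    rw [NatTrans.comp_app, NatTrans.comp_app, comp_actionHomLeft, Category.assoc, β.2,
      ← Category.assoc, α.2, Category.assoc]⟩

/-- The identity module functor. -/
def id : LaxRModFun 𝒜 M M where
  functor := 𝟭 M
  lax := { μᵣ m X := 𝟙 (m ⊙ᵣ X) }

/-- The composite of two lax module functors. -/
def comp (F : LaxRModFun 𝒜 M N) (G : LaxRModFun 𝒜 N P) : LaxRModFun 𝒜 M P where
  functor := F.functor ⋙ G.functor
  lax :=
    { μᵣ m X := μᵣ G.functor (F.functor.obj m) X ≫ G.functor.map (μᵣ F.functor m X)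
      μᵣ_naturality_right m _ _ f := by
        simp only [Functor.comp_obj, Functor.comp_map, μᵣ_naturality_right_assoc,
          ← Functor.map_comp, μᵣ_naturality_right, Category.assoc]
      μᵣ_naturality_left f X := by
        simp only [Functor.comp_obj, Functor.comp_map, μᵣ_naturality_left_assoc,
          ← Functor.map_comp, μᵣ_naturality_left, Category.assoc]
      μᵣ_associativity m X Y := by
        simp only [Functor.comp_obj, Functor.comp_map, Category.assoc, ← Functor.map_comp,
          μᵣ_associativity, comp_actionHomLeft, μᵣ_naturality_left_assoc]
        simp only [Functor.map_comp, μᵣ_associativity_assoc]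
      μᵣ_unitality m := by
        simp only [Functor.comp_obj, Functor.comp_map, Category.assoc, ← Functor.map_comp,
          ← μᵣ_unitality] }

end LaxRModFun

/-- `M` and `N` are equivalent as `k`-linear right `𝒜`-module categories. -/
def RightModEquivalent (k : Type u) [Field k] (𝒜 : Type w₁) [Category.{v₁} 𝒜]
    [MonoidalCategory 𝒜]
    (M : Type w₂) [Category.{v₂} M] [Preadditive M] [Linear k M] [MonoidalRightAction 𝒜 M]
    (N : Type w₃) [Category.{v₃} N] [Preadditive N] [Linear k N] [MonoidalRightAction 𝒜 N] :
    Prop :=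
  ∃ (F : LaxRModFun 𝒜 M N) (G : LaxRModFun 𝒜 N M),
    IsLinearFunctor k F.functor ∧ IsLinearFunctor k G.functor ∧
      Nonempty (F.comp G ≅ LaxRModFun.id) ∧ Nonempty (G.comp F ≅ LaxRModFun.id)

/-- Strong right `𝒜`-module functors (the structure morphism is invertible) whose underlying
functor is `k`-linear. -/
structure RStrong (k : Type u) [Field k] (𝒜 : Type w₁) [Category.{v₁} 𝒜] [MonoidalCategory 𝒜]
    (M : Type w₂) [Category.{v₂} M] [Preadditive M] [Linear k M] [MonoidalRightAction 𝒜 M]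
    (N : Type w₃) [Category.{v₃} N] [Preadditive N] [Linear k N] [MonoidalRightAction 𝒜 N]
    extends LaxRModFun 𝒜 M N where
  linear : IsLinearFunctor k functor
  strong (m : M) (X : 𝒜) : IsIso (μᵣ functor m X)

/-- Left exact strong right `𝒜`-module functors. -/
structure RLex (k : Type u) [Field k] (𝒜 : Type w₁) [Category.{v₁} 𝒜] [MonoidalCategory 𝒜]
    (M : Type w₂) [Category.{v₂} M] [Preadditive M] [Linear k M] [MonoidalRightAction 𝒜 M]
    (N : Type w₃) [Category.{v₃} N] [Preadditive N] [Linear k N] [MonoidalRightAction 𝒜 N]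
    extends RStrong k 𝒜 M N where
  leftExact : PreservesFiniteLimits functor

namespace RLex

variable {k : Type u} [Field k] {𝒜 : Type w₁} [Category.{v₁} 𝒜] [MonoidalCategory 𝒜]
  {M : Type w₂} [Category.{v₂} M] [Preadditive M] [Linear k M] [MonoidalRightAction 𝒜 M]
  {N : Type w₃} [Category.{v₃} N] [Preadditive N] [Linear k N] [MonoidalRightAction 𝒜 N]
  {P : Type w₄} [Category.{v₄} P] [Preadditive P] [Linear k P] [MonoidalRightAction 𝒜 P]

/-- `RLex k 𝒜 M N` as a full subcategory of the category of lax module functors. -/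
instance : Category (RLex k 𝒜 M N) where
  Hom F G := F.toLaxRModFun ⟶ G.toLaxRModFun
  id F := 𝟙 F.toLaxRModFun
  comp α β := CategoryStruct.comp (obj := LaxRModFun 𝒜 M N) α β

/-- The underlying natural transformation of a morphism of module functors. -/
def nat {F G : RLex k 𝒜 M N} (α : F ⟶ G) : F.functor ⟶ G.functor := α.1

lemma nat_comm {F G : RLex k 𝒜 M N} (α : F ⟶ G) (m : M) (X : 𝒜) :
    (nat α).app m ⊵ᵣ X ≫ μᵣ G.functor m X = μᵣ F.functor m X ≫ (nat α).app (m ⊙ᵣ X) :=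
  α.2 m X

/-- Build a morphism of module functors. -/
def mkHom {F G : RLex k 𝒜 M N} (α : F.functor ⟶ G.functor)
    (h : LaxRModFun.IsModuleNat F.toLaxRModFun G.toLaxRModFun α) : F ⟶ G := ⟨α, h⟩

@[ext] lemma hom_ext {F G : RLex k 𝒜 M N} {α β : F ⟶ G}
    (h : ∀ m, (nat α).app m = (nat β).app m) : α = β :=
  Subtype.ext (NatTrans.ext (funext h))

@[simp] lemma nat_mkHom {F G : RLex k 𝒜 M N} (α : F.functor ⟶ G.functor) (h) :
    nat (mkHom (F := F) (G := G) α h) = α := rfl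

@[simp] lemma nat_id (F : RLex k 𝒜 M N) : nat (𝟙 F) = 𝟙 F.functor := rfl

@[simp] lemma nat_comp {F G K : RLex k 𝒜 M N} (α : F ⟶ G) (β : G ⟶ K) :
    nat (α ≫ β) = nat α ≫ nat β := rfl

/-- Build an isomorphism of module functors. -/
def mkIso {F G : RLex k 𝒜 M N} (e : F.functor ≅ G.functor)
    (h : LaxRModFun.IsModuleNat F.toLaxRModFun G.toLaxRModFun e.hom) : F ≅ G where
  hom := mkHom e.hom h
  inv := mkHom e.inv fun m X => by
    have := h m X
    rw [← cancel_mono (e.hom.app (m ⊙ᵣ X)), Category.assoc, Category.assoc, ← this,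
      ← comp_actionHomLeft_assoc]
    simp
  hom_inv_id := by
    ext m
    exact e.hom_inv_id_app m
  inv_hom_id := by
    ext m
    exact e.inv_hom_id_app m

@[simp] lemma nat_mkIso_hom {F G : RLex k 𝒜 M N} (e : F.functor ≅ G.functor) (h) :
    nat (mkIso (F := F) (G := G) e h).hom = e.hom := rfl

@[simp] lemma nat_mkIso_inv {F G : RLex k 𝒜 M N} (e : F.functor ≅ G.functor) (h) :
    nat (mkIso (F := F) (G := G) e h).inv = e.inv := rfl

variable (k 𝒜 M) in
/-- The identity module functor. -/
def id : RLex k 𝒜 M M where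
  toLaxRModFun := LaxRModFun.id
  linear := IsLinearFunctor.id k
  strong m X := inferInstanceAs (IsIso (𝟙 (m ⊙ᵣ X)))
  leftExact := inferInstanceAs (PreservesFiniteLimits (𝟭 M))

/-- The composite of module functors. -/
def comp (F : RLex k 𝒜 M N) (G : RLex k 𝒜 N P) : RLex k 𝒜 M P where
  toLaxRModFun := F.toLaxRModFun.comp G.toLaxRModFun
  linear := F.linear.comp G.linear
  strong m X := by
    have := F.strong m X
    have := G.strong (F.functor.obj m) X
    exact inferInstanceAs (IsIso (μᵣ G.functor (F.functor.obj m) X ≫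
      G.functor.map (μᵣ F.functor m X)))
  leftExact := by
    have := F.leftExact
    have := G.leftExact
    exact comp_preservesFiniteLimits F.functor G.functor

@[simp] lemma id_functor : (id k 𝒜 M).functor = 𝟭 M := rfl

@[simp] lemma comp_functor (F : RLex k 𝒜 M N) (G : RLex k 𝒜 N P) :
    (F.comp G).functor = F.functor ⋙ G.functor := rfl

@[simp] lemma id_μ (m : M) (X : 𝒜) : μᵣ (id k 𝒜 M).functor m X = 𝟙 (m ⊙ᵣ X) := rfl

@[simp] lemma comp_μ (F : RLex k 𝒜 M N) (G : RLex k 𝒜 N P) (m : M) (X : 𝒜) :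
    μᵣ (F.comp G).functor m X =
      μᵣ G.functor (F.functor.obj m) X ≫ G.functor.map (μᵣ F.functor m X) := rfl

/-- Whiskering `F ⋙ α`. -/
def whiskerL (F : RLex k 𝒜 M N) {G G' : RLex k 𝒜 N P} (α : G ⟶ G') :
    F.comp G ⟶ F.comp G' :=
  mkHom (F.functor.whiskerLeft (nat α)) fun m X => by
    have := nat_comm α (F.functor.obj m) X
    change (nat α).app (F.functor.obj m) ⊵ᵣ X ≫
      μᵣ G'.functor (F.functor.obj m) X ≫ G'.functor.map (μᵣ F.functor m X) =
      (μᵣ G.functor (F.functor.obj m) X ≫ G.functor.map (μᵣ F.functor m X)) ≫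
        (nat α).app (F.functor.obj (m ⊙ᵣ X))
    rw [← Category.assoc, this, Category.assoc, Category.assoc, (nat α).naturality]

/-- Whiskering `α ⋙ G`. -/
def whiskerR {F F' : RLex k 𝒜 M N} (α : F ⟶ F') (G : RLex k 𝒜 N P) :
    F.comp G ⟶ F'.comp G :=
  mkHom (Functor.whiskerRight (nat α) G.functor) fun m X => by
    have := nat_comm α m X
    change G.functor.map ((nat α).app m) ⊵ᵣ X ≫
      μᵣ G.functor (F'.functor.obj m) X ≫ G.functor.map (μᵣ F'.functor m X) =
      (μᵣ G.functor (F.functor.obj m) X ≫ G.functor.map (μᵣ F.functor m X)) ≫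
        G.functor.map ((nat α).app (m ⊙ᵣ X))
    rw [μᵣ_naturality_left_assoc, Category.assoc, ← Functor.map_comp, ← Functor.map_comp, this]

@[simp] lemma nat_whiskerL_app (F : RLex k 𝒜 M N) {G G' : RLex k 𝒜 N P} (α : G ⟶ G') (m : M) :
    (nat (whiskerL F α)).app m = (nat α).app (F.functor.obj m) := rfl

@[simp] lemma nat_whiskerR_app {F F' : RLex k 𝒜 M N} (α : F ⟶ F') (G : RLex k 𝒜 N P) (m : M) :
    (nat (whiskerR α G)).app m = G.functor.map ((nat α).app m) := rfl

/-- The associator, with identity components. -/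
def assoc {Q : Type w₅} [Category.{v₅} Q] [Preadditive Q] [Linear k Q] [MonoidalRightAction 𝒜 Q]
    (F : RLex k 𝒜 M N) (G : RLex k 𝒜 N P) (K : RLex k 𝒜 P Q) :
    (F.comp G).comp K ≅ F.comp (G.comp K) :=
  mkIso (Functor.associator F.functor G.functor K.functor) fun m X => by
    change 𝟙 _ ⊵ᵣ X ≫ (μᵣ K.functor _ X ≫ K.functor.map (μᵣ G.functor _ X)) ≫
      K.functor.map (G.functor.map (μᵣ F.functor m X)) =
      (μᵣ K.functor _ X ≫ K.functor.map (μᵣ G.functor _ X ≫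
        G.functor.map (μᵣ F.functor m X))) ≫ 𝟙 _
    simp

/-- The left unitor, with identity components. -/
def leftUnitor (F : RLex k 𝒜 M N) : (id k 𝒜 M).comp F ≅ F :=
  mkIso (Functor.leftUnitor F.functor) fun m X => by
    change 𝟙 _ ⊵ᵣ X ≫ μᵣ F.functor m X = (μᵣ F.functor m X ≫ F.functor.map (𝟙 _)) ≫ 𝟙 _
    simp

/-- The right unitor, with identity components. -/
def rightUnitor (F : RLex k 𝒜 M N) : F.comp (id k 𝒜 N) ≅ F :=
  mkIso (Functor.rightUnitor F.functor) fun m X => by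
    change 𝟙 _ ⊵ᵣ X ≫ μᵣ F.functor m X = (𝟙 _ ≫ μᵣ F.functor m X) ≫ 𝟙 _
    simp

section

variable {Q : Type w₅} [Category.{v₅} Q] [Preadditive Q] [Linear k Q] [MonoidalRightAction 𝒜 Q]
  (F : RLex k 𝒜 M N) (G : RLex k 𝒜 N P) (K : RLex k 𝒜 P Q) (m : M)

@[simp] lemma nat_assoc_hom_app : (nat (assoc F G K).hom).app m = 𝟙 _ := rfl
@[simp] lemma nat_assoc_inv_app : (nat (assoc F G K).inv).app m = 𝟙 _ := rfl
@[simp] lemma nat_leftUnitor_hom_app : (nat (leftUnitor F).hom).app m = 𝟙 _ := rfl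
@[simp] lemma nat_leftUnitor_inv_app : (nat (leftUnitor F).inv).app m = 𝟙 _ := rfl
@[simp] lemma nat_rightUnitor_hom_app : (nat (rightUnitor F).hom).app m = 𝟙 _ := rfl
@[simp] lemma nat_rightUnitor_inv_app : (nat (rightUnitor F).inv).app m = 𝟙 _ := rfl

end

end RLex

end RightModules

/-! ### The dual of a left `𝔐^H`-module category -/


section TensorRight

open MonoidalLeftAction Functor.LaxLeftLinear

variable {k : Type u} [Field k] {H : Type u} [Ring H] [Bialgebra k H]

/-- The linear map `Y ⊗ (V ⊗ X) → (Y ⊗ V) ⊗ X`, `y ⊗ (v ⊗ x) ↦ (y₍₀₎ ⊗ v) ⊗ y₍₁₎ x`. -/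
def xi (Y : RComod k H) (V : Type u) [AddCommGroup V] [Module k V] (X : HMod k H) :
    Y.V ⊗[k] (V ⊗[k] X.V) →ₗ[k] (Y.V ⊗[k] V) ⊗[k] X.V :=
  (TensorProduct.lift X.act.toLinearMap).lTensor (Y.V ⊗[k] V) ∘ₗ
    (TensorProduct.tensorTensorTensorComm k Y.V H V X.V).toLinearMap ∘ₗ
      Y.coact.rTensor (V ⊗[k] X.V)

/-- The linear map `v ⊗ x ↦ (y ⊗ v) ⊗ h x` as a function of `y ⊗ h`. -/
def xiAux {Y V : Type u} [AddCommGroup Y] [Module k Y] [AddCommGroup V] [Module k V]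
    (X : HMod k H) (v : V) (x : X.V) : Y ⊗[k] H →ₗ[k] (Y ⊗[k] V) ⊗[k] X.V :=
  TensorProduct.map ((TensorProduct.mk k Y V).flip v) (orb X.act x)

@[simp] lemma xiAux_tmul {Y V : Type u} [AddCommGroup Y] [Module k Y] [AddCommGroup V]
    [Module k V] (X : HMod k H) (v : V) (x : X.V) (y : Y) (h : H) :
    xiAux X v x (y ⊗ₜ h) = (y ⊗ₜ[k] v) ⊗ₜ[k] X.act h x := rfl

lemma xi_tmul (Y : RComod k H) (V : Type u) [AddCommGroup V] [Module k V] (X : HMod k H)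
    (y : Y.V) (v : V) (x : X.V) :
    xi Y V X (y ⊗ₜ (v ⊗ₜ x)) = xiAux X v x (Y.coact y) := by
  change ((TensorProduct.lift X.act.toLinearMap).lTensor (Y.V ⊗[k] V))
    (TensorProduct.tensorTensorTensorComm k Y.V H V X.V (Y.coact y ⊗ₜ (v ⊗ₜ x))) = _
  generalize Y.coact y = s
  induction s with
  | zero => simp
  | add x y hx hy => simp only [map_add, TensorProduct.add_tmul, hx, hy]
  | tmul a b => simp

lemma xi_natural {Y Y' : RComod k H} {V V' : Type u} [AddCommGroup V] [Module k V]
    [AddCommGroup V'] [Module k V'] {X X' : HMod k H} (f : Y ⟶ Y') (g : V →ₗ[k] V')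
    (p : X ⟶ X') :
    xi Y' V' X' ∘ₗ TensorProduct.map (RComod.lin f) (TensorProduct.map g (HMod.lin p)) =
      TensorProduct.map (TensorProduct.map (RComod.lin f) g) (HMod.lin p) ∘ₗ xi Y V X := by
  refine TensorProduct.ext (LinearMap.ext fun y => TensorProduct.ext' fun v x => ?_)
  change xi Y' V' X' (RComod.lin f y ⊗ₜ (g v ⊗ₜ HMod.lin p x)) =
    TensorProduct.map (TensorProduct.map (RComod.lin f) g) (HMod.lin p)
      (xi Y V X (y ⊗ₜ (v ⊗ₜ x)))
  rw [xi_tmul, xi_tmul, RComod.lin_comm]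
  generalize Y.coact y = s
  induction s with
  | zero => simp
  | add x y hx hy => simp only [map_add, hx, hy]
  | tmul a b => simp [HMod.lin_comm]

lemma xi_assoc (Y Z : RComod k H) (V : Type u) [AddCommGroup V] [Module k V] (X : HMod k H)
    (y : Y.V) (z : Z.V) (v : V) (x : X.V) :
    (TensorProduct.assoc k Y.V Z.V V).toLinearMap.rTensor X.V
      (xi (tensorComod Y Z) V X ((y ⊗ₜ z) ⊗ₜ (v ⊗ₜ x))) =
    xi Y (Z.V ⊗[k] V) X (y ⊗ₜ xi Z V X (z ⊗ₜ (v ⊗ₜ x))) := by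
  refine (congrArg _ (xi_tmul (tensorComod Y Z) V X (y ⊗ₜ z) v x)).trans ?_
  change (TensorProduct.assoc k Y.V Z.V V).toLinearMap.rTensor X.V
    (xiAux X v x (mix k H H Y.V Z.V (Y.coact y ⊗ₜ Z.coact z))) = _
  rw [xi_tmul Z]
  generalize Z.coact z = s
  induction s with
  | zero => simp
  | add x y hx hy => simp only [map_add, TensorProduct.tmul_add, hx, hy]
  | tmul a b =>
    rw [xiAux_tmul, xi_tmul]
    generalize Y.coact y = s
    induction s with
    | zero => simp
    | add x y hx hy => simp only [map_add, TensorProduct.add_tmul, hx, hy]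
    | tmul c d => simp

lemma xi_unit (V : Type u) [AddCommGroup V] [Module k V] (X : HMod k H)
    (r : k) (v : V) (x : X.V) :
    (TensorProduct.lid k V).toLinearMap.rTensor X.V
      (xi (unitComod k H) V X (r ⊗ₜ (v ⊗ₜ x))) = r • (v ⊗ₜ x) := by
  refine (congrArg _ (xi_tmul (unitComod k H) V X r v x)).trans ?_
  change (TensorProduct.lid k V).toLinearMap.rTensor X.V (xiAux X v x (r ⊗ₜ 1)) = _
  simp [TensorProduct.smul_tmul']

lemma xi_tensor (Y : RComod k H) (V : Type u) [AddCommGroup V] [Module k V] (X X' : HMod k H)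
    (y : Y.V) (v : V) (x : X.V) (x' : X'.V) :
    xi Y V (X ⊗ X') (y ⊗ₜ[k] (v ⊗ₜ[k] (x ⊗ₜ[k] x'))) =
      TensorProduct.assoc k (Y.V ⊗[k] V) X.V X'.V
        ((xi Y V X).rTensor X'.V
          (xi Y (V ⊗[k] X.V) X' (y ⊗ₜ[k] ((v ⊗ₜ[k] x) ⊗ₜ[k] x')))) := by
  have hy := LinearMap.congr_fun Y.coassoc y
  simp only [LinearMap.comp_apply, LinearEquiv.coe_coe] at hy
  refine (xi_tmul Y V (X ⊗ X') y v (x ⊗ₜ[k] x')).trans ?_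
  rw [xi_tmul Y (V ⊗[k] X.V) X' y (v ⊗ₜ[k] x) x']
  let Θ : Y.V ⊗[k] (H ⊗[k] H) →ₗ[k] (Y.V ⊗[k] V) ⊗[k] (X.V ⊗[k] X'.V) :=
    TensorProduct.map ((TensorProduct.mk k Y.V V).flip v)
      (TensorProduct.map (orb X.act x) (orb X'.act x'))
  have e₁ : ∀ s : Y.V ⊗[k] H, xiAux (X ⊗ X') v (x ⊗ₜ[k] x') s =
      Θ ((Coalgebra.comul (R := k)).lTensor Y.V s) := fun s =>
    LinearMap.congr_fun (g := Θ ∘ₗ (Coalgebra.comul (R := k)).lTensor Y.V)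
      (TensorProduct.ext' fun a h =>
        congrArg ((a ⊗ₜ[k] v) ⊗ₜ[k] ·) (tensorAct_tmul X.act X'.act h x x')) s
  have e₂ : ∀ s : Y.V ⊗[k] H, TensorProduct.assoc k (Y.V ⊗[k] V) X.V X'.V
      ((xi Y V X).rTensor X'.V (xiAux X' (v ⊗ₜ[k] x) x' s)) =
      Θ (TensorProduct.assoc k Y.V H H (Y.coact.rTensor H s)) := by
    intro s
    induction s with
    | zero => simp
    | add x y hx hy => simp only [map_add, hx, hy]
    | tmul a h =>
      rw [xiAux_tmul, LinearMap.rTensor_tmul, xi_tmul, LinearMap.rTensor_tmul]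
      generalize Y.coact a = s
      induction s with
      | zero => simp
      | add x y hx hy => simp only [map_add, TensorProduct.add_tmul, hx, hy]
      | tmul a b => simp [Θ]
  rw [e₁, e₂, hy]

lemma xi_rid (Y : RComod k H) (V : Type u) [AddCommGroup V] [Module k V]
    (y : Y.V) (v : V) (r : k) :
    TensorProduct.rid k (Y.V ⊗[k] V) (xi Y V (𝟙_ (HMod k H)) (y ⊗ₜ[k] (v ⊗ₜ[k] r))) =
      y ⊗ₜ[k] (r • v) := by
  have hy := LinearMap.congr_fun Y.counit y
  simp only [LinearMap.comp_apply, LinearEquiv.coe_coe, LinearMap.id_apply] at hy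
  refine (congrArg _ (xi_tmul Y V (𝟙_ (HMod k H)) y v r)).trans ?_
  have e : ∀ s : Y.V ⊗[k] H, TensorProduct.rid k (Y.V ⊗[k] V)
      (xiAux (𝟙_ (HMod k H)) v r s) =
      TensorProduct.rid k Y.V ((Coalgebra.counit (R := k)).lTensor Y.V s) ⊗ₜ[k] (r • v) := fun s =>
    LinearMap.congr_fun
      (f := (TensorProduct.rid k (Y.V ⊗[k] V)).toLinearMap ∘ₗ xiAux (𝟙_ (HMod k H)) v r)
      (g := (TensorProduct.mk k Y.V V).flip (r • v) ∘ₗ (TensorProduct.rid k Y.V).toLinearMap ∘ₗ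
        (Coalgebra.counit (R := k)).lTensor Y.V)
      (TensorProduct.ext' fun a h => by
        change (trivAct k H h r) • (a ⊗ₜ[k] v) = (Coalgebra.counit (R := k) h • a) ⊗ₜ[k] (r • v)
        rw [trivAct_apply, TensorProduct.tmul_smul, TensorProduct.smul_tmul',
          TensorProduct.smul_tmul', smul_smul, mul_comm]) s
  rw [e, hy]

/-- The lax `𝔐^H`-module functor `V ↦ V ⊗ X` from `Vec` to `Vec`. -/
def tensorRightFun (X : HMod k H) :
    LLax k (RComod k H) (ModuleCat.{u} k) (ModuleCat.{u} k) where
  functor := tensorRight (ModuleCat.of k X.V)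
  lax :=
    { μₗ Y V := ModuleCat.ofHom (xi Y V X)
      μₗ_naturality_left f V := by
        apply ModuleCat.hom_ext
        have h := xi_natural f (LinearMap.id (M := V)) (𝟙 X)
        rw [HMod.lin_id, TensorProduct.map_id] at h
        exact h
      μₗ_naturality_right Y _ _ g := by
        apply ModuleCat.hom_ext
        exact xi_natural (𝟙 Y) g.hom (𝟙 X)
      μₗ_associativity Y Z V := by
        apply ModuleCat.hom_ext
        exact TensorProduct.ext (TensorProduct.ext' fun (y : Y.V) (z : Z.V) =>
          TensorProduct.ext' fun (v : V) (x : X.V) => xi_assoc Y Z V X y z v x)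
      μₗ_unitality V := by
        apply ModuleCat.hom_ext
        exact TensorProduct.ext (M := k) (N := V ⊗[k] X.V) (P₂ := V ⊗[k] X.V)
          (g := (TensorProduct.lid k (V ⊗[k] X.V)).toLinearMap)
          (h := (TensorProduct.lid k V).toLinearMap.rTensor X.V ∘ₗ xi (unitComod k H) V X)
          (LinearMap.ext fun r => TensorProduct.ext' fun v x => (xi_unit V X r v x).symm) }
  typeL :=
    { additive := inferInstance
      linear := inferInstance
      leftExact := inferInstance
      coproducts _ := inferInstance }

@[simp] lemma tensorRightFun_obj (X : HMod k H) (V : ModuleCat.{u} k) :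
    (tensorRightFun X).functor.obj V = ModuleCat.of k (V ⊗[k] X.V) := rfl

@[simp] lemma tensorRightFun_map (X : HMod k H) {V W : ModuleCat.{u} k} (f : V ⟶ W) :
    (tensorRightFun X).functor.map f = ModuleCat.ofHom (f.hom.rTensor X.V) := rfl

lemma tensorRightFun_μ (X : HMod k H) (Y : RComod k H) (V : ModuleCat.{u} k) :
    μₗ (tensorRightFun X).functor Y V = ModuleCat.ofHom (xi Y V X) := rfl

/-- The morphism of module functors `V ⊗ f : V ⊗ X → V ⊗ X'`. -/
def tensorRightMap {X X' : HMod k H} (f : X ⟶ X') : tensorRightFun X ⟶ tensorRightFun X' :=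
  LLax.mkHom
    { app V := ModuleCat.ofHom ((HMod.lin f).lTensor V)
      naturality V W g := by
        apply ModuleCat.hom_ext
        exact TensorProduct.ext' fun v x => rfl }
    fun Y V => by
      apply ModuleCat.hom_ext
      have h := xi_natural (𝟙 Y) (LinearMap.id (M := V)) f
      rw [RComod.lin_id, TensorProduct.map_id] at h
      exact h

/-- The isomorphism of module functors `V ⊗ (X ⊗ X') ≅ (V ⊗ X) ⊗ X'`. -/
def tensorRightAssoc (X X' : HMod k H) :
    tensorRightFun (X ⊗ X') ≅ (tensorRightFun X).comp (tensorRightFun X') :=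
  LLax.mkIso
    (NatIso.ofComponents (fun V => (TensorProduct.assoc k V X.V X'.V).symm.toModuleIso)
      fun g => by
        apply ModuleCat.hom_ext
        exact TensorProduct.ext (LinearMap.ext fun v => TensorProduct.ext' fun x x' => rfl))
    fun Y V => by
      apply ModuleCat.hom_ext
      refine TensorProduct.ext (LinearMap.ext fun (y : Y.V) =>
        TensorProduct.ext (LinearMap.ext fun (v : V) =>
          TensorProduct.ext' fun (x : X.V) (x' : X'.V) => ?_))
      exact ((LinearEquiv.symm_apply_eq _).2 (xi_tensor Y V X X' y v x x')).symm

/-- The isomorphism of module functors `V ⊗ k ≅ V`. -/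
def tensorRightUnit :
    tensorRightFun (𝟙_ (HMod k H)) ≅ LLax.id k (RComod k H) (ModuleCat.{u} k) :=
  LLax.mkIso
    (NatIso.ofComponents (fun V => (TensorProduct.rid k V).toModuleIso) fun {V W} g => by
      apply ModuleCat.hom_ext
      exact TensorProduct.ext' fun (v : V) (r : k) => (g.hom.map_smul r v).symm)
    fun Y V => by
      apply ModuleCat.hom_ext
      refine TensorProduct.ext (LinearMap.ext fun (y : Y.V) =>
        TensorProduct.ext' fun (v : V) (r : k) => ?_)
      exact (xi_rid Y V y v r).symm

end TensorRight

section Dual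

open MonoidalLeftAction Functor.LaxLeftLinear

variable (k : Type u) [Field k] (H : Type u) [Ring H] [Bialgebra k H]

/-- The category `M^*` of lax `𝔐^H`-module functors `M → Vec` (linear, left exact, preserving
small coproducts). -/
abbrev Dual (M : Type w₁) [Category.{v₁} M] [Preadditive M] [Linear k M]
    [MonoidalLeftAction (RComod k H) M] :=
  LLax k (RComod k H) M (ModuleCat.{u} k)

namespace Dual

variable {k H}
variable {M : Type w₁} [Category.{v₁} M] [Preadditive M] [Linear k M]
  [MonoidalLeftAction (RComod k H) M]
  {N : Type w₂} [Category.{v₂} N] [Preadditive N] [Linear k N]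
  [MonoidalLeftAction (RComod k H) N]

lemma act_zero (X : RComod k H) (V W : ModuleCat.{u} k) : X ⊴ₗ (0 : V ⟶ W) = 0 := by
  apply ModuleCat.hom_ext
  exact TensorProduct.ext' fun x v => TensorProduct.tmul_zero _ _

lemma act_add (X : RComod k H) {V W : ModuleCat.{u} k} (f g : V ⟶ W) :
    X ⊴ₗ (f + g) = X ⊴ₗ f + X ⊴ₗ g := by
  apply ModuleCat.hom_ext
  exact TensorProduct.ext' fun x v => TensorProduct.tmul_add _ _ _

lemma act_smul (X : RComod k H) {V W : ModuleCat.{u} k} (c : k) (f : V ⟶ W) :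
    X ⊴ₗ (c • f) = c • X ⊴ₗ f := by
  apply ModuleCat.hom_ext
  exact TensorProduct.ext' fun x v => TensorProduct.tmul_smul _ _ _

/-- The space of module natural transformations between two objects of the dual. -/
def homs (S T : Dual k H M) : Submodule k (S.functor ⟶ T.functor) where
  carrier := {α | LaxModFun.IsModuleNat S.toLaxModFun T.toLaxModFun α}
  zero_mem' X m := by
    simp [act_zero]
  add_mem' {α β} hα hβ X m := by
    have h₁ := hα X m
    have h₂ := hβ X m
    simp only [NatTrans.app_add, act_add, Preadditive.add_comp, Preadditive.comp_add, h₁, h₂]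
  smul_mem' c α hα X m := by
    have h₁ := hα X m
    simp only [NatTrans.app_smul, act_smul, Linear.smul_comp, Linear.comp_smul, h₁]

instance : Preadditive (Dual k H M) where
  homGroup S T := inferInstanceAs (AddCommGroup (homs S T))
  add_comp _ _ _ _ _ _ := Subtype.ext (Preadditive.add_comp _ _ _ _ _ _)
  comp_add _ _ _ _ _ _ := Subtype.ext (Preadditive.comp_add _ _ _ _ _ _)

instance : Linear k (Dual k H M) where
  homModule S T := inferInstanceAs (Module k (homs S T))
  smul_comp _ _ _ _ _ _ := Subtype.ext (Linear.smul_comp _ _ _ _ _ _)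
  comp_smul _ _ _ _ _ _ := Subtype.ext (Linear.comp_smul _ _ _ _ _ _)

/-- The action `T ◁ X = (- ⊗ X) ∘ T` of a left `H`-module on an object of the dual. -/
def act (T : Dual k H M) (X : HMod k H) : Dual k H M := T.comp (tensorRightFun X)

/-- The isomorphism `T ◁ (X ⊗ Y) ≅ (T ◁ X) ◁ Y`. -/
def actAssoc (T : Dual k H M) (X Y : HMod k H) : act T (X ⊗ Y) ≅ act (act T X) Y where
  hom := LLax.whiskerL T (tensorRightAssoc X Y).hom ≫
    (LLax.assoc T (tensorRightFun X) (tensorRightFun Y)).inv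
  inv := (LLax.assoc T (tensorRightFun X) (tensorRightFun Y)).hom ≫
    LLax.whiskerL T (tensorRightAssoc X Y).inv
  hom_inv_id := by
    ext m : 1
    apply ModuleCat.hom_ext
    exact TensorProduct.ext (LinearMap.ext fun t => TensorProduct.ext' fun x y => rfl)
  inv_hom_id := by
    ext m : 1
    apply ModuleCat.hom_ext
    exact TensorProduct.ext_threefold fun t x y => rfl

/-- The isomorphism `T ◁ k ≅ T`. -/
def actUnit (T : Dual k H M) : act T (𝟙_ (HMod k H)) ≅ T where
  hom := LLax.whiskerL T tensorRightUnit.hom ≫ (LLax.rightUnitor T).hom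
  inv := (LLax.rightUnitor T).inv ≫ LLax.whiskerL T tensorRightUnit.inv
  hom_inv_id := by
    ext m : 1
    apply ModuleCat.hom_ext
    exact LinearMap.ext fun t => (TensorProduct.rid k (T.functor.obj m)).symm_apply_apply t
  inv_hom_id := by
    ext m : 1
    apply ModuleCat.hom_ext
    exact LinearMap.ext fun t => (TensorProduct.rid k (T.functor.obj m)).apply_symm_apply t

/-- The dual of a left `𝔐^H`-module category is a right module category over the monoidal
category of left `H`-modules. -/
instance : MonoidalRightAction (HMod k H) (Dual k H M) where
  actionObj T X := act T X
  actionHomLeft α X := LLax.whiskerR α (tensorRightFun X)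
  actionHomRight T _ _ f := LLax.whiskerL T (tensorRightMap f)
  actionHom {X _ _ T} α f :=
    LLax.whiskerR α (tensorRightFun X) ≫ LLax.whiskerL T (tensorRightMap f)
  actionAssocIso T X Y := actAssoc T X Y
  actionUnitIso T := actUnit T
  actionHom_def f g := rfl
  actionHomRight_id X M := by
    ext m : 1
    apply ModuleCat.hom_ext
    refine TensorProduct.ext' fun x y => rfl
  id_actionHomLeft X M := by
    ext m : 1
    apply ModuleCat.hom_ext
    refine TensorProduct.ext' fun x y => rfl
  actionHom_comp f f' g g' := by
    ext m : 1
    apply ModuleCat.hom_ext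
    refine TensorProduct.ext' fun x y => rfl
  actionAssocIso_hom_naturality f g h := by
    ext m : 1
    apply ModuleCat.hom_ext
    exact TensorProduct.ext (LinearMap.ext fun t => TensorProduct.ext' fun x y => rfl)
  actionUnitIso_hom_naturality f := by
    ext m : 1
    apply ModuleCat.hom_ext
    refine TensorProduct.ext' fun x r => ?_
    exact ((LLax.nat f).app m).hom.map_smul r x
  actionHomRight_whiskerRight {X Y} f Z T := by
    ext m : 1
    apply ModuleCat.hom_ext
    exact TensorProduct.ext (LinearMap.ext fun t => TensorProduct.ext' fun x y => rfl)
  whiskerRight_actionHomLeft X Y Z f T := by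
    ext m : 1
    apply ModuleCat.hom_ext
    exact TensorProduct.ext (LinearMap.ext fun t => TensorProduct.ext' fun x y => rfl)
  actionHom_associator X Y Z N := by
    ext m : 1
    apply ModuleCat.hom_ext
    exact TensorProduct.ext (LinearMap.ext fun n => TensorProduct.ext_threefold fun x y z => rfl)
  actionHom_leftUnitor X T := by
    ext m : 1
    apply ModuleCat.hom_ext
    refine TensorProduct.ext (LinearMap.ext fun t => TensorProduct.ext' fun r x => ?_)
    exact TensorProduct.tmul_smul (show k from r) t x
  actionHom_rightUnitor X T := by
    ext m : 1
    apply ModuleCat.hom_ext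
    refine TensorProduct.ext (LinearMap.ext fun t => TensorProduct.ext' fun x r => ?_)
    exact TensorProduct.tmul_smul (show k from r) t x

end Dual

end Dual

section DualMap

open MonoidalLeftAction Functor.LaxLeftLinear

variable {k : Type u} [Field k] {H : Type u} [Ring H] [Bialgebra k H]
  {M : Type w₁} [Category.{v₁} M] [Preadditive M] [Linear k M]
  [MonoidalLeftAction (RComod k H) M]
  {N : Type w₂} [Category.{v₂} N] [Preadditive N] [Linear k N]
  [MonoidalLeftAction (RComod k H) N]

/-- The strong module functor `F^* : N^* ⥤ M^*`, `T ↦ T ∘ F`. The structure morphism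
`(T ∘ F) ◁ X ⟶ (T ◁ X) ∘ F` has identity components. -/
def dualMap (F : LLax k (RComod k H) M N) : RStrong k (HMod k H) (Dual k H N) (Dual k H M) where
  functor :=
    { obj T := F.comp T
      map α := LLax.whiskerL F α }
  lax :=
    { μᵣ T X := (LLax.assoc F T (tensorRightFun X)).hom
      μᵣ_naturality_right T _ _ f := by
        ext m : 1
        apply ModuleCat.hom_ext
        exact TensorProduct.ext' fun t x => rfl
      μᵣ_naturality_left f X := by
        ext m : 1
        apply ModuleCat.hom_ext
        exact TensorProduct.ext' fun t x => rfl
      μᵣ_associativity T X Y := by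
        ext m : 1
        apply ModuleCat.hom_ext
        exact TensorProduct.ext (LinearMap.ext fun t => TensorProduct.ext' fun x y => rfl)
      μᵣ_unitality T := by
        ext m : 1
        apply ModuleCat.hom_ext
        exact TensorProduct.ext' fun t x => rfl }
  linear :=
    { additive := ⟨rfl⟩
      linear := ⟨fun _ _ => rfl⟩ }
  strong T X := (LLax.assoc F T (tensorRightFun X)).isIso_hom

/-- The module natural transformation `F^* ⟶ G^*` induced by `α : F ⟶ G`. -/
def dualMap₂ {F G : LLax k (RComod k H) M N} (α : F ⟶ G) :
    (dualMap F).toLaxRModFun ⟶ (dualMap G).toLaxRModFun :=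
  ⟨{ app T := LLax.whiskerR α T
     naturality S T β := by
      ext m : 1
      exact ((LLax.nat β).naturality ((LLax.nat α).app m)).symm },
    fun T X => by
      ext m : 1
      apply ModuleCat.hom_ext
      exact TensorProduct.ext' fun t x => rfl⟩

end DualMap

/-! ### The two 2-categories -/

section Bicategories

variable (k : Type u) [Field k] (H : Type u) [Ring H] [Bialgebra k H]

/-- Left `𝔐^H`-module categories equivalent to `𝔐^C` for some left `H`-module coalgebra `C`. -/
structure LeftModCat where
  carrier : Type (u + 1)
  [category : Category.{u} carrier]
  [preadditive : Preadditive carrier]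
  [linear : Linear k carrier]
  [action : MonoidalLeftAction (RComod k H) carrier]
  equiv : ∃ C : ModuleCoalg k H, LeftModEquivalent k (RComod k H) carrier (RComod k C.carrier)

attribute [instance] LeftModCat.category LeftModCat.preadditive LeftModCat.linear
  LeftModCat.action

/-- Right module categories over the monoidal category `_H𝔐` of left `H`-modules that are
equivalent to the category `^C_H𝔐` of left `C`-comodules in `_H𝔐`, for some left `H`-module
coalgebra `C`. The morphisms are allowed to live in `Type (u + 1)`, as do the natural
transformations that are the morphisms of a dual `M^*`; the equivalence with `^C_H𝔐` makes the
morphism spaces essentially small. -/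
structure RightModCat where
  carrier : Type (u + 1)
  [category : Category.{u + 1} carrier]
  [preadditive : Preadditive carrier]
  [linear : Linear k carrier]
  [action : MonoidalRightAction (HMod k H) carrier]
  equiv : ∃ C : ModuleCoalg k H, RightModEquivalent k (HMod k H) carrier (LHComod k H C.carrier)

attribute [instance] RightModCat.category RightModCat.preadditive RightModCat.linear
  RightModCat.action

variable {k H}

/-- The 2-category `𝔐^H-Mod`: the 1-cells are the lax module functors whose underlying functor is
linear, left exact and preserves small coproducts, the 2-cells are the module natural
transformations. -/
instance : Bicategory (LeftModCat k H) where
  Hom M N := LLax k (RComod k H) M.carrier N.carrier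
  id M := LLax.id k (RComod k H) M.carrier
  comp F G := F.comp G
  homCategory M N := inferInstanceAs (Category (LLax k (RComod k H) M.carrier N.carrier))
  whiskerLeft F _ _ α := LLax.whiskerL F α
  whiskerRight α G := LLax.whiskerR α G
  associator F G K := LLax.assoc F G K
  leftUnitor F := LLax.leftUnitor F
  rightUnitor F := LLax.rightUnitor F
  id_whiskerLeft η := LLax.hom_ext fun m => by
    change (LLax.nat η).app m = 𝟙 _ ≫ (LLax.nat η).app m ≫ 𝟙 _
    simp
  comp_whiskerLeft F G _ _ η := LLax.hom_ext fun m => by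
    change (LLax.nat η).app (G.functor.obj (F.functor.obj m)) = 𝟙 _ ≫ (LLax.nat η).app _ ≫ 𝟙 _
    simp
  whiskerLeft_id F G := rfl
  whiskerLeft_comp F _ _ _ η θ := rfl
  id_whiskerRight F G := LLax.hom_ext fun m => G.functor.map_id (F.functor.obj m)
  comp_whiskerRight η θ G := LLax.hom_ext fun m =>
    G.functor.map_comp ((LLax.nat η).app m) ((LLax.nat θ).app m)
  whiskerRight_id η := LLax.hom_ext fun m => by
    change (LLax.nat η).app m = 𝟙 _ ≫ (LLax.nat η).app m ≫ 𝟙 _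
    simp
  whiskerRight_comp η G K := LLax.hom_ext fun m => by
    change K.functor.map (G.functor.map ((LLax.nat η).app m)) =
      𝟙 _ ≫ K.functor.map (G.functor.map ((LLax.nat η).app m)) ≫ 𝟙 _
    simp
  whisker_assoc F _ _ η K := LLax.hom_ext fun m => by
    change K.functor.map ((LLax.nat η).app (F.functor.obj m)) =
      𝟙 _ ≫ K.functor.map ((LLax.nat η).app (F.functor.obj m)) ≫ 𝟙 _
    simp
  whisker_exchange η θ := LLax.hom_ext fun m =>
    ((LLax.nat θ).naturality ((LLax.nat η).app m)).symm
  pentagon F G K L := LLax.hom_ext fun m => by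
    change L.functor.map (𝟙 _) ≫ 𝟙 _ ≫ 𝟙 _ = 𝟙 _ ≫ 𝟙 _
    simp
  triangle F G := LLax.hom_ext fun m => by
    change 𝟙 _ ≫ 𝟙 _ = G.functor.map (𝟙 _)
    simp

/-- The 2-category of right `_H𝔐`-module categories equivalent to some `^C_H𝔐`: the 1-cells are the
left exact (linear) strong module functors, the 2-cells are the module natural transformations. -/
instance : Bicategory (RightModCat k H) where
  Hom M N := RLex k (HMod k H) M.carrier N.carrier
  id M := RLex.id k (HMod k H) M.carrier
  comp F G := F.comp G
  homCategory M N := inferInstanceAs (Category (RLex k (HMod k H) M.carrier N.carrier))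
  whiskerLeft F _ _ α := RLex.whiskerL F α
  whiskerRight α G := RLex.whiskerR α G
  associator F G K := RLex.assoc F G K
  leftUnitor F := RLex.leftUnitor F
  rightUnitor F := RLex.rightUnitor F
  id_whiskerLeft η := RLex.hom_ext fun m => by
    change (RLex.nat η).app m = 𝟙 _ ≫ (RLex.nat η).app m ≫ 𝟙 _
    simp
  comp_whiskerLeft F G _ _ η := RLex.hom_ext fun m => by
    change (RLex.nat η).app (G.functor.obj (F.functor.obj m)) = 𝟙 _ ≫ (RLex.nat η).app _ ≫ 𝟙 _
    simp
  whiskerLeft_id F G := rfl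
  whiskerLeft_comp F _ _ _ η θ := rfl
  id_whiskerRight F G := RLex.hom_ext fun m => G.functor.map_id (F.functor.obj m)
  comp_whiskerRight η θ G := RLex.hom_ext fun m =>
    G.functor.map_comp ((RLex.nat η).app m) ((RLex.nat θ).app m)
  whiskerRight_id η := RLex.hom_ext fun m => by
    change (RLex.nat η).app m = 𝟙 _ ≫ (RLex.nat η).app m ≫ 𝟙 _
    simp
  whiskerRight_comp η G K := RLex.hom_ext fun m => by
    change K.functor.map (G.functor.map ((RLex.nat η).app m)) =
      𝟙 _ ≫ K.functor.map (G.functor.map ((RLex.nat η).app m)) ≫ 𝟙 _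
    simp
  whisker_assoc F _ _ η K := RLex.hom_ext fun m => by
    change K.functor.map ((RLex.nat η).app (F.functor.obj m)) =
      𝟙 _ ≫ K.functor.map ((RLex.nat η).app (F.functor.obj m)) ≫ 𝟙 _
    simp
  whisker_exchange η θ := RLex.hom_ext fun m =>
    ((RLex.nat θ).naturality ((RLex.nat η).app m)).symm
  pentagon F G K L := RLex.hom_ext fun m => by
    change L.functor.map (𝟙 _) ≫ 𝟙 _ ≫ 𝟙 _ = 𝟙 _ ≫ 𝟙 _
    simp
  triangle F G := RLex.hom_ext fun m => by
    change 𝟙 _ ≫ 𝟙 _ = G.functor.map (𝟙 _)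
    simp

end Bicategories

/-! ### The dual as a pseudofunctor -/

section DualFunctor

variable {k : Type u} [Field k] {H : Type u} [Ring H] [Bialgebra k H]

/-- `F^*` as a 1-cell of right module categories, once it is known to be left exact. -/
def dualRLex {M : Type w₁} [Category.{v₁} M] [Preadditive M] [Linear k M]
    [MonoidalLeftAction (RComod k H) M] {N : Type w₂} [Category.{v₂} N] [Preadditive N]
    [Linear k N] [MonoidalLeftAction (RComod k H) N] (F : LLax k (RComod k H) M N)
    (h : PreservesFiniteLimits (dualMap F).functor) :
    RLex k (HMod k H) (Dual k H N) (Dual k H M) where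
  toRStrong := dualMap F
  leftExact := h

/-- The isomorphism `(id_M)^* ≅ id_{M^*}`, with identity components. -/
def dualIdIso {M : Type w₁} [Category.{v₁} M] [Preadditive M] [Linear k M]
    [MonoidalLeftAction (RComod k H) M]
    (h : PreservesFiniteLimits (dualMap (LLax.id k (RComod k H) M)).functor) :
    dualRLex (LLax.id k (RComod k H) M) h ≅ RLex.id k (HMod k H) (Dual k H M) :=
  RLex.mkIso
    (NatIso.ofComponents (fun T => LLax.leftUnitor T) fun {S T} α => LLax.hom_ext fun m => by
      change (LLax.nat α).app m ≫ 𝟙 _ = 𝟙 _ ≫ (LLax.nat α).app m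
      simp)
    fun T X => by
      ext m : 1
      apply ModuleCat.hom_ext
      exact TensorProduct.ext' fun t x => rfl

/-- The isomorphism `(G ∘ F)^* ≅ F^* ∘ G^*`, with identity components. -/
def dualCompIso {M : Type w₁} [Category.{v₁} M] [Preadditive M] [Linear k M]
    [MonoidalLeftAction (RComod k H) M] {N : Type w₂} [Category.{v₂} N] [Preadditive N]
    [Linear k N] [MonoidalLeftAction (RComod k H) N] {P : Type w₃} [Category.{v₃} P]
    [Preadditive P] [Linear k P] [MonoidalLeftAction (RComod k H) P]
    (F : LLax k (RComod k H) M N) (G : LLax k (RComod k H) N P)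
    (hF : PreservesFiniteLimits (dualMap F).functor)
    (hG : PreservesFiniteLimits (dualMap G).functor)
    (hFG : PreservesFiniteLimits (dualMap (F.comp G)).functor) :
    dualRLex (F.comp G) hFG ≅ (dualRLex G hG).comp (dualRLex F hF) :=
  RLex.mkIso
    (NatIso.ofComponents (fun (T : Dual k H P) => LLax.assoc F G T)
      fun {S T} α => LLax.hom_ext fun m => by
      change (LLax.nat α).app _ ≫ 𝟙 _ = 𝟙 _ ≫ (LLax.nat α).app _
      simp)
    fun T X => by
      ext m : 1
      apply ModuleCat.hom_ext
      exact TensorProduct.ext' fun t x => rfl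

open Opposite Bicategory.Opposite

lemma hom₂_ext {A B : (RightModCat k H)ᵒᵖ} {F G : A ⟶ B} {α β : F ⟶ G}
    (h : ∀ T, (RLex.nat α.unop2).app T = (RLex.nat β.unop2).app T) : α = β :=
  congrArg (op2 (B := RightModCat k H)) (RLex.hom_ext h)

/-- The dual as a pseudofunctor `M ↦ M^*`, `F ↦ F^*` from the 2-category `𝔐^H-Mod` to the opposite
of the 2-category of right `_H𝔐`-module categories, once it is known that it takes values there. -/
def dualFunctor
    (h₀ : ∀ M : LeftModCat k H, ∃ C : ModuleCoalg k H,
      RightModEquivalent k (HMod k H) (Dual k H M.carrier) (LHComod k H C.carrier))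
    (h₁ : ∀ {M N : LeftModCat k H} (F : LLax k (RComod k H) M.carrier N.carrier),
      PreservesFiniteLimits (dualMap F).functor) :
    Pseudofunctor (LeftModCat k H) (RightModCat k H)ᵒᵖ where
  obj M := op { carrier := Dual k H M.carrier, equiv := h₀ M }
  map F := Quiver.Hom.op (V := RightModCat k H) (dualRLex F (h₁ F))
  map₂ α := op2 (B := RightModCat k H) (dualMap₂ α)
  map₂_id F := hom₂_ext fun (T : Dual k H _) => LLax.hom_ext fun m => T.functor.map_id _
  map₂_comp α β := hom₂_ext fun (T : Dual k H _) => LLax.hom_ext fun m =>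
    T.functor.map_comp ((LLax.nat α).app m) ((LLax.nat β).app m)
  mapId M := Iso.op2 (B := RightModCat k H) (dualIdIso (h₁ _))
  mapComp F G := Iso.op2 (B := RightModCat k H) (dualCompIso F G (h₁ F) (h₁ G) (h₁ _))
  map₂_whisker_left F _ _ η := hom₂_ext fun (T : Dual k H _) => LLax.hom_ext fun m => by
    change T.functor.map ((LLax.nat η).app _) = 𝟙 _ ≫ T.functor.map ((LLax.nat η).app _) ≫ 𝟙 _
    simp
  map₂_whisker_right η G := hom₂_ext fun (T : Dual k H _) => LLax.hom_ext fun m => by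
    change T.functor.map (G.functor.map ((LLax.nat η).app m)) =
      𝟙 _ ≫ T.functor.map (G.functor.map ((LLax.nat η).app m)) ≫ 𝟙 _
    simp
  map₂_associator F G K := hom₂_ext fun (T : Dual k H _) => LLax.hom_ext fun m => by
    change T.functor.map (𝟙 _) = 𝟙 _ ≫ 𝟙 _ ≫ 𝟙 _ ≫ 𝟙 _ ≫ 𝟙 _
    simp
  map₂_left_unitor F := hom₂_ext fun (T : Dual k H _) => LLax.hom_ext fun m => by
    change T.functor.map (𝟙 _) = 𝟙 _ ≫ 𝟙 _ ≫ 𝟙 _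
    simp
  map₂_right_unitor F := hom₂_ext fun (T : Dual k H _) => LLax.hom_ext fun m => by
    change T.functor.map (𝟙 _) = 𝟙 _ ≫ 𝟙 _ ≫ 𝟙 _
    simp

end DualFunctor

/-- A pseudofunctor is a 2-equivalence if it induces equivalences on hom-categories and is
essentially surjective on objects, up to (internal) equivalence. -/
def IsTwoEquivalence {B : Type w₁} [Bicategory.{v₁, v₂} B] {D : Type w₂} [Bicategory.{v₃, v₄} D]
    (P : Pseudofunctor B D) : Prop :=
  (∀ a b : B, (P.mapFunctor a b).IsEquivalence) ∧
    ∀ d : D, ∃ b : B, Nonempty (Bicategory.Equivalence (P.obj b) d)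

end HopfDual

end

noncomputable section

namespace HopfDual

/-! ### Right comodules as coalgebras over a comonad -/

section Comonadic

namespace RComod

variable (k : Type u) [Field k] (C : Type u) [AddCommGroup C] [Module k C] [Coalgebra k C]

/-- The forgetful functor from comodules to vector spaces. -/
def forget : RComod k C ⥤ ModuleCat.{u} k where
  obj X := ModuleCat.of k X.V
  map f := ModuleCat.ofHom (lin f)

/-- The comonad `V ↦ V ⊗ C` on vector spaces. -/
def comonad : Comonad (ModuleCat.{u} k) where
  toFunctor := tensorRight (ModuleCat.of k C)
  ε :=
    { app V := ModuleCat.ofHom (TensorProduct.rid k V ∘ₗ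
        (Coalgebra.counit (R := k) (A := C)).lTensor V)
      naturality V W f := by
        apply ModuleCat.hom_ext
        refine TensorProduct.ext' fun v c => ?_
        exact (f.hom.map_smul _ v).symm }
  δ :=
    { app V := ModuleCat.ofHom ((TensorProduct.assoc k V C C).symm.toLinearMap ∘ₗ
        (Coalgebra.comul (R := k) (A := C)).lTensor V)
      naturality V W f := by
        apply ModuleCat.hom_ext
        refine TensorProduct.ext' fun v c => ?_
        change (TensorProduct.assoc k W C C).symm (f.hom v ⊗ₜ Coalgebra.comul (R := k) c) =
          (f.hom.rTensor C).rTensor C ((TensorProduct.assoc k V C C).symm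
            (v ⊗ₜ Coalgebra.comul (R := k) c))
        generalize Coalgebra.comul (R := k) c = s
        induction s with
        | zero => simp
        | add x y hx hy => simp only [TensorProduct.tmul_add, map_add, hx, hy]
        | tmul a b => simp }
  coassoc V := by
    apply ModuleCat.hom_ext
    refine TensorProduct.ext' fun v c => ?_
    change ((TensorProduct.assoc k V C C).symm.toLinearMap ∘ₗ
      (Coalgebra.comul (R := k) (A := C)).lTensor V).rTensor C
        ((TensorProduct.assoc k V C C).symm (v ⊗ₜ Coalgebra.comul (R := k) c)) =
      (TensorProduct.assoc k (V ⊗[k] C) C C).symm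
        ((Coalgebra.comul (R := k) (A := C)).lTensor (V ⊗[k] C)
          ((TensorProduct.assoc k V C C).symm (v ⊗ₜ Coalgebra.comul (R := k) c)))
    have hc := Coalgebra.coassoc_apply (R := k) c
    let Θ : C ⊗[k] (C ⊗[k] C) →ₗ[k] ((V ⊗[k] C) ⊗[k] C) ⊗[k] C :=
      (TensorProduct.assoc k (V ⊗[k] C) C C).symm.toLinearMap ∘ₗ
      (TensorProduct.assoc k V C (C ⊗[k] C)).symm.toLinearMap ∘ₗ
        TensorProduct.mk k V (C ⊗[k] (C ⊗[k] C)) v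
    have e₁ : ∀ s : C ⊗[k] C, ((TensorProduct.assoc k V C C).symm.toLinearMap ∘ₗ
      (Coalgebra.comul (R := k) (A := C)).lTensor V).rTensor C
        ((TensorProduct.assoc k V C C).symm (v ⊗ₜ s)) =
        Θ (TensorProduct.assoc k C C C ((Coalgebra.comul (R := k)).rTensor C s)) := by
      intro s
      induction s with
      | zero => simp
      | add x y hx hy => simp only [TensorProduct.tmul_add, map_add, hx, hy]
      | tmul a b =>
        simp only [TensorProduct.assoc_symm_tmul, LinearMap.rTensor_tmul, LinearMap.comp_apply,
          LinearMap.lTensor_tmul]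
        generalize Coalgebra.comul (R := k) a = s
        induction s with
        | zero => simp
        | add x y hx hy =>
          simp only [TensorProduct.tmul_add, TensorProduct.add_tmul, map_add, hx, hy]
        | tmul a b => simp [Θ]
    have e₂ : ∀ s : C ⊗[k] C, (TensorProduct.assoc k (V ⊗[k] C) C C).symm
        ((Coalgebra.comul (R := k) (A := C)).lTensor (V ⊗[k] C)
          ((TensorProduct.assoc k V C C).symm (v ⊗ₜ s))) =
        Θ ((Coalgebra.comul (R := k)).lTensor C s) := by
      intro s
      induction s with
      | zero => simp
      | add x y hx hy => simp only [TensorProduct.tmul_add, map_add, hx, hy]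
      | tmul a b => simp [Θ]
    rw [e₁, e₂, hc]
  left_counit V := by
    apply ModuleCat.hom_ext
    refine TensorProduct.ext' fun v c => ?_
    change TensorProduct.rid k (V ⊗[k] C)
      ((Coalgebra.counit (R := k) (A := C)).lTensor (V ⊗[k] C)
        ((TensorProduct.assoc k V C C).symm (v ⊗ₜ Coalgebra.comul (R := k) c))) = v ⊗ₜ c
    have e : ∀ s : C ⊗[k] C, TensorProduct.rid k (V ⊗[k] C)
        ((Coalgebra.counit (R := k) (A := C)).lTensor (V ⊗[k] C)
          ((TensorProduct.assoc k V C C).symm (v ⊗ₜ s))) =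
        v ⊗ₜ TensorProduct.rid k C ((Coalgebra.counit (R := k) (A := C)).lTensor C s) := by
      intro s
      induction s with
      | zero => simp
      | add x y hx hy => simp only [TensorProduct.tmul_add, map_add, hx, hy]
      | tmul a b => simp
    rw [e, Coalgebra.lTensor_counit_comul]
    simp
  right_counit V := by
    apply ModuleCat.hom_ext
    refine TensorProduct.ext' fun v c => ?_
    change (TensorProduct.rid k V ∘ₗ (Coalgebra.counit (R := k) (A := C)).lTensor V).rTensor C
        ((TensorProduct.assoc k V C C).symm (v ⊗ₜ Coalgebra.comul (R := k) c)) = v ⊗ₜ c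
    have e : ∀ s : C ⊗[k] C,
        (TensorProduct.rid k V ∘ₗ (Coalgebra.counit (R := k) (A := C)).lTensor V).rTensor C
          ((TensorProduct.assoc k V C C).symm (v ⊗ₜ s)) =
        v ⊗ₜ TensorProduct.lid k C ((Coalgebra.counit (R := k) (A := C)).rTensor C s) := by
      intro s
      induction s with
      | zero => simp
      | add x y hx hy => simp only [TensorProduct.tmul_add, map_add, hx, hy]
      | tmul a b => simp [TensorProduct.smul_tmul]
    rw [e, Coalgebra.rTensor_counit_comul]
    simp

/-- The comparison functor from comodules to coalgebras over the comonad `- ⊗ C`. -/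
def toCoalgebra : RComod k C ⥤ (comonad k C).Coalgebra where
  obj X :=
    { A := ModuleCat.of k X.V
      a := ModuleCat.ofHom X.coact
      counit := ModuleCat.hom_ext X.counit
      coassoc := by
        apply ModuleCat.hom_ext
        change (TensorProduct.assoc k X.V C C).symm.toLinearMap ∘ₗ
          (Coalgebra.comul (R := k) (A := C)).lTensor X.V ∘ₗ X.coact =
            X.coact.rTensor C ∘ₗ X.coact
        rw [← X.coassoc, ← LinearMap.comp_assoc]
        simp }
  map f :=
    { f := ModuleCat.ofHom (lin f)
      h := ModuleCat.hom_ext (LinearMap.ext fun x => (lin_comm f x).symm) }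

instance : (toCoalgebra k C).Faithful where
  map_injective h := hom_ext (congrArg (fun f => ModuleCat.Hom.hom (Comonad.Coalgebra.Hom.f f)) h)

instance : (toCoalgebra k C).Full where
  map_surjective g := ⟨mkHom g.f.hom fun x =>
    (LinearMap.congr_fun (congrArg ModuleCat.Hom.hom g.h) x).symm, rfl⟩

lemma assoc_comp_of_symm {V : Type u} [AddCommGroup V] [Module k V] (a : V →ₗ[k] V ⊗[k] C)
    (h : (TensorProduct.assoc k V C C).symm.toLinearMap ∘ₗ
      (Coalgebra.comul (R := k) (A := C)).lTensor V ∘ₗ a = a.rTensor C ∘ₗ a) :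
    TensorProduct.assoc k V C C ∘ₗ a.rTensor C ∘ₗ a =
      (Coalgebra.comul (R := k) (A := C)).lTensor V ∘ₗ a := by
  rw [← h, ← LinearMap.comp_assoc]
  simp

instance : (toCoalgebra k C).EssSurj where
  mem_essImage A := ⟨
    { V := A.A
      coact := A.a.hom
      counit := congrArg ModuleCat.Hom.hom A.counit
      coassoc := assoc_comp_of_symm k C _ (congrArg ModuleCat.Hom.hom A.coassoc) }, ⟨Comonad.Coalgebra.isoMk (Iso.refl _) (by
          change A.a ≫ (comonad k C).map (𝟙 A.A) = 𝟙 A.A ≫ A.a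
          simp)⟩⟩

instance : (toCoalgebra k C).IsEquivalence where

instance : PreservesFiniteLimits (comonad k C).toFunctor :=
  inferInstanceAs (PreservesFiniteLimits (tensorRight (ModuleCat.of k C)))

instance (J : Type) [SmallCategory J] [FinCategory J] : PreservesLimitsOfShape J (forget k C) :=
  inferInstanceAs (PreservesLimitsOfShape J (toCoalgebra k C ⋙ (comonad k C).forget))

instance : PreservesFiniteLimits (forget k C) := ⟨fun _ => inferInstance⟩

instance (J : Type) [SmallCategory J] [FinCategory J] : ReflectsLimitsOfShape J (forget k C) :=
  inferInstanceAs (ReflectsLimitsOfShape J (toCoalgebra k C ⋙ (comonad k C).forget))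

instance (J : Type u) : PreservesColimitsOfShape (Discrete J) (forget k C) :=
  inferInstanceAs (PreservesColimitsOfShape (Discrete J) (toCoalgebra k C ⋙ (comonad k C).forget))

instance (J : Type u) : ReflectsColimitsOfShape (Discrete J) (forget k C) :=
  inferInstanceAs (ReflectsColimitsOfShape (Discrete J) (toCoalgebra k C ⋙ (comonad k C).forget))

instance : (forget k C).Additive := ⟨rfl⟩

instance : (forget k C).Linear k := ⟨fun _ _ => rfl⟩

end RComod

end Comonadic

end HopfDual

end

noncomputable section

namespace HopfDual

/-! ### Finite limits in the dual -/

section PointwiseLimits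

variable {J : Type w₁} [Category.{v₁} J] {I : Type w₂} [Category.{v₂} I]
  {M : Type w₃} [Category.{v₃} M] {V : Type w₄} [Category.{v₄} V]

section

variable [HasColimitsOfShape I V]

/-- The comparison `colim (T ∘ X) ⟶ T (colim X)`, natural in `T`. -/
def colimComparison (X : I ⥤ M) (c : Cocone X) :
    (Functor.whiskeringLeft I M V).obj X ⋙ colim ⟶ (evaluation M V).obj c.pt where
  app T := colimit.desc (X ⋙ T) (T.mapCocone c)
  naturality S T α := colimit.hom_ext fun i => by
    change colimit.ι (X ⋙ S) i ≫ colim.map (Functor.whiskerLeft X α) ≫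
      colimit.desc (X ⋙ T) (T.mapCocone c) =
      colimit.ι (X ⋙ S) i ≫ (colimit.desc (X ⋙ S) (S.mapCocone c) : _ ⟶ S.obj c.pt) ≫ α.app c.pt
    rw [colim_map, ι_colimMap_assoc, colimit.ι_desc, colimit.ι_desc_assoc]
    exact (α.naturality (c.ι.app i)).symm

/-- If `I`-shaped colimits commute with `J`-shaped limits, then a pointwise `J`-shaped limit of
functors preserving `I`-shaped colimits preserves `I`-shaped colimits. -/
lemma preservesColimitsOfShape_of_isLimit [HasLimitsOfShape J V]
    [PreservesLimitsOfShape J (colim : (I ⥤ V) ⥤ V)] {G : J ⥤ M ⥤ V} {c : Cone G}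
    (hc : IsLimit c) (hG : ∀ j, PreservesColimitsOfShape I (G.obj j)) :
    PreservesColimitsOfShape I c.pt where
  preservesColimit {X} := ⟨fun {d} hd => ⟨by
    let δ := colimComparison (V := V) X d
    have hδ : ∀ j, IsIso (δ.app (G.obj j)) := fun j => by
      have := hG j
      have e : δ.app (G.obj j) = ((colimit.isColimit (X ⋙ G.obj j)).coconePointUniqueUpToIso
          (isColimitOfPreserves (G.obj j) hd)).hom :=
        colimit.hom_ext fun i => (colimit.ι_desc _ _).trans
          ((colimit.isColimit (X ⋙ G.obj j)).comp_coconePointUniqueUpToIso_hom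
            (isColimitOfPreserves (G.obj j) hd) i).symm
      rw [e]
      infer_instance
    have h₁ := isLimitOfPreserves ((Functor.whiskeringLeft I M V).obj X ⋙ colim) hc
    have h₂ := isLimitOfPreserves ((evaluation M V).obj d.pt) hc
    have hδ' : ∀ j, IsIso ((Functor.whiskerLeft G δ).app j) := hδ
    have : IsIso (Functor.whiskerLeft G δ) := NatIso.isIso_of_isIso_app _
    have e : δ.app c.pt = (h₁.conePointsIsoOfNatIso h₂ (asIso (Functor.whiskerLeft G δ))).hom :=
      h₂.hom_ext fun j => by
        rw [IsLimit.conePointsIsoOfNatIso_hom_comp]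
        exact (δ.naturality (c.π.app j)).symm
    have : IsIso ((colimit.isColimit (X ⋙ c.pt)).desc (c.pt.mapCocone d)) := by
      change IsIso (δ.app c.pt)
      rw [e]
      infer_instance
    exact IsColimit.ofPointIso (t := c.pt.mapCocone d) (colimit.isColimit (X ⋙ c.pt))⟩⟩

end

/-- A pointwise limit of functors preserving `I`-shaped limits preserves `I`-shaped limits. -/
lemma preservesLimitsOfShape_of_isLimit [HasLimitsOfShape J V] {G : J ⥤ M ⥤ V} {c : Cone G}
    (hc : IsLimit c) (hG : ∀ j, PreservesLimitsOfShape I (G.obj j)) :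
    PreservesLimitsOfShape I c.pt := by
  have : PreservesLimitsOfShape I G.flip := preservesLimitsOfShape_of_evaluation _ _ hG
  exact preservesLimitsOfShape_of_natIso
    ((limitIsoFlipCompLim G).symm ≪≫ (limit.isLimit G).conePointUniqueUpToIso hc)

end PointwiseLimits

namespace Dual

open MonoidalLeftAction Functor.LaxLeftLinear

variable {k : Type u} [Field k] {H : Type u} [Ring H] [Bialgebra k H]
  {M : Type w₁} [Category.{v₁} M] [Preadditive M] [Linear k M]
  [MonoidalLeftAction (RComod k H) M]
  {N : Type w₂} [Category.{v₂} N] [Preadditive N] [Linear k N]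
  [MonoidalLeftAction (RComod k H) N]

variable (k H M) in
/-- The underlying functor of an object of the dual. -/
def toFunctor : Dual k H M ⥤ M ⥤ ModuleCat.{u} k where
  obj T := T.functor
  map α := LLax.nat α

/-- Evaluation of the objects of the dual at an object. -/
def eval (m : M) : Dual k H M ⥤ ModuleCat.{u} k where
  obj T := T.functor.obj m
  map α := (LLax.nat α).app m

section

variable {J : Type w₃} [Category.{v₃} J]

/-- The components of a cone in the dual. -/
def leg {K : J ⥤ Dual k H M} (c : Cone K) (j : J) (m : M) :
    c.pt.functor.obj m ⟶ (K.obj j).functor.obj m :=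
  (LLax.nat (c.π.app j)).app m

lemma leg_naturality {K : J ⥤ Dual k H M} (c : Cone K) (j : J) {m n : M} (f : m ⟶ n) :
    c.pt.functor.map f ≫ leg c j n = leg c j m ≫ (K.obj j).functor.map f :=
  (LLax.nat (c.π.app j)).naturality f

lemma leg_comm {K : J ⥤ Dual k H M} (c : Cone K) (j : J) (X : RComod k H) (m : M) :
    X ⊴ₗ leg c j m ≫ μₗ (K.obj j).functor X m = μₗ c.pt.functor X m ≫ leg c j (X ⊙ₗ m) :=
  LLax.nat_comm (c.π.app j) X m

/-- The morphism induced by a pointwise limit. -/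
def evalLift {K : J ⥤ Dual k H M} {c : Cone K} (h : ∀ m, IsLimit ((eval m).mapCone c))
    (s : Cone K) (m : M) : s.pt.functor.obj m ⟶ c.pt.functor.obj m :=
  (h m).lift ((eval m).mapCone s)

lemma evalLift_leg {K : J ⥤ Dual k H M} {c : Cone K} (h : ∀ m, IsLimit ((eval m).mapCone c))
    (s : Cone K) (m : M) (j : J) : evalLift h s m ≫ leg c j m = leg s j m :=
  (h m).fac ((eval m).mapCone s) j

lemma hom_ext_of_leg {K : J ⥤ Dual k H M} {c : Cone K} (h : ∀ m, IsLimit ((eval m).mapCone c))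
    {V : ModuleCat.{u} k} {m : M} {f g : V ⟶ c.pt.functor.obj m}
    (e : ∀ j, f ≫ leg c j m = g ≫ leg c j m) : f = g :=
  (h m).hom_ext e

/-- Evaluations jointly reflect limits. -/
def isLimitOfEval {K : J ⥤ Dual k H M} (c : Cone K) (h : ∀ m, IsLimit ((eval m).mapCone c)) :
    IsLimit c where
  lift s := LLax.mkHom
    { app m := evalLift h s m
      naturality m n f := hom_ext_of_leg h fun j => by
        rw [Category.assoc, evalLift_leg, Category.assoc, leg_naturality,
          ← evalLift_leg h s m j, Category.assoc, ← leg_naturality] }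
    fun X m => hom_ext_of_leg h fun j => by
      change (X ⊴ₗ evalLift h s m ≫ _) ≫ _ = (_ ≫ evalLift h s (X ⊙ₗ m)) ≫ _
      rw [Category.assoc, Category.assoc, evalLift_leg, ← leg_comm, ← leg_comm,
        ← actionHomRight_comp_assoc, evalLift_leg]
  fac s j := LLax.hom_ext fun m => evalLift_leg h s m j
  uniq s f hf := LLax.hom_ext fun m => (h m).uniq ((eval m).mapCone s) _ fun j =>
    congrArg (fun α => (LLax.nat α).app m) (hf j)

end

section

variable {J : Type} [SmallCategory J] {K : J ⥤ Dual k H M} {c : Cone (K ⋙ toFunctor k H M)}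

/-- The components of a cone of functors. -/
def proj (c : Cone (K ⋙ toFunctor k H M)) (j : J) (m : M) :
    c.pt.obj m ⟶ (K.obj j).functor.obj m :=
  (c.π.app j).app m

lemma proj_comp {i j : J} (f : i ⟶ j) (m : M) :
    proj c i m ≫ (LLax.nat (K.map f)).app m = proj c j m :=
  congrArg (fun α => NatTrans.app α m) (c.w f)

lemma proj_naturality (j : J) {m n : M} (f : m ⟶ n) :
    c.pt.map f ≫ proj c j n = proj c j m ≫ (K.obj j).functor.map f :=
  (c.π.app j).naturality f

/-- The cone defining the structure morphism of a pointwise limit. -/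
def laxCone (c : Cone (K ⋙ toFunctor k H M)) (X : RComod k H) (m : M) :
    Cone ((K ⋙ toFunctor k H M) ⋙ (evaluation M (ModuleCat.{u} k)).obj (X ⊙ₗ m)) where
  pt := X ⊙ₗ c.pt.obj m
  π :=
    { app j := X ⊴ₗ proj c j m ≫ μₗ (K.obj j).functor X m
      naturality i j f := by
        have h := LLax.nat_comm (K.map f) X m
        change 𝟙 _ ≫ X ⊴ₗ proj c j m ≫ μₗ (K.obj j).functor X m =
          (X ⊴ₗ proj c i m ≫ μₗ (K.obj i).functor X m) ≫
            (LLax.nat (K.map f)).app (X ⊙ₗ m)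
        rw [Category.id_comp, Category.assoc, ← h, ← actionHomRight_comp_assoc, proj_comp] }

variable (hc : IsLimit c)

/-- The pointwise limit is a limit at each object. -/
def evalLimit (m : M) : IsLimit (((evaluation M (ModuleCat.{u} k)).obj m).mapCone c) :=
  isLimitOfPreserves _ hc

/-- The structure morphism of a pointwise limit. -/
def laxLift (X : RComod k H) (m : M) : X ⊙ₗ c.pt.obj m ⟶ c.pt.obj (X ⊙ₗ m) :=
  (evalLimit hc (X ⊙ₗ m)).lift (laxCone c X m)

lemma laxLift_proj (X : RComod k H) (m : M) (j : J) :
    laxLift hc X m ≫ proj c j (X ⊙ₗ m) = X ⊴ₗ proj c j m ≫ μₗ (K.obj j).functor X m :=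
  (evalLimit hc (X ⊙ₗ m)).fac (laxCone c X m) j

lemma hom_ext_of_proj (hc : IsLimit c) {V : ModuleCat.{u} k} {m : M} {f g : V ⟶ c.pt.obj m}
    (h : ∀ j, f ≫ proj c j m = g ≫ proj c j m) : f = g :=
  (evalLimit hc m).hom_ext h

variable [FinCategory J]

/-- The pointwise limit of a finite diagram, as an object of the dual. -/
def limitObj : Dual k H M where
  functor := c.pt
  lax :=
    { μₗ X m := laxLift hc X m
      μₗ_naturality_left f m := hom_ext_of_proj hc fun j => by
        rw [Category.assoc, Category.assoc, laxLift_proj, proj_naturality, reassoc_of% laxLift_proj,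
          ← μₗ_naturality_left, ← Category.assoc, ← Category.assoc, ← actionHom_def,
          actionHom_def']
      μₗ_naturality_right X _ _ f := hom_ext_of_proj hc fun j => by
        rw [Category.assoc, Category.assoc, laxLift_proj, proj_naturality, reassoc_of% laxLift_proj,
          ← μₗ_naturality_right, ← actionHomRight_comp_assoc, proj_naturality,
          actionHomRight_comp_assoc]
      μₗ_associativity X Y m := hom_ext_of_proj hc fun j => by
        rw [Category.assoc, proj_naturality, reassoc_of% laxLift_proj, μₗ_associativity]
        simp only [Category.assoc]
        rw [laxLift_proj, ← actionHomRight_comp_assoc, laxLift_proj, actionHomRight_comp_assoc]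
        simp
      μₗ_unitality m := hom_ext_of_proj hc fun j => by
        rw [Category.assoc, proj_naturality, reassoc_of% laxLift_proj, ← μₗ_unitality]
        simp }
  typeL :=
    { additive := ⟨fun {m n f g} => hom_ext_of_proj hc fun j => by
        have := (K.obj j).typeL.additive
        rw [Preadditive.add_comp, proj_naturality, proj_naturality, proj_naturality,
          Functor.map_add, Preadditive.comp_add]⟩
      linear := ⟨fun {m n} f r => hom_ext_of_proj hc fun j => by
        have := (K.obj j).typeL.additive
        have := (K.obj j).typeL.linear
        rw [Linear.smul_comp, proj_naturality, proj_naturality, Functor.map_smul,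
          Linear.comp_smul]⟩
      leftExact := ⟨fun I _ _ => preservesLimitsOfShape_of_isLimit hc fun j => by
        have := (K.obj j).typeL.leftExact
        exact inferInstanceAs (PreservesLimitsOfShape I (K.obj j).functor)⟩
      coproducts I := preservesColimitsOfShape_of_isLimit hc fun j =>
        (K.obj j).typeL.coproducts I }

/-- The limit cone on the pointwise limit. -/
def limitCone : Cone K where
  pt := limitObj hc
  π :=
    { app j := LLax.mkHom (c.π.app j) fun X m => (laxLift_proj hc X m j).symm
      naturality i j f := LLax.hom_ext fun m => by
        change 𝟙 _ ≫ proj c j m = proj c i m ≫ (LLax.nat (K.map f)).app m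
        rw [proj_comp, Category.id_comp] }

/-- The pointwise limit is a limit in the dual. -/
def limitConeIsLimit : IsLimit (limitCone hc) :=
  isLimitOfEval _ fun m => evalLimit hc m

end

instance : HasFiniteLimits (Dual k H M) where
  out _ _ _ := ⟨fun K => ⟨_, limitConeIsLimit (limit.isLimit (K ⋙ toFunctor k H M))⟩⟩

instance (m : M) : PreservesFiniteLimits (eval m : Dual k H M ⥤ _) where
  preservesFiniteLimits _ _ _ := ⟨fun {K} => preservesLimit_of_preserves_limit_cone
    (limitConeIsLimit (limit.isLimit (K ⋙ toFunctor k H M)))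
    (evalLimit (limit.isLimit (K ⋙ toFunctor k H M)) m)⟩

end Dual

open HopfDual.Dual in
/-- The functor `F^*` is left exact. -/
lemma dualMap_preservesFiniteLimits {k : Type u} [Field k] {H : Type u} [Ring H] [Bialgebra k H]
    {M : Type w₁} [Category.{v₁} M] [Preadditive M] [Linear k M]
    [MonoidalLeftAction (RComod k H) M]
    {N : Type w₂} [Category.{v₂} N] [Preadditive N] [Linear k N]
    [MonoidalLeftAction (RComod k H) N] (F : LLax k (RComod k H) M N) :
    PreservesFiniteLimits (dualMap F).functor where
  preservesFiniteLimits _ _ _ := ⟨⟨fun hc => ⟨isLimitOfEval _ fun m =>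
    isLimitOfPreserves (eval (F.functor.obj m)) hc⟩⟩⟩

end HopfDual

end

noncomputable section

namespace HopfDual

/-! ### Regular and trivial comodules -/

section RegularComodule

variable (k : Type u) [Field k] (C : Type u) [AddCommGroup C] [Module k C] [Coalgebra k C]

/-- A coalgebra as a right comodule over itself. -/
def regComod : RComod k C where
  V := C
  coact := Coalgebra.comul (R := k)
  coassoc := LinearMap.ext fun c => Coalgebra.coassoc_apply (R := k) c
  counit := LinearMap.ext fun c => by
    change TensorProduct.rid k C ((Coalgebra.counit (R := k)).lTensor C
      (Coalgebra.comul (R := k) c)) = c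
    rw [Coalgebra.lTensor_counit_comul]
    simp

end RegularComodule

section TrivialComodule

variable (k : Type u) [Field k] (H : Type u) [Ring H] [Bialgebra k H]

/-- The trivial `H`-comodule on a vector space, with coaction `v ↦ v ⊗ 1`. -/
def trivComod (V : Type u) [AddCommGroup V] [Module k V] : RComod k H where
  V := V
  coact := (TensorProduct.mk k V H).flip 1
  coassoc := by
    ext v
    simp [Algebra.TensorProduct.one_def]
  counit := by
    ext v
    simp

variable {V W : Type u} [AddCommGroup V] [Module k V] [AddCommGroup W] [Module k W]

/-- A linear map as a morphism of trivial comodules. -/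
def trivMap (f : V →ₗ[k] W) : trivComod k H V ⟶ trivComod k H W :=
  RComod.mkHom (X := trivComod k H V) (Y := trivComod k H W) f fun _ => rfl

/-- The morphism `r ↦ r v` to a trivial comodule. -/
def trivPoint (v : V) : unitComod k H ⟶ trivComod k H V :=
  RComod.mkHom (X := unitComod k H) (Y := trivComod k H V) (LinearMap.toSpanSingleton k V v)
    fun _ => rfl

lemma mix_trivComod {C : Type u} [AddCommGroup C] [Module k C]
    [Module H C] [IsScalarTower k H C] (v : V) {M : Type u} [AddCommGroup M] [Module k M] (s : M ⊗[k] C) :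
    mix k H C V M ((v ⊗ₜ 1) ⊗ₜ s) = (TensorProduct.assoc k V M C).symm (v ⊗ₜ s) := by
  induction s with
  | zero => simp
  | add x y hx hy => simp only [TensorProduct.tmul_add, map_add, hx, hy]
  | tmul a b => simp

variable {C : Type u} [AddCommGroup C] [Module k C] [Coalgebra k C]
  [Module H C] [IsScalarTower k H C] [IsModuleCoalgebra k H C]

/-- The morphism `x ↦ v ⊗ x`. -/
def insertHom (v : V) (m : RComod k C) : m ⟶ tensorComod (trivComod k H V) m :=
  (tensorComodUnit (H := H) m).inv ≫ tensorComodMap (trivPoint k H v) (𝟙 m)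

lemma lin_insertHom (v : V) (m : RComod k C) (x : m.V) :
    RComod.lin (insertHom k H v m) x = v ⊗ₜ[k] x :=
  congrArg (· ⊗ₜ[k] x) (one_smul k v)

lemma trivComod_coact (V : Type u) [AddCommGroup V] [Module k V] (s : V ⊗[k] C) :
    (tensorComod (trivComod k H V) (regComod k C)).coact s =
      (TensorProduct.assoc k V C C).symm ((Coalgebra.comul (R := k)).lTensor V s) :=
  LinearMap.congr_fun
    (f := ((tensorComod (trivComod k H V) (regComod k C)).coact :
      V ⊗[k] C →ₗ[k] (V ⊗[k] C) ⊗[k] C))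
    (g := (TensorProduct.assoc k V C C).symm.toLinearMap ∘ₗ
      (Coalgebra.comul (R := k) (A := C)).lTensor V)
    (TensorProduct.ext' fun v (c : C) => mix_trivComod k H v (Coalgebra.comul (R := k) c)) s

/-- The coaction of a comodule as a colinear map to a cofree comodule. -/
def coactHom (m : RComod k C) : m ⟶ tensorComod (trivComod k H m.V) (regComod k C) :=
  RComod.mkHom (Y := tensorComod (trivComod k H m.V) (regComod k C)) m.coact fun x =>
    (trivComod_coact k H m.V (m.coact x)).trans
      ((LinearEquiv.symm_apply_eq _).2 (LinearMap.congr_fun m.coassoc x).symm)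

/-- The action `H ⊗ C ⟶ C` as a colinear map. -/
def actHom (C : Type u) [AddCommGroup C] [Module k C] [Coalgebra k C]
    [Module H C] [IsScalarTower k H C] [IsModuleCoalgebra k H C] :
    tensorComod (regComod k H) (regComod k C) ⟶ regComod k C :=
  RComod.mkHom (X := tensorComod (regComod k H) (regComod k C)) (Y := regComod k C)
    (actMap k H C) fun t => by
    refine LinearMap.congr_fun (f := (Coalgebra.comul (R := k) (A := C)) ∘ₗ actMap k H C)
      (g := (actMap k H C).rTensor C ∘ₗ (tensorComod (regComod k H) (regComod k C)).coact)
      (TensorProduct.ext' fun h c => ?_) t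
    change Coalgebra.comul (R := k) (h • c) = (actMap k H C).rTensor C
      (mix k H C H C (Coalgebra.comul (R := k) h ⊗ₜ Coalgebra.comul (R := k) c))
    rw [IsModuleCoalgebra.comul_smul]
    generalize Coalgebra.comul (R := k) h = s
    generalize Coalgebra.comul (R := k) c = t
    induction s with
    | zero => simp
    | add x y hx hy => simp only [TensorProduct.add_tmul, map_add, hx, hy]
    | tmul a b =>
      induction t with
      | zero => simp
      | add x y hx hy => simp only [TensorProduct.tmul_add, map_add, hx, hy]
      | tmul c d => simp

end TrivialComodule

/-! ### Copowers of comodules -/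

section Copower

variable {k : Type u} [Field k]

/-- The vector space `V ⊗ W` as a copower of `W`. -/
def copowerIsColimit {V W I : Type u} [AddCommGroup V] [Module k V] [AddCommGroup W] [Module k W]
    (b : Module.Basis I k V) :
    IsColimit (Cofan.mk (ModuleCat.of k (V ⊗[k] W))
      fun i => ModuleCat.ofHom (TensorProduct.mk k V W (b i))) :=
  Cofan.IsColimit.mk _ (fun s => ModuleCat.ofHom (TensorProduct.lift
      (b.constr k fun i => (s.inj i).hom)))
    (fun s i => by
      apply ModuleCat.hom_ext
      refine LinearMap.ext fun w => ?_
      change b.constr k (fun i => (s.inj i).hom) (b i) w = (s.inj i).hom w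
      rw [b.constr_basis])
    (fun s f hf => by
      apply ModuleCat.hom_ext
      refine TensorProduct.ext (b.ext fun i => LinearMap.ext fun w => ?_)
      change f.hom (b i ⊗ₜ w) = b.constr k (fun i => (s.inj i).hom) (b i) w
      rw [b.constr_basis, ← hf i]
      rfl)

variable {H : Type u} [Ring H] [Bialgebra k H] {C : Type u} [AddCommGroup C] [Module k C]
  [Coalgebra k C] [Module H C] [IsScalarTower k H C] [IsModuleCoalgebra k H C]

/-- The underlying vector space of `V ⊗ m` as a copower of the one of `m`. -/
def copowerForgetIsColimit {V I : Type u} [AddCommGroup V] [Module k V]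
    (b : Module.Basis I k V) (m : RComod k C) :
    IsColimit (Cofan.mk ((RComod.forget k C).obj (tensorComod (trivComod k H V) m))
      fun i => (RComod.forget k C).map (insertHom k H (b i) m)) :=
  (copowerIsColimit (W := m.V) b).ofIsoColimit (Cofan.ext (Iso.refl _) fun i => by
    apply ModuleCat.hom_ext
    exact LinearMap.ext fun x => (lin_insertHom k H (b i) m x).symm)

/-- The comodule `V ⊗ m` as a copower of `m`. -/
def copowerComodIsColimit {V I : Type u} [AddCommGroup V] [Module k V]
    (b : Module.Basis I k V) (m : RComod k C) :
    IsColimit (Cofan.mk (tensorComod (trivComod k H V) m) fun i => insertHom k H (b i) m) :=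
  isColimitOfIsColimitCofanMkObj (RComod.forget k C) _ _ (copowerForgetIsColimit b m)

end Copower

/-! ### Objects of the dual of a category of comodules -/

namespace Dual

open MonoidalLeftAction Functor.LaxLeftLinear

variable {k : Type u} [Field k] {H : Type u} [Ring H] [Bialgebra k H]
  {C : Type u} [AddCommGroup C] [Module k C]
  [Coalgebra k C] [Module H C] [IsScalarTower k H C] [IsModuleCoalgebra k H C]

/-- The structure morphism of an object of the dual as a linear map. -/
def mu (T : Dual k H (RComod k C)) (Y : RComod k H) (m : RComod k C) :
    Y.V ⊗[k] T.functor.obj m →ₗ[k] T.functor.obj (tensorComod Y m) :=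
  (μₗ T.functor Y m).hom

/-- The map on morphisms of an object of the dual. -/
def tmap (T : Dual k H (RComod k C)) {m n : RComod k C} (f : m ⟶ n) :
    T.functor.obj m →ₗ[k] T.functor.obj n :=
  (T.functor.map f).hom

section

variable (T : Dual k H (RComod k C))

lemma tmap_id (m : RComod k C) : tmap T (𝟙 m) = LinearMap.id :=
  congrArg ModuleCat.Hom.hom (T.functor.map_id m)

lemma tmap_comp {m n p : RComod k C} (f : m ⟶ n) (g : n ⟶ p) (t : T.functor.obj m) :
    tmap T (f ≫ g) t = tmap T g (tmap T f t) :=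
  LinearMap.congr_fun (congrArg ModuleCat.Hom.hom (T.functor.map_comp f g)) t

lemma tmap_comp_eq {m n n' p : RComod k C} {f : m ⟶ n} {g : n ⟶ p} {f' : m ⟶ n'} {g' : n' ⟶ p}
    (h : f ≫ g = f' ≫ g') (t : T.functor.obj m) :
    tmap T g (tmap T f t) = tmap T g' (tmap T f' t) := by
  rw [← tmap_comp, h, tmap_comp]

lemma mu_left {Y Y' : RComod k H} (f : Y ⟶ Y') (m : RComod k C)
    (s : Y.V ⊗[k] T.functor.obj m) :
    mu T Y' m ((RComod.lin f).rTensor _ s) = tmap T (tensorComodMap f (𝟙 m)) (mu T Y m s) :=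
  LinearMap.congr_fun (congrArg ModuleCat.Hom.hom (μₗ_naturality_left T.functor f m)) s

lemma mu_right (Y : RComod k H) {m n : RComod k C} (g : m ⟶ n)
    (s : Y.V ⊗[k] T.functor.obj m) :
    mu T Y n ((tmap T g).lTensor _ s) = tmap T (tensorComodMap (𝟙 Y) g) (mu T Y m s) :=
  LinearMap.congr_fun (congrArg ModuleCat.Hom.hom (μₗ_naturality_right T.functor Y g)) s

lemma mu_assoc (Y Z : RComod k H) (m : RComod k C) (y : Y.V) (z : Z.V) (t : T.functor.obj m) :
    tmap T (tensorComodAssoc Y Z m).hom (mu T (tensorComod Y Z) m ((y ⊗ₜ[k] z) ⊗ₜ[k] t)) =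
      mu T Y (tensorComod Z m) (y ⊗ₜ[k] mu T Z m (z ⊗ₜ[k] t)) :=
  LinearMap.congr_fun (congrArg ModuleCat.Hom.hom (μₗ_associativity T.functor Y Z m))
    ((y ⊗ₜ[k] z) ⊗ₜ[k] t)

lemma mu_unit (m : RComod k C) (r : k) (t : T.functor.obj m) :
    tmap T (tensorComodUnit m).hom (mu T (unitComod k H) m (r ⊗ₜ[k] t)) = r • t :=
  (LinearMap.congr_fun (congrArg ModuleCat.Hom.hom (μₗ_unitality T.functor (C := RComod k H) m))
    (r ⊗ₜ[k] t)).symm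

lemma mu_trivComod {V : Type u} [AddCommGroup V] [Module k V] (m : RComod k C) (v : V)
    (t : T.functor.obj m) :
    mu T (trivComod k H V) m (v ⊗ₜ[k] t) = tmap T (insertHom k H v m) t := by
  have h₁ := mu_left T (trivPoint k H v) m ((1 : k) ⊗ₜ[k] t)
  have h₂ : mu T (unitComod k H) m ((1 : k) ⊗ₜ[k] t) = tmap T (tensorComodUnit (H := H) m).inv t := by
    have h := congrArg (tmap T (tensorComodUnit (H := H) m).inv) (mu_unit T m 1 t)
    rwa [← tmap_comp, Iso.hom_inv_id, tmap_id, one_smul] at h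
  have h₃ : RComod.lin (trivPoint k H v) (1 : k) = v := one_smul k v
  refine (congrArg (fun w => mu T (trivComod k H V) m (w ⊗ₜ[k] t)) h₃.symm).trans ?_
  rw [insertHom, tmap_comp, ← h₂]
  exact h₁

lemma mu_trivComod_bijective (V : Type u) [AddCommGroup V] [Module k V] (m : RComod k C) :
    Function.Bijective (mu T (trivComod k H V) m) := by
  let b := Module.Basis.ofVectorSpace k V
  have := T.typeL.coproducts (Module.Basis.ofVectorSpaceIndex k V)
  have h₁ := copowerIsColimit (k := k) (W := T.functor.obj m) b
  have h₂ := isColimitCofanMkObjOfIsColimit T.functor _ _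
    (copowerComodIsColimit (H := H) b m)
  have e : μₗ T.functor (trivComod k H V) m = (h₁.coconePointUniqueUpToIso h₂).hom :=
    h₁.hom_ext fun ⟨i⟩ => by
      refine Eq.trans ?_ (h₁.comp_coconePointUniqueUpToIso_hom h₂ ⟨i⟩).symm
      apply ModuleCat.hom_ext
      exact LinearMap.ext fun t => mu_trivComod T m (b i) t
  have : IsIso (μₗ T.functor (trivComod k H V) m) := by
    rw [e]
    exact Iso.isIso_hom _
  exact ConcreteCategory.bijective_of_isIso (μₗ T.functor (trivComod k H V) m)

/-- The isomorphism `V ⊗ T(m) ≅ T(V ⊗ m)` for an object `T` of the dual. -/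
def muEquiv (V : Type u) [AddCommGroup V] [Module k V] (m : RComod k C) :
    V ⊗[k] T.functor.obj m ≃ₗ[k] T.functor.obj (tensorComod (trivComod k H V) m) :=
  LinearEquiv.ofBijective (mu T (trivComod k H V) m) (mu_trivComod_bijective T V m)

/-- The map `T(m) → m ⊗ T(C)` induced by the coaction of `m`. -/
def coactMap (m : RComod k C) :
    T.functor.obj m →ₗ[k] m.V ⊗[k] T.functor.obj (regComod k C) :=
  (muEquiv T m.V (regComod k C)).symm.toLinearMap ∘ₗ tmap T (coactHom k H m)

lemma mu_coactMap (m : RComod k C) (t : T.functor.obj m) :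
    mu T (trivComod k H m.V) (regComod k C) (coactMap T m t) = tmap T (coactHom k H m) t :=
  (muEquiv T m.V (regComod k C)).apply_symm_apply _

lemma coactMap_eq_iff {m : RComod k C} {t : T.functor.obj m}
    {s : m.V ⊗[k] T.functor.obj (regComod k C)} :
    coactMap T m t = s ↔
      tmap T (coactHom k H m) t = mu T (trivComod k H m.V) (regComod k C) s :=
  (muEquiv T m.V (regComod k C)).symm_apply_eq

lemma coactMap_injective (m : RComod k C) : Function.Injective (coactMap T m) := by
  have := T.typeL.leftExact
  have : Mono ((RComod.forget k C).map (coactHom k H m)) := by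
    refine (ModuleCat.mono_iff_injective _).2 fun x y h => ?_
    have hx : ∀ x : m.V, TensorProduct.rid k m.V
        ((Coalgebra.counit (R := k) (A := C)).lTensor m.V (m.coact x)) = x :=
      LinearMap.congr_fun m.counit
    have h' : m.coact x = m.coact y := h
    rw [← hx x, ← hx y, h']
  have : Mono (coactHom k H m) := (RComod.forget k C).mono_of_mono_map this
  have h : Function.Injective (tmap T (coactHom k H m)) :=
    (ModuleCat.mono_iff_injective _).1 (inferInstanceAs (Mono (T.functor.map (coactHom k H m))))
  exact (muEquiv T m.V (regComod k C)).symm.injective.comp h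

lemma coactMap_naturality {m n : RComod k C} (f : m ⟶ n) (t : T.functor.obj m) :
    coactMap T n (tmap T f t) = (RComod.lin f).rTensor _ (coactMap T m t) := by
  rw [coactMap_eq_iff]
  refine Eq.trans ?_ (mu_left T (trivMap k H (RComod.lin f)) (regComod k C)
    (coactMap T m t)).symm
  rw [mu_coactMap]
  refine tmap_comp_eq T ?_ t
  apply RComod.hom_ext
  exact LinearMap.ext fun x => RComod.lin_comm f x

end

end Dual

end HopfDual

end

noncomputable section

namespace HopfDual

/-! ### The forgetful functor as an object of the dual -/

section Forgetful

open MonoidalLeftAction MonoidalRightAction Functor.LaxLeftLinear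

variable (k : Type u) [Field k] (H : Type u) [Ring H] [Bialgebra k H]

lemma coalgMod_act_tmul {C : Type u} [AddCommGroup C] [Module k C] [Module H C]
    [IsScalarTower k H C] (h : H) (a b : C) :
    tensorAct (Algebra.lsmul k k C) (Algebra.lsmul k k C) h (a ⊗ₜ b) =
      TensorProduct.map (actMap k H C) (actMap k H C)
        (TensorProduct.tensorTensorTensorComm k H H C C
          (Coalgebra.comul (R := k) h ⊗ₜ (a ⊗ₜ b))) := by
  rw [tensorAct_tmul]
  generalize Coalgebra.comul (R := k) h = s
  induction s with
  | zero => simp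
  | add x y hx hy => simp only [TensorProduct.add_tmul, map_add, hx, hy]
  | tmul x y => simp

variable (C : Type u) [AddCommGroup C] [Module k C]
  [Coalgebra k C] [Module H C] [IsScalarTower k H C] [IsModuleCoalgebra k H C]

/-- A module coalgebra as a module. -/
def coalgMod (C : Type u) [AddCommGroup C] [Module k C] [Module H C] [IsScalarTower k H C] :
    HMod k H where
  V := C
  act := Algebra.lsmul k k C

/-- The comultiplication of a module coalgebra as a morphism of modules. -/
def comulHom : coalgMod k H C ⟶ coalgMod k H C ⊗ coalgMod k H C :=
  HMod.mkHom (X := coalgMod k H C) (Y := coalgMod k H C ⊗ coalgMod k H C)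
    (Coalgebra.comul (R := k) (A := C)) fun h c => by
    refine (IsModuleCoalgebra.comul_smul (k := k) h (show C from c)).trans ?_
    change _ = tensorAct (Algebra.lsmul k k C) (Algebra.lsmul k k C) h
      (Coalgebra.comul (R := k) (show C from c))
    generalize Coalgebra.comul (R := k) (show C from c) = s
    induction s with
    | zero => simp
    | add x y hx hy => simp only [TensorProduct.tmul_add, map_add, hx, hy]
    | tmul a b => exact (coalgMod_act_tmul k H h a b).symm

/-- The counit of a module coalgebra as a morphism of modules. -/
def counitHom : coalgMod k H C ⟶ 𝟙_ (HMod k H) :=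
  HMod.mkHom (X := coalgMod k H C) (Y := 𝟙_ (HMod k H))
    (Coalgebra.counit (R := k) (A := C)) fun h c =>
      IsModuleCoalgebra.counit_smul (k := k) h (show C from c)

/-- The forgetful functor from comodules to vector spaces, as a strict module functor. -/
def forgetDual : Dual k H (RComod k C) where
  functor := RComod.forget k C
  lax :=
    { μₗ Y m := 𝟙 (ModuleCat.of k (Y.V ⊗[k] m.V))
      μₗ_naturality_left f m := rfl
      μₗ_naturality_right Y _ _ f := rfl
      μₗ_associativity Y Z m := by
        apply ModuleCat.hom_ext
        exact TensorProduct.ext_threefold fun y z x => rfl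
      μₗ_unitality m := rfl }
  typeL :=
    { additive := inferInstance
      linear := inferInstance
      leftExact := inferInstance
      coproducts _ := inferInstance }

variable {k H C}

/-- The linear map `y ⊗ (v ⊗ c) ↦ (y₍₀₎ ⊗ v) ⊗ y₍₁₎ c`. -/
def coalgXi (C : Type u) [AddCommGroup C] [Module k C] [Module H C] [IsScalarTower k H C]
    (Y : RComod k H) (V : Type u) [AddCommGroup V] [Module k V] :
    Y.V ⊗[k] (V ⊗[k] C) →ₗ[k] (Y.V ⊗[k] V) ⊗[k] C :=
  xi Y V (coalgMod k H C)

variable (k H C) in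
/-- The coaction `U ⟶ U ◁ C` on the forgetful functor. -/
def forgetCoact : forgetDual k H C ⟶ forgetDual k H C ⊙ᵣ coalgMod k H C :=
  LLax.mkHom
    { app m := ModuleCat.ofHom m.coact
      naturality m n f := by
        apply ModuleCat.hom_ext
        exact LinearMap.ext fun x => RComod.lin_comm f x }
    fun Y m => by
      apply ModuleCat.hom_ext
      exact TensorProduct.ext' fun y x => LinearMap.congr_fun (LinearMap.rTensor_id C _)
        (coalgXi C Y m.V (y ⊗ₜ[k] m.coact x))

/-- The colinear map `y ⊗ (v ⊗ c) ↦ (y₍₀₎ ⊗ v) ⊗ y₍₁₎ c`. -/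
def cofreeTensor (Y : RComod k H) (V : Type u) [AddCommGroup V] [Module k V] :
    tensorComod Y (tensorComod (trivComod k H V) (regComod k C)) ⟶
      tensorComod (trivComod k H (Y.V ⊗[k] V)) (regComod k C) :=
  RComod.mkHom (X := tensorComod Y (tensorComod (trivComod k H V) (regComod k C)))
    (Y := tensorComod (trivComod k H (Y.V ⊗[k] V)) (regComod k C))
    (coalgXi C Y V) fun t => by
      refine (trivComod_coact k H (Y.V ⊗[k] V) (coalgXi C Y V t)).trans ?_
      refine LinearMap.congr_fun
        (f := (TensorProduct.assoc k (Y.V ⊗[k] V) C C).symm.toLinearMap ∘ₗ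
          (Coalgebra.comul (R := k) (A := C)).lTensor (Y.V ⊗[k] V) ∘ₗ coalgXi C Y V)
        (g := (coalgXi C Y V).rTensor C ∘ₗ
          (tensorComod Y (tensorComod (trivComod k H V) (regComod k C))).coact)
        (TensorProduct.ext (LinearMap.ext fun y => TensorProduct.ext' fun v (c : C) => ?_)) t
      change (TensorProduct.assoc k (Y.V ⊗[k] V) C C).symm
          ((Coalgebra.comul (R := k) (A := C)).lTensor (Y.V ⊗[k] V)
            (coalgXi C Y V (y ⊗ₜ (v ⊗ₜ c)))) =
        (coalgXi C Y V).rTensor C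
          (coalgXi C Y (V ⊗[k] C) (y ⊗ₜ
            (tensorComod (trivComod k H V) (regComod k C)).coact (v ⊗ₜ[k] c)))
      have h := LinearMap.congr_fun (xi_natural (𝟙 Y) (LinearMap.id (M := V)) (comulHom k H C))
        (y ⊗ₜ[k] (v ⊗ₜ[k] c))
      let ξ : Y.V ⊗[k] (V ⊗[k] (C ⊗[k] C)) →ₗ[k] (Y.V ⊗[k] V) ⊗[k] (C ⊗[k] C) :=
        xi Y V (coalgMod k H C ⊗ coalgMod k H C)
      have e₁ : (Coalgebra.comul (R := k) (A := C)).lTensor (Y.V ⊗[k] V)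
            (coalgXi C Y V (y ⊗ₜ (v ⊗ₜ c))) =
          ξ (y ⊗ₜ[k] (v ⊗ₜ[k] Coalgebra.comul (R := k) (A := C) c)) := by
        refine Eq.trans ?_ h.symm
        rw [RComod.lin_id, TensorProduct.map_id]
        rfl
      have e₂ : (tensorComod (trivComod k H V) (regComod k C)).coact (v ⊗ₜ[k] c) =
          (TensorProduct.assoc k V C C).symm (v ⊗ₜ Coalgebra.comul (R := k) c) :=
        trivComod_coact k H V (v ⊗ₜ[k] c)
      rw [e₁, e₂]
      generalize Coalgebra.comul (R := k) (A := C) c = s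
      induction s with
      | zero =>
        rw [TensorProduct.tmul_zero, TensorProduct.tmul_zero, map_zero, map_zero, map_zero,
          TensorProduct.tmul_zero, map_zero, map_zero]
      | add a b ha hb =>
        rw [TensorProduct.tmul_add, TensorProduct.tmul_add, map_add, map_add, map_add,
          TensorProduct.tmul_add, map_add, map_add, ha, hb]
      | tmul a b =>
        rw [LinearEquiv.symm_apply_eq]
        exact xi_tensor Y V (coalgMod k H C) (coalgMod k H C) y v a b

/-- The colinear map `y ⊗ c ↦ y₍₀₎ ⊗ y₍₁₎ c`. -/
def cofreeAct (Y : RComod k H) :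
    tensorComod Y (regComod k C) ⟶ tensorComod (trivComod k H Y.V) (regComod k C) :=
  tensorComodMap (coactHom k H Y) (𝟙 (regComod k C)) ≫
    (tensorComodAssoc (trivComod k H Y.V) (regComod k H) (regComod k C)).hom ≫
      tensorComodMap (𝟙 (trivComod k H Y.V)) (actHom k H C)

lemma lin_cofreeAct (Y : RComod k H) (y : Y.V) (c : C) :
    RComod.lin (cofreeAct (C := C) Y) (y ⊗ₜ[k] c) =
      (orb (Algebra.lsmul k k C) c).lTensor Y.V (Y.coact y) := by
  change (actMap k H C).lTensor Y.V (TensorProduct.assoc k Y.V H C (Y.coact y ⊗ₜ[k] c)) = _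
  generalize Y.coact y = s
  induction s with
  | zero => simp
  | add x y hx hy => simp only [TensorProduct.add_tmul, map_add, hx, hy]
  | tmul a h => simp

lemma insert_cofreeTensor (Y : RComod k H) {V : Type u} [AddCommGroup V] [Module k V] (v : V) :
    tensorComodMap (𝟙 Y) (insertHom k H v (regComod k C)) ≫ cofreeTensor Y V =
      cofreeAct Y ≫ tensorComodMap (trivMap k H ((TensorProduct.mk k Y.V V).flip v))
        (𝟙 (regComod k C)) := by
  apply RComod.hom_ext
  refine TensorProduct.ext' fun y (c : C) => ?_
  change coalgXi C Y V (y ⊗ₜ[k] RComod.lin (insertHom k H v (regComod k C)) c) =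
    ((TensorProduct.mk k Y.V V).flip v).rTensor C (RComod.lin (cofreeAct (C := C) Y) (y ⊗ₜ[k] c))
  rw [lin_cofreeAct]
  refine (congrArg (fun w => coalgXi C Y V (y ⊗ₜ[k] w))
    (lin_insertHom k H v (regComod k C) c)).trans ?_
  refine (xi_tmul Y V (coalgMod k H C) y v c).trans ?_
  generalize Y.coact y = s
  induction s with
  | zero => exact (map_zero _).trans ((congrArg _ (map_zero _)).trans (map_zero _)).symm
  | add x y hx hy =>
    simp only [map_add, hx, hy]
    rfl
  | tmul a h => rfl

end Forgetful

/-! ### The comodule of an object of the dual -/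

namespace Dual

open MonoidalLeftAction MonoidalRightAction Functor.LaxLeftLinear

variable {k : Type u} [Field k] {H : Type u} [Ring H] [Bialgebra k H]
  {C : Type u} [AddCommGroup C] [Module k C]
  [Coalgebra k C] [Module H C] [IsScalarTower k H C] [IsModuleCoalgebra k H C]

section

variable (T : Dual k H (RComod k C))

/-- The map `H ⊗ T(C) → T(C)` induced by the action of `H` on `C`. -/
def fiberAct : H ⊗[k] T.functor.obj (regComod k C) →ₗ[k] T.functor.obj (regComod k C) :=
  tmap T (actHom k H C) ∘ₗ mu T (regComod k H) (regComod k C)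

lemma fiberAct_one (t : T.functor.obj (regComod k C)) : fiberAct T ((1 : H) ⊗ₜ[k] t) = t := by
  let η : unitComod k H ⟶ regComod k H :=
    RComod.mkHom (X := unitComod k H) (Y := regComod k H) (Algebra.linearMap k H) fun (r : k) => by
      change Coalgebra.comul (R := k) (algebraMap k H r) = algebraMap k H r ⊗ₜ[k] 1
      rw [Bialgebra.comul_algebraMap]
      rfl
  have h₁ : mu T (regComod k H) (regComod k C) ((1 : H) ⊗ₜ[k] t) =
      tmap T (tensorComodMap η (𝟙 _)) (mu T (unitComod k H) (regComod k C) ((1 : k) ⊗ₜ[k] t)) := by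
    refine Eq.trans ?_ (mu_left T η (regComod k C) ((1 : k) ⊗ₜ[k] t))
    exact congrArg (fun w : H => mu T (regComod k H) (regComod k C) (w ⊗ₜ[k] t))
      (map_one (algebraMap k H)).symm
  have h₂ : tensorComodMap η (𝟙 _) ≫ actHom k H C = (tensorComodUnit (regComod k C)).hom := by
    apply RComod.hom_ext
    refine TensorProduct.ext' fun (r : k) (c : C) => ?_
    exact algebraMap_smul H r c
  change tmap T (actHom k H C) (mu T (regComod k H) (regComod k C) ((1 : H) ⊗ₜ[k] t)) = t
  rw [h₁, ← tmap_comp, h₂, mu_unit, one_smul]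

lemma fiberAct_mul (h h' : H) (t : T.functor.obj (regComod k C)) :
    fiberAct T ((h * h') ⊗ₜ[k] t) = fiberAct T (h ⊗ₜ[k] fiberAct T (h' ⊗ₜ[k] t)) := by
  change tmap T (actHom k H C) (mu T (regComod k H) (regComod k C) ((h * h') ⊗ₜ[k] t)) =
    tmap T (actHom k H C) (mu T (regComod k H) (regComod k C) (h ⊗ₜ[k]
      tmap T (actHom k H C) (mu T (regComod k H) (regComod k C) (h' ⊗ₜ[k] t))))
  have h₁ := mu_left T (actHom k H H) (regComod k C)
    (((h ⊗ₜ[k] h' : H ⊗[k] H)) ⊗ₜ[k] t)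
  have h₂ := mu_right T (regComod k H) (actHom k H C)
    (h ⊗ₜ[k] mu T (regComod k H) (regComod k C) (h' ⊗ₜ[k] t))
  have h₃ := mu_assoc T (regComod k H) (regComod k H) (regComod k C) h h' t
  refine (congrArg (tmap T (actHom k H C)) h₁).trans ?_
  refine Eq.trans ?_ (congrArg (tmap T (actHom k H C)) h₂).symm
  rw [← h₃, ← tmap_comp, ← tmap_comp, ← tmap_comp]
  refine congrArg (fun f => tmap T f _) ?_
  apply RComod.hom_ext
  exact TensorProduct.ext_threefold fun (a b : H) (c : C) => mul_smul a b c

/-- The left `H`-module `T(C)`. -/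
def fiber : HMod k H where
  V := T.functor.obj (regComod k C)
  act := AlgHom.ofLinearMap (TensorProduct.curry (fiberAct T))
    (LinearMap.ext fun t => fiberAct_one T t)
    (fun h h' => LinearMap.ext fun t => fiberAct_mul T h h' t)

lemma tmap_cofreeAct (Y : RComod k H) (y : Y.V) (t : T.functor.obj (regComod k C)) :
    tmap T (cofreeAct Y) (mu T Y (regComod k C) (y ⊗ₜ[k] t)) =
      mu T (trivComod k H Y.V) (regComod k C) ((orb (fiber T).act t).lTensor Y.V (Y.coact y)) := by
  have h₁ := mu_left T (coactHom k H Y) (regComod k C) (y ⊗ₜ[k] t)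
  change mu T (tensorComod (trivComod k H Y.V) (regComod k H)) (regComod k C)
    (Y.coact y ⊗ₜ[k] t) = _ at h₁
  rw [cofreeAct, tmap_comp, tmap_comp, ← h₁]
  refine LinearMap.congr_fun
    (f := tmap T (tensorComodMap (𝟙 (trivComod k H Y.V)) (actHom k H C)) ∘ₗ
      tmap T (tensorComodAssoc (trivComod k H Y.V) (regComod k H) (regComod k C)).hom ∘ₗ
        (mu T (tensorComod (trivComod k H Y.V) (regComod k H)) (regComod k C) ∘ₗ
          (TensorProduct.mk k (Y.V ⊗[k] H) (T.functor.obj (regComod k C))).flip t :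
            Y.V ⊗[k] H →ₗ[k] _))
    (g := (mu T (trivComod k H Y.V) (regComod k C) ∘ₗ (orb (fiber T).act t).lTensor Y.V :
      Y.V ⊗[k] H →ₗ[k] _))
    (TensorProduct.ext' fun a h => ?_) (Y.coact y)
  refine (congrArg (tmap T (tensorComodMap (𝟙 (trivComod k H Y.V)) (actHom k H C)))
    (mu_assoc T (trivComod k H Y.V) (regComod k H) (regComod k C) a h t)).trans ?_
  exact (mu_right T (trivComod k H Y.V) (actHom k H C) _).symm

lemma tmap_cofreeTensor (Y : RComod k H) {V : Type u} [AddCommGroup V] [Module k V] (y : Y.V)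
    (s : V ⊗[k] T.functor.obj (regComod k C)) :
    tmap T (cofreeTensor Y V) (mu T Y (tensorComod (trivComod k H V) (regComod k C))
      (y ⊗ₜ[k] mu T (trivComod k H V) (regComod k C) s)) =
      mu T (trivComod k H (Y.V ⊗[k] V)) (regComod k C) (xi Y V (fiber T) (y ⊗ₜ[k] s)) := by
  refine LinearMap.congr_fun
    (f := tmap T (cofreeTensor Y V) ∘ₗ mu T Y (tensorComod (trivComod k H V) (regComod k C)) ∘ₗ
      TensorProduct.mk k Y.V _ y ∘ₗ (mu T (trivComod k H V) (regComod k C) :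
        V ⊗[k] (fiber T).V →ₗ[k] _))
    (g := mu T (trivComod k H (Y.V ⊗[k] V)) (regComod k C) ∘ₗ xi Y V (fiber T) ∘ₗ
      TensorProduct.mk k Y.V (V ⊗[k] (fiber T).V) y)
    (TensorProduct.ext' fun v t => ?_) s
  have h₁ := mu_right T Y (insertHom k H v (regComod k C)) (y ⊗ₜ[k] t)
  rw [LinearMap.lTensor_tmul, ← mu_trivComod] at h₁
  refine (congrArg (tmap T (cofreeTensor Y V)) h₁).trans ?_
  refine (tmap_comp_eq T (insert_cofreeTensor (V := V) Y v) _).trans ?_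
  rw [tmap_cofreeAct]
  refine (mu_left T (trivMap k H ((TensorProduct.mk k Y.V V).flip v)) (regComod k C)
    _).symm.trans ?_
  refine congrArg (mu T (trivComod k H (Y.V ⊗[k] V)) (regComod k C)) ?_
  refine Eq.trans ?_ (xi_tmul Y V (fiber T) y v t).symm
  refine LinearMap.congr_fun
    (f := ((TensorProduct.mk k Y.V V).flip v).rTensor (fiber T).V ∘ₗ
      (orb (fiber T).act t).lTensor Y.V)
    (g := xiAux (fiber T) v t) (TensorProduct.ext' fun a h => rfl) (Y.coact y)

lemma coactHom_tensorComod (Y : RComod k H) (m : RComod k C) :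
    coactHom k H (tensorComod Y m) =
      tensorComodMap (𝟙 Y) (coactHom k H m) ≫ cofreeTensor Y m.V := by
  apply RComod.hom_ext
  exact TensorProduct.ext' fun y x => rfl

/-- The maps `T(m) → m ⊗ T(C)` are compatible with the module structures. -/
lemma coactMap_mu (Y : RComod k H) (m : RComod k C) (y : Y.V) (t : T.functor.obj m) :
    coactMap T (tensorComod Y m) (mu T Y m (y ⊗ₜ[k] t)) =
      xi Y m.V (fiber T) (y ⊗ₜ[k] coactMap T m t) := by
  refine (coactMap_eq_iff T).2 ?_
  have h := mu_right T Y (coactHom k H m) (y ⊗ₜ[k] t)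
  rw [LinearMap.lTensor_tmul, ← mu_coactMap] at h
  refine (congrArg (fun f => tmap T f _) (coactHom_tensorComod Y m)).trans ?_
  refine (tmap_comp T _ (cofreeTensor Y m.V) _).trans ?_
  rw [← h]
  exact tmap_cofreeTensor T Y y (coactMap T m t)

/-- The morphism `T ⟶ U ◁ T(C)`. -/
def toCofree : T ⟶ forgetDual k H C ⊙ᵣ fiber T :=
  LLax.mkHom
    { app m := ModuleCat.ofHom (coactMap T m)
      naturality m n f := by
        apply ModuleCat.hom_ext
        exact LinearMap.ext fun t => coactMap_naturality T f t }
    fun Y m => by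
      apply ModuleCat.hom_ext
      exact TensorProduct.ext' fun y t => (LinearMap.congr_fun
        (LinearMap.rTensor_id (fiber T).V (Y.V ⊗[k] m.V))
          (xi Y m.V (fiber T) (y ⊗ₜ[k] coactMap T m t))).trans (coactMap_mu T Y m y t).symm

end

end Dual

end HopfDual

end

noncomputable section

namespace HopfDual

/-! ### The comodule structure on the fiber -/

namespace Dual

open MonoidalLeftAction MonoidalRightAction Functor.LaxLeftLinear

variable {k : Type u} [Field k] {H : Type u} [Ring H] [Bialgebra k H]
  {C : Type u} [AddCommGroup C] [Module k C]
  [Coalgebra k C] [Module H C] [IsScalarTower k H C] [IsModuleCoalgebra k H C]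

lemma xi_trivComod (V W : Type u) [AddCommGroup V] [Module k V] [AddCommGroup W] [Module k W]
    (X : HMod k H) (v : V) (s : W ⊗[k] X.V) :
    xi (trivComod k H V) W X (v ⊗ₜ[k] s) = (TensorProduct.assoc k V W X.V).symm (v ⊗ₜ[k] s) := by
  refine LinearMap.congr_fun
    (f := (xi (trivComod k H V) W X : V ⊗[k] (W ⊗[k] X.V) →ₗ[k] (V ⊗[k] W) ⊗[k] X.V))
    (g := (TensorProduct.assoc k V W X.V).symm.toLinearMap)
    (TensorProduct.ext (LinearMap.ext fun v => TensorProduct.ext' fun w x => ?_)) (v ⊗ₜ[k] s)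
  refine (xi_tmul (trivComod k H V) W X v w x).trans ?_
  change xiAux X w x (v ⊗ₜ[k] (1 : H)) = (v ⊗ₜ[k] w) ⊗ₜ[k] x
  rw [xiAux_tmul, map_one]
  rfl

section

variable (T : Dual k H (RComod k C))

/-- The coaction on `T(C)`. -/
def fiberCoact : T.functor.obj (regComod k C) →ₗ[k] C ⊗[k] T.functor.obj (regComod k C) :=
  coactMap T (regComod k C)

lemma coactMap_trivComod (V : Type u) [AddCommGroup V] [Module k V]
    (x : V ⊗[k] T.functor.obj (regComod k C)) :
    coactMap T (tensorComod (trivComod k H V) (regComod k C))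
        (mu T (trivComod k H V) (regComod k C) x) =
      (TensorProduct.assoc k V C _).symm ((fiberCoact T).lTensor V x) := by
  refine LinearMap.congr_fun
    (f := (coactMap T (tensorComod (trivComod k H V) (regComod k C)) ∘ₗ
      mu T (trivComod k H V) (regComod k C) :
        V ⊗[k] T.functor.obj (regComod k C) →ₗ[k] (V ⊗[k] C) ⊗[k] T.functor.obj (regComod k C)))
    (g := (TensorProduct.assoc k V C _).symm.toLinearMap ∘ₗ (fiberCoact T).lTensor V)
    (TensorProduct.ext' fun v t => ?_) x
  refine (coactMap_mu T (trivComod k H V) (regComod k C) v t).trans ?_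
  exact xi_trivComod V C (fiber T) v (fiberCoact T t)

end

end Dual

section Fork

variable {k : Type u} [Field k] (H : Type u) [Ring H] [Bialgebra k H]
  {C : Type u} [AddCommGroup C] [Module k C]
  [Coalgebra k C] [Module H C] [IsScalarTower k H C] [IsModuleCoalgebra k H C]

/-- The coaction of `m` induces a map between cofree comodules. -/
def cofreeMap (m : RComod k C) :
    tensorComod (trivComod k H m.V) (regComod k C) ⟶
      tensorComod (trivComod k H (m.V ⊗[k] C)) (regComod k C) :=
  tensorComodMap (trivMap k H m.coact) (𝟙 (regComod k C))

/-- The coaction of the cofree comodule on `m`. -/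
def cofreeCoactHom (V : Type u) [AddCommGroup V] [Module k V] :
    tensorComod (trivComod k H V) (regComod k C) ⟶
      tensorComod (trivComod k H (V ⊗[k] C)) (regComod k C) :=
  coactHom k H (tensorComod (trivComod k H V) (regComod k C))

lemma coactHom_fork (m : RComod k C) :
    coactHom k H m ≫ cofreeMap H m = coactHom k H m ≫ cofreeCoactHom H m.V := by
  apply RComod.hom_ext
  refine LinearMap.ext fun x => ?_
  exact (RComod.lin_comm (coactHom k H m) x).symm

/-- The linear map `v ⊗ c ↦ ε(c) v`. -/
def counitMap (k : Type u) [Field k] (V C : Type u) [AddCommGroup V] [Module k V]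
    [AddCommGroup C] [Module k C] [Coalgebra k C] : V ⊗[k] C →ₗ[k] V :=
  (TensorProduct.rid k V).toLinearMap ∘ₗ (Coalgebra.counit (R := k) (A := C)).lTensor V

/-- A comodule is the equalizer of two maps between cofree comodules. -/
def coactHomIsLimit (m : RComod k C) :
    IsLimit (Fork.ofι (coactHom k H m) (coactHom_fork H m)) := by
  have h : ∀ s : m.V ⊗[k] C, (TensorProduct.rid k (m.V ⊗[k] C))
      ((Coalgebra.counit (R := k) (A := C)).lTensor (m.V ⊗[k] C)
        ((TensorProduct.assoc k m.V C C).symm ((Coalgebra.comul (R := k)).lTensor m.V s))) = s :=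
    fun s => LinearMap.congr_fun
      (f := counitMap k (m.V ⊗[k] C) C ∘ₗ (TensorProduct.assoc k m.V C C).symm.toLinearMap ∘ₗ
        (Coalgebra.comul (R := k) (A := C)).lTensor m.V) (g := LinearMap.id)
      (TensorProduct.ext' fun v c => by
        refine Eq.trans ?_ (congrArg (v ⊗ₜ[k] ·) (LinearMap.congr_fun (regComod k C).counit c))
        refine LinearMap.congr_fun
          (f := counitMap k (m.V ⊗[k] C) C ∘ₗ (TensorProduct.assoc k m.V C C).symm.toLinearMap ∘ₗ
            TensorProduct.mk k m.V (C ⊗[k] C) v)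
          (g := TensorProduct.mk k m.V C v ∘ₗ counitMap k C C)
          (TensorProduct.ext' fun a b => ?_) (Coalgebra.comul (R := k) c)
        exact (TensorProduct.tmul_smul (Coalgebra.counit (R := k) b) v a).symm) s
  have h' : ∀ s : m.V ⊗[k] C, counitMap k (m.V ⊗[k] C) C
      ((tensorComod (trivComod k H m.V) (regComod k C)).coact s) = s := fun s =>
    (congrArg (counitMap k (m.V ⊗[k] C) C) (trivComod_coact (C := C) k H m.V s)).trans (h s)
  let e : IsSplitEqualizer ((RComod.forget k C).map (cofreeMap H m))
      ((RComod.forget k C).map (cofreeCoactHom H m.V))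
      ((RComod.forget k C).map (coactHom k H m)) :=
    { leftRetraction := ModuleCat.ofHom (counitMap k m.V C)
      rightRetraction := ModuleCat.ofHom (counitMap k (m.V ⊗[k] C) C)
      condition := by rw [← Functor.map_comp, coactHom_fork, Functor.map_comp]
      ι_leftRetraction := by
        apply ModuleCat.hom_ext
        exact m.counit
      bottom_rightRetraction := by
        apply ModuleCat.hom_ext
        exact LinearMap.ext h'
      top_rightRetraction := by
        apply ModuleCat.hom_ext
        refine TensorProduct.ext' fun v c => ?_
        change counitMap k (m.V ⊗[k] C) C (m.coact v ⊗ₜ[k] c) =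
          m.coact (counitMap k m.V C (v ⊗ₜ[k] c))
        exact (m.coact.map_smul (Coalgebra.counit (R := k) (A := C) c) v).symm }
  exact isLimitOfReflects (RComod.forget k C)
    ((isLimitMapConeForkEquiv (RComod.forget k C) (coactHom_fork H m)).symm e.isEqualizer)

lemma exists_of_isLimit_fork {V W W' : ModuleCat.{u} k} {f g : W ⟶ W'} {ι : V ⟶ W}
    {w : ι ≫ f = ι ≫ g} (h : IsLimit (Fork.ofι ι w)) (y : W) (hy : f.hom y = g.hom y) :
    ∃ x, ι.hom x = y := by
  have e : ModuleCat.ofHom (LinearMap.toSpanSingleton k W y) ≫ f =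
      ModuleCat.ofHom (LinearMap.toSpanSingleton k W y) ≫ g := by
    apply ModuleCat.hom_ext
    ext
    change f.hom ((1 : k) • y) = g.hom ((1 : k) • y)
    rw [one_smul, hy]
  refine ⟨(Fork.IsLimit.lift h _ e).hom (1 : k), ?_⟩
  refine (LinearMap.congr_fun (congrArg ModuleCat.Hom.hom (Fork.IsLimit.lift_ι' h _ e))
    (1 : k)).trans ?_
  exact one_smul k y

end Fork

namespace Dual

variable {k : Type u} [Field k] {H : Type u} [Ring H] [Bialgebra k H]
  {C : Type u} [AddCommGroup C] [Module k C]
  [Coalgebra k C] [Module H C] [IsScalarTower k H C] [IsModuleCoalgebra k H C]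

section

variable (T : Dual k H (RComod k C))

lemma exists_coactMap_eq_iff {m : RComod k C} {x : m.V ⊗[k] T.functor.obj (regComod k C)} :
    (∃ t, coactMap T m t = x) ↔ m.coact.rTensor _ x =
      (TensorProduct.assoc k m.V C _).symm ((fiberCoact T).lTensor m.V x) := by
  have h₁ : tmap T (cofreeMap H m) (mu T (trivComod k H m.V) (regComod k C) x) =
      mu T (trivComod k H (m.V ⊗[k] C)) (regComod k C) (m.coact.rTensor _ x) :=
    (mu_left T (trivMap k H m.coact) (regComod k C) x).symm
  have h₂ : tmap T (cofreeCoactHom H m.V) (mu T (trivComod k H m.V) (regComod k C) x) =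
      mu T (trivComod k H (m.V ⊗[k] C)) (regComod k C)
        ((TensorProduct.assoc k m.V C _).symm ((fiberCoact T).lTensor m.V x)) :=
    (coactMap_eq_iff T).1 (coactMap_trivComod T m.V x)
  have h₃ : m.coact.rTensor _ x =
      (TensorProduct.assoc k m.V C _).symm ((fiberCoact T).lTensor m.V x) ↔
      tmap T (cofreeMap H m) (mu T (trivComod k H m.V) (regComod k C) x) =
      tmap T (cofreeCoactHom H m.V) (mu T (trivComod k H m.V) (regComod k C) x) := by
    rw [h₁, h₂]
    exact (mu_trivComod_bijective T (m.V ⊗[k] C) (regComod k C)).1.eq_iff.symm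
  rw [h₃]
  constructor
  · rintro ⟨t, rfl⟩
    rw [mu_coactMap]
    exact tmap_comp_eq T (coactHom_fork H m) t
  · intro h
    have := T.typeL.leftExact
    obtain ⟨t, ht⟩ := exists_of_isLimit_fork
      (isLimitForkMapOfIsLimit T.functor (coactHom_fork H m) (coactHomIsLimit H m)) _ h
    exact ⟨t, (coactMap_eq_iff T).2 ht⟩

lemma coactMap_fork {m : RComod k C} (t : T.functor.obj m) :
    m.coact.rTensor _ (coactMap T m t) =
      (TensorProduct.assoc k m.V C _).symm ((fiberCoact T).lTensor m.V (coactMap T m t)) :=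
  (exists_coactMap_eq_iff T).1 ⟨t, rfl⟩

lemma fiberCoact_counit (t : T.functor.obj (regComod k C)) :
    TensorProduct.lid k _ ((Coalgebra.counit (R := k) (A := C)).rTensor _ (fiberCoact T t)) =
      t := by
  let ε : trivComod k H C ⟶ unitComod k H :=
    RComod.mkHom (X := trivComod k H C) (Y := unitComod k H) (Coalgebra.counit (R := k) (A := C))
      fun _ => rfl
  have e : coactHom k H (regComod k C) ≫ tensorComodMap ε (𝟙 (regComod k C)) ≫
      (tensorComodUnit (regComod k C)).hom = 𝟙 _ := by
    apply RComod.hom_ext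
    refine LinearMap.ext fun (c : C) => ?_
    change TensorProduct.lid k C ((Coalgebra.counit (R := k) (A := C)).rTensor C
      (Coalgebra.comul (R := k) c)) = c
    rw [Coalgebra.rTensor_counit_comul]
    simp
  have h := congrArg (fun f => tmap T f t) e
  have h' : tmap T (coactHom k H (regComod k C)) t =
    mu T (trivComod k H C) (regComod k C) (fiberCoact T t) := (mu_coactMap T _ t).symm
  rw [tmap_comp, tmap_comp, h', tmap_id] at h
  refine Eq.trans ?_ h
  refine LinearMap.congr_fun
    (f := (TensorProduct.lid k _).toLinearMap ∘ₗ (Coalgebra.counit (R := k) (A := C)).rTensor _)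
    (g := tmap T (tensorComodUnit (regComod k C)).hom ∘ₗ tmap T (tensorComodMap ε (𝟙 _)) ∘ₗ
      (mu T (trivComod k H C) (regComod k C) :
        C ⊗[k] T.functor.obj (regComod k C) →ₗ[k] _)) (TensorProduct.ext' fun c t => ?_) _
  refine (mu_unit T (regComod k C) (Coalgebra.counit (R := k) c) t).symm.trans ?_
  exact congrArg _ (mu_left T ε (regComod k C) (c ⊗ₜ[k] t))

lemma fiberCoact_act (h : H) (t : T.functor.obj (regComod k C)) :
    fiberCoact T ((fiber T).act h t) =
      tensorAct (Algebra.lsmul k k C) (fiber T).act h (fiberCoact T t) := by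
  refine (coactMap_naturality T (actHom k H C) _).trans ?_
  refine (congrArg _ (coactMap_mu T (regComod k H) (regComod k C) h t)).trans ?_
  refine LinearMap.congr_fun
    (f := (actMap k H C).rTensor (fiber T).V ∘ₗ (xi (regComod k H) C (fiber T) :
      H ⊗[k] (C ⊗[k] (fiber T).V) →ₗ[k] (H ⊗[k] C) ⊗[k] (fiber T).V) ∘ₗ
      TensorProduct.mk k H (C ⊗[k] (fiber T).V) h)
    (g := (tensorAct (Algebra.lsmul k k C) (fiber T).act h :
      C ⊗[k] (fiber T).V →ₗ[k] C ⊗[k] (fiber T).V))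
    (TensorProduct.ext' fun c x => ?_) (fiberCoact T t)
  refine (congrArg _ (xi_tmul (regComod k H) C (fiber T) h c x)).trans ?_
  refine Eq.trans ?_ (tensorAct_tmul (Algebra.lsmul k k C) (fiber T).act h c x).symm
  exact LinearMap.congr_fun
    (f := (actMap k H C).rTensor (fiber T).V ∘ₗ xiAux (Y := H) (V := C) (fiber T) c x)
    (g := TensorProduct.map (orb (Algebra.lsmul k k C) c) (orb (fiber T).act x))
    (TensorProduct.ext' fun a b => rfl) (Coalgebra.comul (R := k) h)

/-- The object `T(C)` of `^C_H𝔐` of an object `T` of the dual of `𝔐^C`. -/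
def fiberComod : LHComod k H C where
  toHMod := fiber T
  coact := fiberCoact T
  coassoc := by
    refine LinearMap.ext fun t => ?_
    exact (LinearEquiv.eq_symm_apply _).1 (coactMap_fork T (m := regComod k C) t)
  counit := LinearMap.ext (fiberCoact_counit T)
  coact_act := fiberCoact_act T

end

section

variable {S T : Dual k H (RComod k C)}

/-- The components of a morphism of the dual as linear maps. -/
def app (α : S ⟶ T) (m : RComod k C) : S.functor.obj m →ₗ[k] T.functor.obj m :=
  ((LLax.nat α).app m).hom

lemma app_tmap (α : S ⟶ T) {m n : RComod k C} (f : m ⟶ n) (s : S.functor.obj m) :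
    app α n (tmap S f s) = tmap T f (app α m s) :=
  LinearMap.congr_fun (congrArg ModuleCat.Hom.hom ((LLax.nat α).naturality f)) s

lemma app_mu (α : S ⟶ T) (Y : RComod k H) (m : RComod k C) (x : Y.V ⊗[k] S.functor.obj m) :
    app α (tensorComod Y m) (mu S Y m x) = mu T Y m ((app α m).lTensor Y.V x) :=
  (LinearMap.congr_fun (congrArg ModuleCat.Hom.hom (LLax.nat_comm α Y m)) x).symm

lemma coactMap_app (α : S ⟶ T) (m : RComod k C) (s : S.functor.obj m) :
    coactMap T m (app α m s) = (app α (regComod k C)).lTensor m.V (coactMap S m s) := by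
  refine (coactMap_eq_iff T).2 ?_
  rw [← app_tmap, ← mu_coactMap]
  exact app_mu α (trivComod k H m.V) (regComod k C) (coactMap S m s)

/-- The morphism `S(C) ⟶ T(C)` of `^C_H𝔐` induced by a morphism of the dual of `𝔐^C`. -/
def fiberMap (α : S ⟶ T) : fiberComod S ⟶ fiberComod T :=
  LHComod.mkHom (X := fiberComod S) (Y := fiberComod T) (app α (regComod k C))
    (fun h s => (app_tmap α (actHom k H C) _).trans
      (congrArg _ (app_mu α (regComod k H) (regComod k C) (h ⊗ₜ[k] s))))
    fun s => coactMap_app α (regComod k C) s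

end

variable (k H C) in
/-- The functor `T ↦ T(C)` from the dual of `𝔐^C` to `^C_H𝔐`. -/
def fiberFunctor : Dual k H (RComod k C) ⥤ LHComod k H C where
  obj T := fiberComod T
  map α := fiberMap α

instance : (fiberFunctor k H C).Faithful where
  map_injective {S T α β} h := LLax.hom_ext fun m => by
    have h' : app α (regComod k C) = app β (regComod k C) := congrArg LHComod.lin h
    apply ModuleCat.hom_ext
    refine LinearMap.ext fun s => coactMap_injective T m ?_
    change coactMap T m (app α m s) = coactMap T m (app β m s)
    rw [coactMap_app, coactMap_app, h']

end Dual


end HopfDual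

end

noncomputable section

namespace HopfDual

/-! ### The fork of an object of the dual -/

/-- A fork of vector spaces which is exact on elements is a limit. -/
def forkIsLimit {k : Type u} [Field k] {V W W' : ModuleCat.{u} k} {f g : W ⟶ W'} {ι : V ⟶ W}
    (w : ι ≫ f = ι ≫ g) (hι : Function.Injective ι.hom)
    (h : ∀ y, f.hom y = g.hom y → ∃ x, ι.hom x = y) : IsLimit (Fork.ofι ι w) :=
  have := (ModuleCat.mono_iff_injective ι).2 hι
  Fork.IsLimit.mk' _ fun s => by
    have hs : ∀ z, s.ι.hom z ∈ LinearMap.range ι.hom := fun z =>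
      h _ (LinearMap.congr_fun (congrArg ModuleCat.Hom.hom s.condition) z)
    have e : ModuleCat.ofHom ((LinearEquiv.ofInjective ι.hom hι).symm.toLinearMap ∘ₗ
        s.ι.hom.codRestrict _ hs) ≫ ι = s.ι := by
      apply ModuleCat.hom_ext
      refine LinearMap.ext fun z => ?_
      exact congrArg Subtype.val ((LinearEquiv.ofInjective ι.hom hι).apply_symm_apply
        ⟨s.ι.hom z, hs z⟩)
    exact ⟨_, e, fun {m} hm => (cancel_mono ι).1 (hm.trans e.symm)⟩

/-- The coaction of an object of `^C_H𝔐` as a morphism of `H`-modules. -/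
def LHComod.coactHom {k : Type u} [Field k] {H : Type u} [Ring H] [Bialgebra k H]
    {C : Type u} [AddCommGroup C] [Module k C] [Coalgebra k C] [Module H C] [IsScalarTower k H C]
    (N : LHComod k H C) : N.toHMod ⟶ coalgMod k H C ⊗ N.toHMod :=
  HMod.mkHom (X := N.toHMod) (Y := coalgMod k H C ⊗ N.toHMod) N.coact N.coact_act

/-- The `H`-linear map underlying a morphism of `^C_H𝔐`. -/
def LHComod.hmodHom {k : Type u} [Field k] {H : Type u} [Ring H] [Bialgebra k H]
    {C : Type u} [AddCommGroup C] [Module k C] [Coalgebra k C] [Module H C] [IsScalarTower k H C]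
    {N N' : LHComod k H C} (f : N ⟶ N') :
    N.toHMod ⟶ N'.toHMod :=
  HMod.mkHom (LHComod.lin f) (LHComod.lin_act f)

/-- The linear map `c ⊗ n ↦ ε(c) n`. -/
def counitLeft (k : Type u) [Field k] (C V : Type u) [AddCommGroup V] [Module k V]
    [AddCommGroup C] [Module k C] [Coalgebra k C] : C ⊗[k] V →ₗ[k] V :=
  (TensorProduct.lid k V).toLinearMap ∘ₗ (Coalgebra.counit (R := k) (A := C)).rTensor V

lemma LHComod.counitLeft_coact {k : Type u} [Field k] {H : Type u} [Ring H] [Bialgebra k H]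
    {C : Type u} [AddCommGroup C] [Module k C] [Coalgebra k C] [Module H C] [IsScalarTower k H C]
    (N : LHComod k H C) (n : N.V) : counitLeft k C N.V (N.coact n) = n :=
  LinearMap.congr_fun N.counit n

lemma LHComod.coact_injective {k : Type u} [Field k] {H : Type u} [Ring H] [Bialgebra k H]
    {C : Type u} [AddCommGroup C] [Module k C] [Coalgebra k C] [Module H C] [IsScalarTower k H C]
    (N : LHComod k H C) : Function.Injective N.coact := fun n n' h => by
  rw [← LHComod.counitLeft_coact N n, h, LHComod.counitLeft_coact]

namespace Dual

open MonoidalLeftAction MonoidalRightAction Functor.LaxLeftLinear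

variable {k : Type u} [Field k] {H : Type u} [Ring H] [Bialgebra k H]
  {C : Type u} [AddCommGroup C] [Module k C]
  [Coalgebra k C] [Module H C] [IsScalarTower k H C] [IsModuleCoalgebra k H C]

variable (C) in
/-- The morphism `U ◁ X ⟶ (U ◁ C) ◁ X` given by the coactions of comodules. -/
def cofreeLeft (X : HMod k H) :
    forgetDual k H C ⊙ᵣ X ⟶ (forgetDual k H C ⊙ᵣ coalgMod k H C) ⊙ᵣ X :=
  forgetCoact k H C ⊵ᵣ X

/-- The morphism `U ◁ N ⟶ (U ◁ C) ◁ N` given by the coaction of `N`. -/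
def cofreeRight (N : LHComod k H C) :
    forgetDual k H C ⊙ᵣ N.toHMod ⟶ (forgetDual k H C ⊙ᵣ coalgMod k H C) ⊙ᵣ N.toHMod :=
  forgetDual k H C ⊴ᵣ N.coactHom ≫ (αᵣ (forgetDual k H C) (coalgMod k H C) N.toHMod).hom

/-- The morphism `T ⟶ U ◁ T(C)`. -/
def toFiber (T : Dual k H (RComod k C)) : T ⟶ forgetDual k H C ⊙ᵣ (fiberComod T).toHMod :=
  toCofree T

lemma toFiber_fork (T : Dual k H (RComod k C)) :
    toFiber T ≫ cofreeLeft C (fiberComod T).toHMod = toFiber T ≫ cofreeRight (fiberComod T) :=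
  LLax.hom_ext fun m => by
    apply ModuleCat.hom_ext
    exact LinearMap.ext fun t => coactMap_fork T t

/-- An object `T` of the dual of `𝔐^C` is an equalizer of `U ◁ T(C) ⇉ (U ◁ C) ◁ T(C)`. -/
def toFiberIsLimit (T : Dual k H (RComod k C)) :
    IsLimit (Fork.ofι (f := cofreeLeft C (fiberComod T).toHMod) (g := cofreeRight (fiberComod T))
      (toFiber T) (toFiber_fork T)) :=
  isLimitOfEval _ fun m => (isLimitMapConeForkEquiv (eval m) (toFiber_fork T)).symm
    (forkIsLimit _ (coactMap_injective T m) fun _ hy => (exists_coactMap_eq_iff T).2 hy)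

instance (T : Dual k H (RComod k C)) : Mono (toFiber T) :=
  mono_of_isLimit_fork (toFiberIsLimit T)

lemma toFiber_naturality {S T : Dual k H (RComod k C)} (α : S ⟶ T) :
    α ≫ toFiber T = toFiber S ≫
      forgetDual k H C ⊴ᵣ LHComod.hmodHom (fiberMap α) :=
  LLax.hom_ext fun m => by
    apply ModuleCat.hom_ext
    exact LinearMap.ext fun s => coactMap_app α m s

/-! ### The module structure on the fiber functor -/

section

variable (T : Dual k H (RComod k C)) (X : HMod k H)

lemma mu_act (Y : RComod k H) (m : RComod k C) (y : Y.V) (s : T.functor.obj m ⊗[k] X.V) :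
    mu (T ⊙ᵣ X) Y m (y ⊗ₜ[k] s) = (mu T Y m).rTensor X.V (xi Y (T.functor.obj m) X (y ⊗ₜ[k] s)) :=
  rfl

lemma fiber_act_act (h : H) (s : T.functor.obj (regComod k C) ⊗[k] X.V) :
    (fiber (T ⊙ᵣ X)).act h s = tensorAct (fiber T).act X.act h s := by
  refine LinearMap.congr_fun
    (f := ((fiber (T ⊙ᵣ X)).act h : (fiber T).V ⊗[k] X.V →ₗ[k] (fiber T).V ⊗[k] X.V))
    (g := tensorAct (fiber T).act X.act h) (TensorProduct.ext' fun t x => ?_) s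
  refine Eq.trans ?_ (tensorAct_tmul (fiber T).act X.act h t x).symm
  change (tmap T (actHom k H C)).rTensor X.V ((mu T (regComod k H) (regComod k C)).rTensor X.V
    (xi (regComod k H) (T.functor.obj (regComod k C)) X (h ⊗ₜ[k] (t ⊗ₜ[k] x)))) = _
  refine (congrArg (fun w => (tmap T (actHom k H C)).rTensor X.V
    ((mu T (regComod k H) (regComod k C)).rTensor X.V w))
    (xi_tmul (regComod k H) (T.functor.obj (regComod k C)) X h t x)).trans ?_
  exact LinearMap.congr_fun
    (f := (tmap T (actHom k H C)).rTensor X.V ∘ₗ (mu T (regComod k H) (regComod k C)).rTensor X.V ∘ₗ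
      xiAux (Y := H) (V := T.functor.obj (regComod k C)) X t x)
    (g := TensorProduct.map (orb (fiber T).act t) (orb X.act x))
    (TensorProduct.ext' fun a b => rfl) (Coalgebra.comul (R := k) h)

lemma coactMap_act (m : RComod k C) (s : T.functor.obj m ⊗[k] X.V) :
    coactMap (T ⊙ᵣ X) m s =
      TensorProduct.assoc k m.V (T.functor.obj (regComod k C)) X.V
        ((coactMap T m).rTensor X.V s) := by
  refine LinearMap.congr_fun
    (f := (coactMap (T ⊙ᵣ X) m : T.functor.obj m ⊗[k] X.V →ₗ[k]
      m.V ⊗[k] (T.functor.obj (regComod k C) ⊗[k] X.V)))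
    (g := (TensorProduct.assoc k m.V (T.functor.obj (regComod k C)) X.V).toLinearMap ∘ₗ
      (coactMap T m).rTensor X.V) (TensorProduct.ext' fun t x => ?_) s
  refine (coactMap_eq_iff (T ⊙ᵣ X)).2 ?_
  change tmap T (coactHom k H m) t ⊗ₜ[k] x = _
  rw [← mu_coactMap]
  refine LinearMap.congr_fun
    (f := (TensorProduct.mk k (T.functor.obj (tensorComod (trivComod k H m.V) (regComod k C)))
      X.V).flip x ∘ₗ (mu T (trivComod k H m.V) (regComod k C) :
        m.V ⊗[k] T.functor.obj (regComod k C) →ₗ[k]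
          T.functor.obj (tensorComod (trivComod k H m.V) (regComod k C))))
    (g := (mu (T ⊙ᵣ X) (trivComod k H m.V) (regComod k C) :
      m.V ⊗[k] (T.functor.obj (regComod k C) ⊗[k] X.V) →ₗ[k]
        T.functor.obj (tensorComod (trivComod k H m.V) (regComod k C)) ⊗[k] X.V) ∘ₗ
      (TensorProduct.assoc k m.V (T.functor.obj (regComod k C)) X.V).toLinearMap ∘ₗ
      (TensorProduct.mk k (m.V ⊗[k] T.functor.obj (regComod k C)) X.V).flip x) (TensorProduct.ext' fun v t => ?_) _
  refine Eq.symm ((mu_act T X (trivComod k H m.V) (regComod k C) v (t ⊗ₜ[k] x)).trans ?_)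
  exact congrArg ((mu T (trivComod k H m.V) (regComod k C)).rTensor X.V)
    (xi_trivComod m.V (T.functor.obj (regComod k C)) X v (t ⊗ₜ[k] x))

lemma fiberCoact_tensor (s : T.functor.obj (regComod k C) ⊗[k] X.V) :
    fiberCoact (T ⊙ᵣ X) s = TensorProduct.assoc k C (T.functor.obj (regComod k C)) X.V
      ((fiberCoact T).rTensor X.V s) :=
  coactMap_act T X (regComod k C) s

/-- The isomorphism `T(C) ⊗ X ≅ (T ◁ X)(C)`, which is the identity of vector spaces. -/
def fiberActIso : fiberComod T ⊙ᵣ X ≅ fiberComod (T ⊙ᵣ X) :=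
  LHComod.mkIso (X := fiberComod T ⊙ᵣ X) (Y := fiberComod (T ⊙ᵣ X))
    (LinearEquiv.refl k (T.functor.obj (regComod k C) ⊗[k] X.V))
    (fun h s => (fiber_act_act T X h s).symm)
    fun s => (fiberCoact_tensor T X s).trans (LinearMap.congr_fun
      (LinearMap.lTensor_id C ((fiber T).V ⊗[k] X.V)) (TensorProduct.assoc k C (fiber T).V X.V
        ((fiberCoact T).rTensor X.V s))).symm

end

variable (k H C) in
/-- The functor `T ↦ T(C)` as a strong module functor. -/
def fiberStrong : RStrong k (HMod k H) (Dual k H (RComod k C)) (LHComod k H C) where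
  functor := fiberFunctor k H C
  lax :=
    { μᵣ T X := (fiberActIso T X).hom
      μᵣ_naturality_right T _ _ f := by
        apply LHComod.hom_ext
        exact TensorProduct.ext' fun t x => rfl
      μᵣ_naturality_left f X := by
        apply LHComod.hom_ext
        exact TensorProduct.ext' fun t x => rfl
      μᵣ_associativity T X Y := by
        apply LHComod.hom_ext
        exact TensorProduct.ext (LinearMap.ext fun t => TensorProduct.ext' fun x y => rfl)
      μᵣ_unitality T := by
        apply LHComod.hom_ext
        exact TensorProduct.ext' fun t x => rfl }
  linear :=
    { additive := ⟨rfl⟩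
      linear := ⟨fun _ _ => rfl⟩ }
  strong T X := (fiberActIso T X).isIso_hom

/-! ### The fiber functor is an equivalence -/

lemma map_cofreeLeft {X X' : HMod k H} (f : X ⟶ X') :
    forgetDual k H C ⊴ᵣ f ≫ cofreeLeft C X' =
      cofreeLeft C X ≫ (forgetDual k H C ⊙ᵣ coalgMod k H C) ⊴ᵣ f := by
  ext m : 1
  apply ModuleCat.hom_ext
  exact TensorProduct.ext' fun t x => rfl

lemma map_cofreeRight {N N' : LHComod k H C} (f : N ⟶ N') :
    forgetDual k H C ⊴ᵣ LHComod.hmodHom f ≫ cofreeRight N' =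
      cofreeRight N ≫ (forgetDual k H C ⊙ᵣ coalgMod k H C) ⊴ᵣ LHComod.hmodHom f := by
  ext m : 1
  apply ModuleCat.hom_ext
  refine TensorProduct.ext' fun t x => ?_
  change (TensorProduct.assoc k m.V C N'.V).symm (t ⊗ₜ[k] N'.coact (LHComod.lin f x)) =
    (LHComod.lin f).lTensor (m.V ⊗[k] C) ((TensorProduct.assoc k m.V C N.V).symm
      (t ⊗ₜ[k] N.coact x))
  rw [LHComod.lin_coact]
  exact LinearMap.congr_fun
    (f := (TensorProduct.assoc k m.V C N'.V).symm.toLinearMap ∘ₗ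
      TensorProduct.mk k m.V (C ⊗[k] N'.V) t ∘ₗ (LHComod.lin f).lTensor C)
    (g := (LHComod.lin f).lTensor (m.V ⊗[k] C) ∘ₗ
      (TensorProduct.assoc k m.V C N.V).symm.toLinearMap ∘ₗ TensorProduct.mk k m.V (C ⊗[k] N.V) t)
    (TensorProduct.ext' fun a b => rfl) (N.coact x)

lemma toFiber_condition {S T : Dual k H (RComod k C)} (f : fiberComod S ⟶ fiberComod T) :
    (toFiber S ≫ forgetDual k H C ⊴ᵣ LHComod.hmodHom f) ≫ cofreeLeft C (fiberComod T).toHMod =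
      (toFiber S ≫ forgetDual k H C ⊴ᵣ LHComod.hmodHom f) ≫ cofreeRight (fiberComod T) := by
  rw [Category.assoc, Category.assoc]
  rw [map_cofreeLeft, map_cofreeRight, ← Category.assoc, ← Category.assoc, toFiber_fork]

/-- The morphism of the dual of `𝔐^C` induced by a morphism between the fibers. -/
def ofFiberMap {S T : Dual k H (RComod k C)} (f : fiberComod S ⟶ fiberComod T) : S ⟶ T :=
  Fork.IsLimit.lift (toFiberIsLimit T) _ (toFiber_condition f)

lemma ofFiberMap_toFiber {S T : Dual k H (RComod k C)} (f : fiberComod S ⟶ fiberComod T) :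
    ofFiberMap f ≫ toFiber T = toFiber S ≫ forgetDual k H C ⊴ᵣ LHComod.hmodHom f :=
  Fork.IsLimit.lift_ι' (toFiberIsLimit T) _ (toFiber_condition f)

instance : (fiberFunctor k H C).Full where
  map_surjective {S T} f := ⟨ofFiberMap f, by
    apply LHComod.hom_ext
    refine LinearMap.ext fun s => coactMap_injective T (regComod k C) ?_
    have h := congrArg (fun α => app α (regComod k C) s) (ofFiberMap_toFiber f)
    refine Eq.trans h ?_
    exact (LHComod.lin_coact f s).symm⟩

lemma coactMap_forgetDual (m : RComod k C) (x : m.V) :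
    coactMap (forgetDual k H C) m x = m.coact x :=
  (coactMap_eq_iff (forgetDual k H C)).2 rfl

section

variable (N : LHComod k H C)

/-- The equalizer of `U ◁ N ⇉ (U ◁ C) ◁ N`. -/
def cotensor : Dual k H (RComod k C) :=
  equalizer (cofreeLeft C N.toHMod) (cofreeRight N)

/-- The inclusion of the equalizer of `U ◁ N ⇉ (U ◁ C) ◁ N`. -/
def cotensorι : cotensor N ⟶ forgetDual k H C ⊙ᵣ N.toHMod :=
  equalizer.ι (cofreeLeft C N.toHMod) (cofreeRight N)

/-- The inclusion of the cotensor product. -/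
def cotensorIncl (m : RComod k C) : (cotensor N).functor.obj m →ₗ[k] m.V ⊗[k] N.V :=
  app (cotensorι N) m

lemma cotensorι_condition :
    cotensorι N ≫ cofreeLeft C N.toHMod = cotensorι N ≫ cofreeRight N :=
  equalizer.condition _ _

/-- The cotensor product is an equalizer of vector spaces. -/
def cotensorIsLimit (m : RComod k C) :=
  isLimitForkMapOfIsLimit (eval m) (cotensorι_condition N)
    (equalizerIsEqualizer (cofreeLeft C N.toHMod) (cofreeRight N))

lemma cotensorIncl_injective (m : RComod k C) : Function.Injective (cotensorIncl N m) :=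
  (ModuleCat.mono_iff_injective _).1 (mono_of_isLimit_fork (cotensorIsLimit N m))

lemma cotensorIncl_condition (m : RComod k C) (t : (cotensor N).functor.obj m) :
    m.coact.rTensor N.V (cotensorIncl N m t) =
      (TensorProduct.assoc k m.V C N.V).symm (N.coact.lTensor m.V (cotensorIncl N m t)) :=
  congrArg (fun α => app α m t) (cotensorι_condition N)

lemma exists_cotensorIncl (m : RComod k C) (x : m.V ⊗[k] N.V) (hx : m.coact.rTensor N.V x =
      (TensorProduct.assoc k m.V C N.V).symm (N.coact.lTensor m.V x)) :
    ∃ t, cotensorIncl N m t = x :=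
  exists_of_isLimit_fork (cotensorIsLimit N m) x hx

lemma counitLeft_comul (V : Type u) [AddCommGroup V] [Module k V] (x : C ⊗[k] V) :
    (counitLeft k C V).lTensor C (TensorProduct.assoc k C C V
      ((Coalgebra.comul (R := k) (A := C)).rTensor V x)) = x := by
  refine LinearMap.congr_fun
    (f := (counitLeft k C V).lTensor C ∘ₗ (TensorProduct.assoc k C C V).toLinearMap ∘ₗ
      (Coalgebra.comul (R := k) (A := C)).rTensor V) (g := LinearMap.id)
    (TensorProduct.ext' fun c v => ?_) x
  refine Eq.trans ?_ (congrArg (· ⊗ₜ[k] v) (LinearMap.congr_fun (regComod k C).counit c))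
  refine LinearMap.congr_fun
    (f := (counitLeft k C V).lTensor C ∘ₗ (TensorProduct.assoc k C C V).toLinearMap ∘ₗ
      (TensorProduct.mk k (C ⊗[k] C) V).flip v)
    (g := (TensorProduct.mk k C V).flip v ∘ₗ counitMap k C C)
    (TensorProduct.ext' fun a b => ?_) (Coalgebra.comul (R := k) c)
  exact (TensorProduct.smul_tmul (Coalgebra.counit (R := k) b) a v).symm

lemma counitLeft_comul' (V : Type u) [AddCommGroup V] [Module k V] (x : C ⊗[k] V) :
    (counitLeft k C C).rTensor V ((Coalgebra.comul (R := k) (A := C)).rTensor V x) = x := by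
  refine LinearMap.congr_fun
    (f := (counitLeft k C C).rTensor V ∘ₗ (Coalgebra.comul (R := k) (A := C)).rTensor V)
    (g := LinearMap.id) (TensorProduct.ext' fun c v => congrArg (· ⊗ₜ[k] v) ?_) x
  change TensorProduct.lid k C ((Coalgebra.counit (R := k) (A := C)).rTensor C
    (Coalgebra.comul (R := k) c)) = c
  rw [Coalgebra.rTensor_counit_comul]
  simp

/-- The inclusion of the cotensor product `C □ N` into `C ⊗ N`. -/
def cotensorFiber : (cotensor N).functor.obj (regComod k C) →ₗ[k] C ⊗[k] N.V :=
  cotensorIncl N (regComod k C)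

lemma cotensorFiber_condition (t : (cotensor N).functor.obj (regComod k C)) :
    (Coalgebra.comul (R := k) (A := C)).rTensor N.V (cotensorFiber N t) =
      (TensorProduct.assoc k C C N.V).symm (N.coact.lTensor C (cotensorFiber N t)) :=
  cotensorIncl_condition N (regComod k C) t

/-- The comparison map from the cotensor product `C □ N` to `N`. -/
def cotensorCounit : (cotensor N).functor.obj (regComod k C) →ₗ[k] N.V :=
  counitLeft k C N.V ∘ₗ cotensorFiber N

lemma coact_cotensorCounit (t : (cotensor N).functor.obj (regComod k C)) :
    N.coact (cotensorCounit N t) = cotensorFiber N t := by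
  refine Eq.trans ?_ (counitLeft_comul' N.V (cotensorFiber N t))
  rw [cotensorFiber_condition]
  refine LinearMap.congr_fun
    (f := N.coact ∘ₗ counitLeft k C N.V)
    (g := (counitLeft k C C).rTensor N.V ∘ₗ (TensorProduct.assoc k C C N.V).symm.toLinearMap ∘ₗ
      N.coact.lTensor C) (TensorProduct.ext' fun c n => ?_) (cotensorFiber N t)
  refine (N.coact.map_smul (Coalgebra.counit (R := k) c) n).trans ?_
  exact LinearMap.congr_fun (f := (Coalgebra.counit (R := k) c) • LinearMap.id)
    (g := (counitLeft k C C).rTensor N.V ∘ₗ (TensorProduct.assoc k C C N.V).symm.toLinearMap ∘ₗ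
      TensorProduct.mk k C (C ⊗[k] N.V) c)
    (TensorProduct.ext' fun a b => TensorProduct.smul_tmul' _ a b) (N.coact n)

lemma cotensorCounit_bijective : Function.Bijective (cotensorCounit N) := by
  refine ⟨fun t t' h => cotensorIncl_injective N (regComod k C) ?_, fun n => ?_⟩
  · change cotensorFiber N t = cotensorFiber N t'
    rw [← coact_cotensorCounit, h, coact_cotensorCounit]
  · obtain ⟨t, ht⟩ := exists_cotensorIncl N (regComod k C) (N.coact n)
      ((LinearEquiv.eq_symm_apply _).2 (LinearMap.congr_fun N.coassoc n))
    exact ⟨t, N.coact_injective ((coact_cotensorCounit N t).trans ht)⟩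

lemma cotensorCounit_act (h : H) (t : (cotensor N).functor.obj (regComod k C)) :
    cotensorCounit N ((fiber (cotensor N)).act h t) = N.act h (cotensorCounit N t) := by
  refine N.coact_injective ((coact_cotensorCounit N _).trans ?_)
  rw [N.coact_act, coact_cotensorCounit]
  refine (LHComod.lin_act (fiberMap (cotensorι N)) h t).trans ?_
  exact fiber_act_act (forgetDual k H C) N.toHMod h (cotensorFiber N t)

lemma cotensorCounit_coact (t : (cotensor N).functor.obj (regComod k C)) :
    N.coact (cotensorCounit N t) =
      (cotensorCounit N).lTensor C (fiberCoact (cotensor N) t) := by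
  rw [coact_cotensorCounit, cotensorCounit, LinearMap.lTensor_comp, LinearMap.comp_apply]
  have h : (cotensorFiber N).lTensor C (fiberCoact (cotensor N) t) =
      TensorProduct.assoc k C C N.V
        ((Coalgebra.comul (R := k) (A := C)).rTensor N.V (cotensorFiber N t)) := by
    refine (coactMap_app (cotensorι N) (regComod k C) t).symm.trans ?_
    refine (coactMap_act (forgetDual k H C) N.toHMod (regComod k C) (cotensorFiber N t)).trans ?_
    have e : coactMap (forgetDual k H C) (regComod k C) = Coalgebra.comul (R := k) (A := C) :=
      LinearMap.ext fun c => coactMap_forgetDual (regComod k C) c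
    exact congrArg (fun f : C →ₗ[k] C ⊗[k] C =>
      TensorProduct.assoc k C C N.V (f.rTensor N.V (cotensorFiber N t))) e
  rw [h, counitLeft_comul]

/-- The isomorphism `C □ N ≅ N`. -/
def fiberCotensorIso : fiberComod (cotensor N) ≅ N :=
  LHComod.mkIso (X := fiberComod (cotensor N)) (Y := N)
    (LinearEquiv.ofBijective (cotensorCounit N) (cotensorCounit_bijective N))
    (cotensorCounit_act N) (cotensorCounit_coact N)

end

instance : (fiberFunctor k H C).EssSurj where
  mem_essImage N := ⟨cotensor N, ⟨fiberCotensorIso N⟩⟩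

instance : (fiberFunctor k H C).IsEquivalence where

end Dual

end HopfDual

end

noncomputable section

namespace HopfDual

/-! ### Equivalences of module categories -/

section RightModEquivalent

open MonoidalRightAction Functor.LaxRightLinear

variable {𝒜 : Type w₁} [Category.{v₁} 𝒜] [MonoidalCategory 𝒜]
  {M : Type w₂} [Category.{v₂} M] [MonoidalRightAction 𝒜 M]
  {N : Type w₃} [Category.{v₃} N] [MonoidalRightAction 𝒜 N]
  {P : Type w₄} [Category.{v₄} P] [MonoidalRightAction 𝒜 P]

namespace LaxRModFun

/-- The underlying natural transformation of a morphism of module functors. -/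
def nat {F G : LaxRModFun 𝒜 M N} (α : F ⟶ G) : F.functor ⟶ G.functor := α.1

/-- The underlying natural isomorphism of an isomorphism of module functors. -/
def natIso {F G : LaxRModFun 𝒜 M N} (e : F ≅ G) : F.functor ≅ G.functor where
  hom := nat e.hom
  inv := nat e.inv
  hom_inv_id := congrArg nat e.hom_inv_id
  inv_hom_id := congrArg nat e.inv_hom_id

/-- Build an isomorphism of module functors. -/
def mkIso {F G : LaxRModFun 𝒜 M N} (e : F.functor ≅ G.functor) (h : IsModuleNat F G e.hom) :
    F ≅ G where
  hom := ⟨e.hom, h⟩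
  inv := ⟨e.inv, fun m X => by
    have := h m X
    rw [← cancel_mono (e.hom.app (m ⊙ᵣ X)), Category.assoc, Category.assoc, ← this,
      ← comp_actionHomLeft_assoc]
    simp⟩
  hom_inv_id := Subtype.ext e.hom_inv_id
  inv_hom_id := Subtype.ext e.inv_hom_id

section

variable {F : LaxRModFun 𝒜 M N} {G : LaxRModFun 𝒜 N M}

/-- The components of an isomorphism between a composite and the identity. -/
def invApp (e : F.comp G ≅ id) (m : M) : G.functor.obj (F.functor.obj m) ≅ m :=
  (natIso e).app m

lemma invApp_naturality (e : F.comp G ≅ id) {m n : M} (f : m ⟶ n) :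
    G.functor.map (F.functor.map f) ≫ (invApp e n).hom = (invApp e m).hom ≫ f :=
  (nat e.hom).naturality f

lemma invApp_comm (e : F.comp G ≅ id) (m : M) (X : 𝒜) :
    (invApp e m).hom ⊵ᵣ X = μᵣ G.functor (F.functor.obj m) X ≫
      G.functor.map (μᵣ F.functor m X) ≫ (invApp e (m ⊙ᵣ X)).hom :=
  (Category.comp_id _).symm.trans ((e.hom.2 m X).trans (Category.assoc _ _ _))

/-- Build an isomorphism between a composite and the identity. -/
def mkInvIso (a : ∀ m, G.functor.obj (F.functor.obj m) ≅ m)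
    (h : ∀ {m n : M} (f : m ⟶ n), G.functor.map (F.functor.map f) ≫ (a n).hom = (a m).hom ≫ f)
    (h' : ∀ (m : M) (X : 𝒜), (a m).hom ⊵ᵣ X = μᵣ G.functor (F.functor.obj m) X ≫
      G.functor.map (μᵣ F.functor m X) ≫ (a (m ⊙ᵣ X)).hom) : F.comp G ≅ id :=
  mkIso (NatIso.ofComponents a h) fun m X =>
    (Category.comp_id _).trans ((h' m X).trans (Category.assoc _ _ _).symm)

end

/-- If `F'` and `G'` are inverse to each other, as are `F` and `G`, then so are their composites. -/
def compInvIso {F : LaxRModFun 𝒜 M N} {G : LaxRModFun 𝒜 N M} {F' : LaxRModFun 𝒜 N P}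
    {G' : LaxRModFun 𝒜 P N} (e : F.comp G ≅ id) (e' : F'.comp G' ≅ id) :
    (F.comp F').comp (G'.comp G) ≅ id :=
  mkInvIso (fun m => G.functor.mapIso (invApp e' (F.functor.obj m)) ≪≫ invApp e m)
    (fun {m n} f => by
      change G.functor.map (G'.functor.map (F'.functor.map (F.functor.map f))) ≫
        G.functor.map (invApp e' (F.functor.obj n)).hom ≫ (invApp e n).hom =
        (G.functor.map (invApp e' (F.functor.obj m)).hom ≫ (invApp e m).hom) ≫ f
      rw [← Functor.map_comp_assoc, invApp_naturality, Functor.map_comp_assoc, invApp_naturality,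
        Category.assoc])
    fun m X => by
      change (G.functor.map (invApp e' (F.functor.obj m)).hom ≫ (invApp e m).hom) ⊵ᵣ X =
        (μᵣ G.functor _ X ≫ G.functor.map (μᵣ G'.functor _ X)) ≫
          G.functor.map (G'.functor.map (μᵣ F'.functor _ X ≫
            F'.functor.map (μᵣ F.functor m X))) ≫
          G.functor.map (invApp e' (F.functor.obj (m ⊙ᵣ X))).hom ≫ (invApp e (m ⊙ᵣ X)).hom
      rw [comp_actionHomLeft, invApp_comm, μᵣ_naturality_left_assoc, invApp_comm]
      simp only [Category.assoc, Functor.map_comp]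
      rw [← Functor.map_comp_assoc _ _ (invApp e' (F.functor.obj (m ⊙ᵣ X))).hom,
        invApp_naturality]
      simp only [Category.assoc, Functor.map_comp]

lemma isEquivalence_of_inverse {F : LaxRModFun 𝒜 M N} {G : LaxRModFun 𝒜 N M}
    (e : F.comp G ≅ id) (e' : G.comp F ≅ id) : F.functor.IsEquivalence :=
  (CategoryTheory.Equivalence.mk F.functor G.functor (natIso e).symm
    (natIso e')).isEquivalence_functor

/-- Module functors which are inverse to each other are strong. -/
lemma isIso_μ_of_inverse {F : LaxRModFun 𝒜 M N} {G : LaxRModFun 𝒜 N M}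
    (e : F.comp G ≅ id) (e' : G.comp F ≅ id) (m : M) (X : 𝒜) : IsIso (μᵣ F.functor m X) := by
  have := isEquivalence_of_inverse e e'
  have := isEquivalence_of_inverse e' e
  have h : IsIso (μᵣ G.functor (F.functor.obj m) X ≫ G.functor.map (μᵣ F.functor m X)) := by
    have : IsIso ((μᵣ G.functor (F.functor.obj m) X ≫ G.functor.map (μᵣ F.functor m X)) ≫
        (invApp e (m ⊙ᵣ X)).hom) := by
      rw [Category.assoc, ← invApp_comm]
      infer_instance
    exact IsIso.of_isIso_comp_right _ (invApp e (m ⊙ᵣ X)).hom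
  have h' : IsIso (μᵣ F.functor (G.functor.obj (F.functor.obj m)) X ≫
      F.functor.map (μᵣ G.functor (F.functor.obj m) X)) := by
    have : IsIso ((μᵣ F.functor (G.functor.obj (F.functor.obj m)) X ≫
        F.functor.map (μᵣ G.functor (F.functor.obj m) X)) ≫
          (invApp e' (F.functor.obj m ⊙ᵣ X)).hom) := by
      rw [Category.assoc, ← invApp_comm]
      infer_instance
    exact IsIso.of_isIso_comp_right _ (invApp e' (F.functor.obj m ⊙ᵣ X)).hom
  have h₁ : IsIso (F.functor.map (μᵣ G.functor (F.functor.obj m) X)) := by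
    have : Mono (F.functor.map (μᵣ G.functor (F.functor.obj m) X)) := by
      have : IsIso (F.functor.map (μᵣ G.functor (F.functor.obj m) X) ≫
          F.functor.map (G.functor.map (μᵣ F.functor m X))) := by
        rw [← Functor.map_comp]
        infer_instance
      exact mono_of_mono _ (F.functor.map (G.functor.map (μᵣ F.functor m X)))
    have : IsSplitEpi (F.functor.map (μᵣ G.functor (F.functor.obj m) X)) :=
      ⟨⟨inv (μᵣ F.functor (G.functor.obj (F.functor.obj m)) X ≫
        F.functor.map (μᵣ G.functor (F.functor.obj m) X)) ≫ μᵣ F.functor _ X, by simp⟩⟩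
    exact isIso_of_mono_of_isSplitEpi _
  have h₂ : IsIso (μᵣ G.functor (F.functor.obj m) X) := isIso_of_reflects_iso _ F.functor
  have h₃ : IsIso (G.functor.map (μᵣ F.functor m X)) :=
    IsIso.of_isIso_comp_left (μᵣ G.functor (F.functor.obj m) X) _
  exact isIso_of_reflects_iso _ G.functor

end LaxRModFun

variable {k : Type u} [Field k] [Preadditive M] [Linear k M] [Preadditive N] [Linear k N]
  [Preadditive P] [Linear k P]

lemma RightModEquivalent.symm (h : RightModEquivalent k 𝒜 M N) : RightModEquivalent k 𝒜 N M := by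
  obtain ⟨F, G, hF, hG, e, e'⟩ := h
  exact ⟨G, F, hG, hF, e', e⟩

lemma RightModEquivalent.trans (h : RightModEquivalent k 𝒜 M N) (h' : RightModEquivalent k 𝒜 N P) :
    RightModEquivalent k 𝒜 M P := by
  obtain ⟨F, G, hF, hG, ⟨e₁⟩, ⟨e₂⟩⟩ := h
  obtain ⟨F', G', hF', hG', ⟨e₁'⟩, ⟨e₂'⟩⟩ := h'
  exact ⟨F.comp F', G'.comp G, hF.comp hF', hG'.comp hG, ⟨LaxRModFun.compInvIso e₁ e₁'⟩,
    ⟨LaxRModFun.compInvIso e₂' e₂⟩⟩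

/-! ### A strong module functor which is an equivalence has a lax inverse -/

namespace RStrong

variable (F : RStrong k 𝒜 M N) [F.functor.IsEquivalence]

/-- The counit of the equivalence given by a module functor. -/
def counitIso (n : N) : F.functor.obj (F.functor.inv.obj n) ≅ n :=
  F.functor.asEquivalence.counitIso.app n

lemma counitIso_naturality {n n' : N} (f : n ⟶ n') :
    F.functor.map (F.functor.inv.map f) ≫ (counitIso F n').hom = (counitIso F n).hom ≫ f :=
  F.functor.asEquivalence.counitIso.hom.naturality f

lemma ext_of_counit {m : M} {n : N} {X : 𝒜} {f g : m ⊙ᵣ X ⟶ F.functor.inv.obj n}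
    (h : μᵣ F.functor m X ≫ F.functor.map f ≫ (counitIso F n).hom =
      μᵣ F.functor m X ≫ F.functor.map g ≫ (counitIso F n).hom) : f = g := by
  have := F.strong m X
  exact F.functor.map_injective ((cancel_mono _).1 ((cancel_epi _).1 h))

/-- The structure morphism of the inverse. -/
def invμ (n : N) (X : 𝒜) : F.functor.inv.obj n ⊙ᵣ X ⟶ F.functor.inv.obj (n ⊙ᵣ X) :=
  have := F.strong (F.functor.inv.obj n) X
  F.functor.preimage (inv (μᵣ F.functor (F.functor.inv.obj n) X) ≫
    (counitIso F n).hom ⊵ᵣ X ≫ (counitIso F (n ⊙ᵣ X)).inv)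

lemma map_invμ (n : N) (X : 𝒜) :
    μᵣ F.functor (F.functor.inv.obj n) X ≫ F.functor.map (invμ F n X) ≫
      (counitIso F (n ⊙ᵣ X)).hom = (counitIso F n).hom ⊵ᵣ X := by
  have := F.strong (F.functor.inv.obj n) X
  simp [invμ]

/-- The inverse of a strong module functor which is an equivalence. -/
def invFun : LaxRModFun 𝒜 N M where
  functor := F.functor.inv
  lax :=
    { μᵣ n X := invμ F n X
      μᵣ_naturality_right n X X' f := ext_of_counit F (by
        simp only [Functor.map_comp, Category.assoc, counitIso_naturality, reassoc_of% map_invμ]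
        rw [← μᵣ_naturality_right_assoc, map_invμ, ← actionHom_def, ← actionHom_def'])
      μᵣ_naturality_left {n n'} f X := ext_of_counit F (by
        simp only [Functor.map_comp, Category.assoc, counitIso_naturality, reassoc_of% map_invμ]
        rw [← μᵣ_naturality_left_assoc, map_invμ, ← comp_actionHomLeft, counitIso_naturality,
          comp_actionHomLeft])
      μᵣ_associativity n X Y := ext_of_counit F (by
        simp only [Functor.map_comp, Category.assoc, counitIso_naturality, reassoc_of% map_invμ]
        rw [μᵣ_associativity_assoc, ← μᵣ_naturality_left_assoc, map_invμ,
          ← comp_actionHomLeft, ← comp_actionHomLeft, map_invμ]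
        simp)
      μᵣ_unitality n := ext_of_counit F (by
        simp only [Functor.map_comp, Category.assoc, counitIso_naturality, reassoc_of% map_invμ]
        rw [← μᵣ_unitality_assoc]
        simp) }

/-- The unit of the equivalence given by a module functor. -/
def unitIso (m : M) : F.functor.inv.obj (F.functor.obj m) ≅ m :=
  (F.functor.asEquivalence.unitIso.app m).symm

lemma map_unitIso (m : M) :
    F.functor.map (unitIso F m).hom = (counitIso F (F.functor.obj m)).hom :=
  (F.functor.asEquivalence.counit_app_functor m).symm

/-- The unit of the equivalence given by a module functor, as a module transformation. -/
def compInv : F.toLaxRModFun.comp (invFun F) ≅ LaxRModFun.id :=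
  LaxRModFun.mkInvIso (unitIso F) (fun f => F.functor.asEquivalence.unitIso.inv.naturality f)
    fun m X => by
      have := F.strong (F.functor.inv.obj (F.functor.obj m)) X
      change (unitIso F m).hom ⊵ᵣ X =
        invμ F (F.functor.obj m) X ≫ F.functor.inv.map (μᵣ F.functor m X) ≫
          (unitIso F (m ⊙ᵣ X)).hom
      apply F.functor.map_injective
      rw [← cancel_epi (μᵣ F.functor (F.functor.inv.obj (F.functor.obj m)) X)]
      simp only [Functor.map_comp, map_unitIso, counitIso_naturality, reassoc_of% map_invμ]
      rw [← μᵣ_naturality_left, map_unitIso]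

/-- The counit of the equivalence given by a module functor, as a module transformation. -/
def invComp : (invFun F).comp F.toLaxRModFun ≅ LaxRModFun.id :=
  LaxRModFun.mkInvIso (counitIso F) (counitIso_naturality F) fun n X => (map_invμ F n X).symm

lemma rightModEquivalent (F : RStrong k 𝒜 M N) [F.functor.IsEquivalence] : RightModEquivalent k 𝒜 M N := by
  have := F.linear.additive
  have := F.linear.linear
  have : F.functor.asEquivalence.functor.Additive := F.linear.additive
  have : F.functor.asEquivalence.functor.Linear k := F.linear.linear
  exact ⟨F.toLaxRModFun, invFun F, F.linear,
    ⟨F.functor.asEquivalence.inverse_additive, F.functor.asEquivalence.inverseLinear k⟩,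
    ⟨compInv F⟩, ⟨invComp F⟩⟩

end RStrong

end RightModEquivalent

end HopfDual

end

noncomputable section

namespace HopfDual

/-! ### The dual of a category equivalent to a category of comodules -/

section LeftModEquivalent

open MonoidalLeftAction Functor.LaxLeftLinear

variable {k : Type u} [Field k]

lemma IsLinearFunctor.isTypeL {M : Type w₁} [Category.{v₁} M] [Preadditive M] [Linear k M]
    {N : Type w₂} [Category.{v₂} N] [Preadditive N] [Linear k N] {F : M ⥤ N} [F.IsEquivalence]
    (h : IsLinearFunctor k F) : IsTypeL k F where
  toIsLinearFunctor := h
  leftExact := inferInstance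
  coproducts _ := inferInstance

lemma LeftModEquivalent.exists_llax {𝒜 : Type w₁} [Category.{v₁} 𝒜] [MonoidalCategory 𝒜]
    {M : Type w₂} [Category.{v₂} M] [Preadditive M] [Linear k M] [MonoidalLeftAction 𝒜 M]
    {N : Type w₃} [Category.{v₃} N] [Preadditive N] [Linear k N] [MonoidalLeftAction 𝒜 N]
    (h : LeftModEquivalent k 𝒜 M N) :
    ∃ (F : LLax k 𝒜 M N) (G : LLax k 𝒜 N M), Nonempty (F.comp G ≅ LLax.id k 𝒜 M) ∧
      Nonempty (G.comp F ≅ LLax.id k 𝒜 N) := by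
  obtain ⟨F, G, hF, hG, ⟨e⟩, ⟨e'⟩⟩ := h
  let η : F.functor ⋙ G.functor ≅ 𝟭 M :=
    ⟨e.hom.1, e.inv.1, congrArg Subtype.val e.hom_inv_id, congrArg Subtype.val e.inv_hom_id⟩
  let η' : G.functor ⋙ F.functor ≅ 𝟭 N :=
    ⟨e'.hom.1, e'.inv.1, congrArg Subtype.val e'.hom_inv_id, congrArg Subtype.val e'.inv_hom_id⟩
  have : F.functor.IsEquivalence :=
    (CategoryTheory.Equivalence.mk F.functor G.functor η.symm η').isEquivalence_functor
  have : G.functor.IsEquivalence :=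
    (CategoryTheory.Equivalence.mk G.functor F.functor η'.symm η).isEquivalence_functor
  exact ⟨⟨F, hF.isTypeL⟩, ⟨G, hG.isTypeL⟩,
    ⟨⟨e.hom, e.inv, e.hom_inv_id, e.inv_hom_id⟩⟩, ⟨⟨e'.hom, e'.inv, e'.hom_inv_id, e'.inv_hom_id⟩⟩⟩

variable {H : Type u} [Ring H] [Bialgebra k H]
  {M : Type w₁} [Category.{v₁} M] [Preadditive M] [Linear k M]
  [MonoidalLeftAction (RComod k H) M]
  {N : Type w₂} [Category.{v₂} N] [Preadditive N] [Linear k N]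
  [MonoidalLeftAction (RComod k H) N]

/-- If `F` and `G` are inverse to each other, then `F^*(G^*(T)) ≅ T`. -/
def dualInvApp {F : LLax k (RComod k H) M N} {G : LLax k (RComod k H) N M}
    (e : F.comp G ≅ LLax.id k (RComod k H) M) (T : Dual k H M) : F.comp (G.comp T) ≅ T where
  hom := (LLax.assoc F G T).inv ≫ LLax.whiskerR e.hom T ≫ (LLax.leftUnitor T).hom
  inv := (LLax.leftUnitor T).inv ≫ LLax.whiskerR e.inv T ≫ (LLax.assoc F G T).hom
  hom_inv_id := by
    rw [Category.assoc, Category.assoc, Iso.hom_inv_id_assoc]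
    refine Eq.trans ?_ (LLax.assoc F G T).inv_hom_id
    congr 1
    refine LLax.hom_ext fun m => ?_
    have h := congrArg (fun α => (LLax.nat α).app m) e.hom_inv_id
    change T.functor.map ((LLax.nat e.hom).app m) ≫ T.functor.map ((LLax.nat e.inv).app m) ≫
      𝟙 _ = 𝟙 _
    rw [Category.comp_id, ← Functor.map_comp]
    exact (congrArg T.functor.map h).trans (T.functor.map_id _)
  inv_hom_id := by
    rw [Category.assoc, Category.assoc, Iso.hom_inv_id_assoc]
    refine Eq.trans ?_ (LLax.leftUnitor T).inv_hom_id
    congr 1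
    refine LLax.hom_ext fun m => ?_
    have h := congrArg (fun α => (LLax.nat α).app m) e.inv_hom_id
    change T.functor.map ((LLax.nat e.inv).app m) ≫ T.functor.map ((LLax.nat e.hom).app m) ≫
      𝟙 _ = 𝟙 _
    rw [Category.comp_id, ← Functor.map_comp]
    exact (congrArg T.functor.map h).trans (T.functor.map_id _)

lemma dualInvApp_app {F : LLax k (RComod k H) M N} {G : LLax k (RComod k H) N M}
    (e : F.comp G ≅ LLax.id k (RComod k H) M) (T : Dual k H M) (m : M) :
    (LLax.nat (dualInvApp e T).hom).app m = T.functor.map ((LLax.nat e.hom).app m) := by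
  change 𝟙 _ ≫ T.functor.map ((LLax.nat e.hom).app m) ≫ 𝟙 _ = _
  rw [Category.id_comp, Category.comp_id]

/-- If `F` and `G` are inverse to each other, then so are `F^*` and `G^*`. -/
def dualInvIso {F : LLax k (RComod k H) M N} {G : LLax k (RComod k H) N M}
    (e : F.comp G ≅ LLax.id k (RComod k H) M) :
    (dualMap G).toLaxRModFun.comp (dualMap F).toLaxRModFun ≅ LaxRModFun.id :=
  LaxRModFun.mkInvIso (dualInvApp e)
    (fun {S T} α => LLax.hom_ext fun m => by
      change (LLax.nat α).app (G.functor.obj (F.functor.obj m)) ≫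
        (LLax.nat (dualInvApp e T).hom).app m =
          (LLax.nat (dualInvApp e S).hom).app m ≫ (LLax.nat α).app m
      rw [dualInvApp_app, dualInvApp_app]
      exact ((LLax.nat α).naturality ((LLax.nat e.hom).app m)).symm)
    fun T X => LLax.hom_ext fun m => by
      apply ModuleCat.hom_ext
      exact TensorProduct.ext' fun t x => rfl

lemma LeftModEquivalent.dual (h : LeftModEquivalent k (RComod k H) M N) :
    RightModEquivalent k (HMod k H) (Dual k H M) (Dual k H N) := by
  obtain ⟨F, G, ⟨e⟩, ⟨e'⟩⟩ := h.exists_llax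
  exact ⟨(dualMap G).toLaxRModFun, (dualMap F).toLaxRModFun, (dualMap G).linear,
    (dualMap F).linear, ⟨dualInvIso e⟩, ⟨dualInvIso e'⟩⟩

end LeftModEquivalent

variable (k : Type u) [Field k] (H : Type u) [Ring H] [Bialgebra k H]

lemma dual_rcomod (C : ModuleCoalg k H) : RightModEquivalent k (HMod k H)
    (Dual k H (RComod k C.carrier)) (LHComod k H C.carrier) := by
  have : (Dual.fiberStrong k H C.carrier).functor.IsEquivalence :=
    inferInstanceAs (Dual.fiberFunctor k H C.carrier).IsEquivalence
  exact (Dual.fiberStrong k H C.carrier).rightModEquivalent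

variable {k H}

/-- The dual of a category equivalent to `𝔐^C` is equivalent to `^C_H𝔐`. -/
lemma LeftModCat.dual (M : LeftModCat k H) : ∃ C : ModuleCoalg k H,
    RightModEquivalent k (HMod k H) (Dual k H M.carrier) (LHComod k H C.carrier) := by
  obtain ⟨C, h⟩ := M.equiv
  exact ⟨C, h.dual.trans (dual_rcomod k H C)⟩

end HopfDual

end

noncomputable section

namespace HopfDual

namespace RLex

open MonoidalRightAction Functor.LaxRightLinear

variable {k : Type u} [Field k] {𝒜 : Type w₁} [Category.{v₁} 𝒜] [MonoidalCategory 𝒜]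
  {M : Type w₂} [Category.{v₂} M] [Preadditive M] [Linear k M] [MonoidalRightAction 𝒜 M]
  {N : Type w₃} [Category.{v₃} N] [Preadditive N] [Linear k N] [MonoidalRightAction 𝒜 N]

instance (F : RLex k 𝒜 M N) (m : M) (X : 𝒜) : IsIso (μᵣ F.functor m X) := F.strong m X

variable {F G : RLex k 𝒜 M N}

/-- The morphism `F(m ◁ X) ⟶ G(m ◁ X)` induced by a morphism `F(m) ⟶ G(m)`. -/
def actExt {m : M} (a : F.functor.obj m ⟶ G.functor.obj m) (X : 𝒜) :
    F.functor.obj (m ⊙ᵣ X) ⟶ G.functor.obj (m ⊙ᵣ X) :=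
  inv (μᵣ F.functor m X) ≫ a ⊵ᵣ X ≫ μᵣ G.functor m X

lemma μ_actExt {m : M} (a : F.functor.obj m ⟶ G.functor.obj m) (X : 𝒜) :
    μᵣ F.functor m X ≫ actExt a X = a ⊵ᵣ X ≫ μᵣ G.functor m X := by
  simp [actExt]

lemma actExt_nat (θ : F ⟶ G) (m : M) (X : 𝒜) :
    actExt ((nat θ).app m) X = (nat θ).app (m ⊙ᵣ X) := by
  rw [← cancel_epi (μᵣ F.functor m X), μ_actExt, nat_comm]

lemma actExt_naturality {m : M} (a : F.functor.obj m ⟶ G.functor.obj m) {X X' : 𝒜} (f : X ⟶ X') :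
    F.functor.map (m ⊴ᵣ f) ≫ actExt a X' = actExt a X ≫ G.functor.map (m ⊴ᵣ f) := by
  rw [← cancel_epi (μᵣ F.functor m X), ← μᵣ_naturality_right_assoc, μ_actExt, reassoc_of% μ_actExt,
    ← μᵣ_naturality_right, ← Category.assoc, ← Category.assoc, ← actionHom_def, actionHom_def']

lemma actExt_map {m m' : M} {a : F.functor.obj m ⟶ G.functor.obj m}
    {a' : F.functor.obj m' ⟶ G.functor.obj m'} {f : m ⟶ m'}
    (h : F.functor.map f ≫ a' = a ≫ G.functor.map f) (X : 𝒜) :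
    F.functor.map (f ⊵ᵣ X) ≫ actExt a' X = actExt a X ≫ G.functor.map (f ⊵ᵣ X) := by
  rw [← cancel_epi (μᵣ F.functor m X), ← μᵣ_naturality_left_assoc, μ_actExt, reassoc_of% μ_actExt,
    ← μᵣ_naturality_left, ← comp_actionHomLeft_assoc, h, comp_actionHomLeft_assoc]

lemma actExt_assoc {m : M} (a : F.functor.obj m ⟶ G.functor.obj m) (X Y : 𝒜) :
    F.functor.map (αᵣ m X Y).hom ≫ actExt (actExt a X) Y =
      actExt a (X ⊗ Y) ≫ G.functor.map (αᵣ m X Y).hom := by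
  rw [← cancel_epi (μᵣ F.functor m (X ⊗ Y)), μᵣ_associativity_assoc, μ_actExt, reassoc_of% μ_actExt,
    μᵣ_associativity, ← comp_actionHomLeft_assoc, μ_actExt]
  simp

lemma actExt_assoc_inv {m : M} (a : F.functor.obj m ⟶ G.functor.obj m) (X Y : 𝒜) :
    F.functor.map (αᵣ m X Y).inv ≫ actExt a (X ⊗ Y) =
      actExt (actExt a X) Y ≫ G.functor.map (αᵣ m X Y).inv := by
  rw [← cancel_epi (F.functor.map (αᵣ m X Y).hom), reassoc_of% actExt_assoc, ← Functor.map_comp_assoc,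
    ← Functor.map_comp]
  simp

end RLex

/-! ### Module functors on the dual of a category of comodules -/

namespace Dual

open MonoidalRightAction Functor.LaxRightLinear RLex

variable {k : Type u} [Field k] {H : Type u} [Ring H] [Bialgebra k H]
  {C : Type u} [AddCommGroup C] [Module k C]
  [Coalgebra k C] [Module H C] [IsScalarTower k H C] [IsModuleCoalgebra k H C]
  {K : Type w₁} [Category.{v₁} K] [Preadditive K] [Linear k K] [MonoidalRightAction (HMod k H) K]
  {F G : RLex k (HMod k H) (Dual k H (RComod k C)) K}

instance (G : RLex k (HMod k H) (Dual k H (RComod k C)) K) (T : Dual k H (RComod k C)) :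
    Mono (G.functor.map (toFiber T)) :=
  have := G.leftExact
  inferInstance

/-- A module transformation between left exact module functors is determined by its component at
the forgetful functor. -/
lemma rlex_hom_ext {θ θ' : F ⟶ G}
    (h : (nat θ).app (forgetDual k H C) = (nat θ').app (forgetDual k H C)) : θ = θ' := by
  refine RLex.hom_ext fun T => ?_
  rw [← cancel_mono (G.functor.map (toFiber T)), ← (nat θ).naturality, ← (nat θ').naturality,
    ← actExt_nat, ← actExt_nat, h]

/-- Compatibility of a morphism `F(U) ⟶ G(U)` with the coaction of `U`. -/
def IsCoactHom (a : F.functor.obj (forgetDual k H C) ⟶ G.functor.obj (forgetDual k H C)) : Prop :=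
  F.functor.map (forgetCoact k H C) ≫ actExt a (coalgMod k H C) =
    a ≫ G.functor.map (forgetCoact k H C)

variable {a : F.functor.obj (forgetDual k H C) ⟶ G.functor.obj (forgetDual k H C)}

lemma IsCoactHom.condition (h : IsCoactHom a) (T : Dual k H (RComod k C)) :
    (F.functor.map (toFiber T) ≫ actExt a (fiberComod T).toHMod) ≫
        G.functor.map (cofreeLeft C (fiberComod T).toHMod) =
      (F.functor.map (toFiber T) ≫ actExt a (fiberComod T).toHMod) ≫
        G.functor.map (cofreeRight (fiberComod T)) := by
  rw [Category.assoc, Category.assoc, cofreeRight, Functor.map_comp, ← reassoc_of% actExt_naturality,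
    ← actExt_assoc, cofreeLeft, ← actExt_map h, ← Functor.map_comp_assoc,
    ← Functor.map_comp_assoc, ← Functor.map_comp_assoc]
  exact congrArg (fun f => F.functor.map f ≫ _) (toFiber_fork T)

/-- The components of the module transformation induced by a morphism `F(U) ⟶ G(U)`. -/
def IsCoactHom.app (h : IsCoactHom a) (T : Dual k H (RComod k C)) :
    F.functor.obj T ⟶ G.functor.obj T :=
  have := G.leftExact
  Fork.IsLimit.lift (isLimitForkMapOfIsLimit G.functor (toFiber_fork T) (toFiberIsLimit T)) _
    (h.condition T)

lemma IsCoactHom.app_toFiber (h : IsCoactHom a) (T : Dual k H (RComod k C)) :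
    h.app T ≫ G.functor.map (toFiber T) =
      F.functor.map (toFiber T) ≫ actExt a (fiberComod T).toHMod :=
  have := G.leftExact
  Fork.IsLimit.lift_ι' (isLimitForkMapOfIsLimit G.functor (toFiber_fork T) (toFiberIsLimit T)) _
    (h.condition T)

/-- The `H`-linear map `T(C) ⊗ X → (T ◁ X)(C)`, which is the identity of vector spaces. -/
def fiberTensorHom (T : Dual k H (RComod k C)) (X : HMod k H) :
    (fiberComod T).toHMod ⊗ X ⟶ (fiberComod (T ⊙ᵣ X)).toHMod :=
  LHComod.hmodHom (fiberActIso T X).hom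

lemma toFiber_act (T : Dual k H (RComod k C)) (X : HMod k H) :
    toFiber (T ⊙ᵣ X) = toFiber T ⊵ᵣ X ≫
      (αᵣ (forgetDual k H C) (fiberComod T).toHMod X).inv ≫
        forgetDual k H C ⊴ᵣ fiberTensorHom T X := by
  refine LLax.hom_ext fun m => ?_
  apply ModuleCat.hom_ext
  refine LinearMap.ext fun s => (coactMap_act T X m s).trans ?_
  exact (LinearMap.congr_fun (LinearMap.lTensor_id m.V ((fiber T).V ⊗[k] X.V))
    (TensorProduct.assoc k m.V (fiber T).V X.V ((coactMap T m).rTensor X.V s))).symm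

variable (k H C) in
/-- The module coalgebra `C` as the fiber of the forgetful functor. -/
def coalgToFiber : coalgMod k H C ⟶ (fiberComod (forgetDual k H C)).toHMod :=
  HMod.mkHom (X := coalgMod k H C) (Y := (fiberComod (forgetDual k H C)).toHMod)
    (LinearMap.id : C →ₗ[k] C) fun _ _ => rfl

lemma toFiber_forgetDual :
    toFiber (forgetDual k H C) = forgetCoact k H C ≫ forgetDual k H C ⊴ᵣ coalgToFiber k H C := by
  refine LLax.hom_ext fun m => ?_
  apply ModuleCat.hom_ext
  refine LinearMap.ext fun s => (coactMap_forgetDual m s).trans ?_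
  exact (LinearMap.congr_fun (LinearMap.lTensor_id m.V C) (m.coact s)).symm

/-- The module transformation induced by a morphism `F(U) ⟶ G(U)`. -/
def IsCoactHom.hom (h : IsCoactHom a) : F ⟶ G :=
  RLex.mkHom
    { app := h.app
      naturality S T α := by
        rw [← cancel_mono (G.functor.map (toFiber T)), Category.assoc, Category.assoc,
          h.app_toFiber, ← Functor.map_comp_assoc, ← Functor.map_comp, toFiber_naturality,
          Functor.map_comp, Functor.map_comp, Category.assoc, reassoc_of% h.app_toFiber,
          actExt_naturality] }
    fun T X => by
      change h.app T ⊵ᵣ X ≫ μᵣ G.functor T X = μᵣ F.functor T X ≫ h.app (T ⊙ᵣ X)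
      rw [← μ_actExt]
      congr 1
      rw [← cancel_mono (G.functor.map (toFiber (T ⊙ᵣ X))), h.app_toFiber, toFiber_act]
      simp only [Functor.map_comp, Category.assoc]
      rw [← reassoc_of% actExt_map (h.app_toFiber T).symm, actExt_naturality,
        reassoc_of% actExt_assoc_inv]

lemma IsCoactHom.nat_hom (h : IsCoactHom a) : (nat h.hom).app (forgetDual k H C) = a := by
  change h.app _ = a
  rw [← cancel_mono (G.functor.map (toFiber (forgetDual k H C))), h.app_toFiber,
    toFiber_forgetDual, Functor.map_comp, Functor.map_comp, Category.assoc, actExt_naturality]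
  exact (Category.assoc _ _ _).symm.trans ((congrArg (· ≫ _) h).trans (Category.assoc _ _ _))

end Dual

end HopfDual

end

noncomputable section

namespace HopfDual

/-! ### Module functors into a category of comodules -/

namespace Dual

open MonoidalLeftAction MonoidalRightAction Functor.LaxLeftLinear

variable {k : Type u} [Field k] {H : Type u} [Ring H] [Bialgebra k H]
  {C : Type u} [AddCommGroup C] [Module k C]
  [Coalgebra k C] [Module H C] [IsScalarTower k H C] [IsModuleCoalgebra k H C]
  {M : Type w₁} [Category.{v₁} M] [Preadditive M] [Linear k M]
  [MonoidalLeftAction (RComod k H) M]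

/-- A coaction of a module coalgebra `C` on an object of the dual. -/
structure IsCoaction {S : Dual k H M} (d : S ⟶ S ⊙ᵣ coalgMod k H C) : Prop where
  coassoc : d ≫ d ⊵ᵣ coalgMod k H C =
    d ≫ S ⊴ᵣ comulHom k H C ≫ (αᵣ S (coalgMod k H C) (coalgMod k H C)).hom
  counit : d ≫ S ⊴ᵣ counitHom k H C ≫ (ρᵣ S).hom = 𝟙 S

/-- The components of a coaction. -/
def coactionApp {S : Dual k H M} (d : S ⟶ S ⊙ᵣ coalgMod k H C) (m : M) :
    S.functor.obj m →ₗ[k] S.functor.obj m ⊗[k] C :=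
  ((LLax.nat d).app m).hom

namespace IsCoaction

variable {S : Dual k H M} {d : S ⟶ S ⊙ᵣ coalgMod k H C} (hd : IsCoaction d)

include hd in
lemma app_coassoc (m : M) (s : S.functor.obj m) :
    (coactionApp d m).rTensor C (coactionApp d m s) =
      (TensorProduct.assoc k (S.functor.obj m) C C).symm
        ((Coalgebra.comul (R := k) (A := C)).lTensor _ (coactionApp d m s)) :=
  LinearMap.congr_fun (congrArg (fun α => ModuleCat.Hom.hom ((LLax.nat α).app m)) hd.coassoc) s

include hd in
lemma app_counit (m : M) (s : S.functor.obj m) :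
    TensorProduct.rid k (S.functor.obj m)
        ((Coalgebra.counit (R := k) (A := C)).lTensor _ (coactionApp d m s)) = s :=
  LinearMap.congr_fun (congrArg (fun α => ModuleCat.Hom.hom ((LLax.nat α).app m)) hd.counit) s

/-- The values of an object of the dual with a coaction are comodules. -/
def comod (m : M) : RComod k C where
  V := S.functor.obj m
  coact := coactionApp d m
  coassoc := LinearMap.ext fun s => (LinearEquiv.eq_symm_apply _).1 (hd.app_coassoc m s)
  counit := LinearMap.ext (hd.app_counit m)

/-- The functor to the category of comodules given by a coaction. -/
def functor : M ⥤ RComod k C where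
  obj m := hd.comod m
  map {m n} f := RComod.mkHom (X := hd.comod m) (Y := hd.comod n) (S.functor.map f).hom fun s =>
    LinearMap.congr_fun (congrArg ModuleCat.Hom.hom ((LLax.nat d).naturality f)) s
  map_id m := RComod.hom_ext (congrArg ModuleCat.Hom.hom (S.functor.map_id m))
  map_comp f g := RComod.hom_ext (congrArg ModuleCat.Hom.hom (S.functor.map_comp f g))

/-- The structure morphism of the functor to the category of comodules given by a coaction. -/
def μ (Y : RComod k H) (m : M) : tensorComod Y (hd.comod m) ⟶ hd.comod (Y ⊙ₗ m) :=
  RComod.mkHom (X := tensorComod Y (hd.comod m)) (Y := hd.comod (Y ⊙ₗ m))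
    (μₗ S.functor Y m).hom fun s => by
      refine (LinearMap.congr_fun (congrArg ModuleCat.Hom.hom (LLax.nat_comm d Y m)) s).symm.trans ?_
      refine LinearMap.congr_fun
        (f := ((μₗ S.functor Y m).hom : Y.V ⊗[k] S.functor.obj m →ₗ[k] _).rTensor C ∘ₗ
          coalgXi C Y (S.functor.obj m) ∘ₗ (coactionApp d m).lTensor Y.V)
        (g := ((μₗ S.functor Y m).hom : Y.V ⊗[k] S.functor.obj m →ₗ[k] _).rTensor C ∘ₗ
          (tensorComod Y (hd.comod m)).coact)
        (TensorProduct.ext' fun y t => rfl) s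

lemma functor_typeL : IsTypeL k hd.functor where
  additive := by
    have := S.typeL.additive
    exact ⟨fun {m n f g} => RComod.hom_ext (congrArg ModuleCat.Hom.hom (S.functor.map_add))⟩
  linear := by
    have := S.typeL.additive
    have := S.typeL.linear
    exact ⟨fun {m n} f r => RComod.hom_ext (congrArg ModuleCat.Hom.hom (S.functor.map_smul r f))⟩
  leftExact := by
    refine ⟨fun J _ _ => ?_⟩
    have := S.typeL.leftExact
    have : PreservesLimitsOfShape J (hd.functor ⋙ RComod.forget k C) :=
      inferInstanceAs (PreservesLimitsOfShape J S.functor)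
    exact preservesLimitsOfShape_of_reflects_of_preserves hd.functor (RComod.forget k C)
  coproducts J := by
    have := S.typeL.coproducts J
    have : PreservesColimitsOfShape (Discrete J) (hd.functor ⋙ RComod.forget k C) :=
      inferInstanceAs (PreservesColimitsOfShape (Discrete J) S.functor)
    exact preservesColimitsOfShape_of_reflects_of_preserves hd.functor (RComod.forget k C)

/-- The lax module functor to the category of comodules given by a coaction. -/
def llax : LLax k (RComod k H) M (RComod k C) where
  functor := hd.functor
  lax :=
    { μₗ := hd.μ
      μₗ_naturality_left f m :=
        RComod.hom_ext (congrArg ModuleCat.Hom.hom (μₗ_naturality_left S.functor f m))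
      μₗ_naturality_right Y _ _ f :=
        RComod.hom_ext (congrArg ModuleCat.Hom.hom (μₗ_naturality_right S.functor Y f))
      μₗ_associativity Y Z m :=
        RComod.hom_ext (congrArg ModuleCat.Hom.hom (μₗ_associativity S.functor Y Z m))
      μₗ_unitality m :=
        RComod.hom_ext (congrArg ModuleCat.Hom.hom (μₗ_unitality S.functor (C := RComod k H) m)) }
  typeL := hd.functor_typeL

/-- The underlying object of the dual of the module functor given by a coaction. -/
def llaxForget : hd.llax.comp (forgetDual k H C) ≅ S :=
  LLax.mkIso (Iso.refl S.functor) fun Y m => by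
    apply ModuleCat.hom_ext
    exact TensorProduct.ext' fun y s => rfl

end IsCoaction

end Dual

end HopfDual

end

noncomputable section

namespace HopfDual

/-! ### Module functors between duals -/

namespace Dual

open MonoidalRightAction Functor.LaxRightLinear RLex

variable {k : Type u} [Field k] {H : Type u} [Ring H] [Bialgebra k H]
  {C : Type u} [AddCommGroup C] [Module k C]
  [Coalgebra k C] [Module H C] [IsScalarTower k H C] [IsModuleCoalgebra k H C]

section

variable {K : Type w₁} [Category.{v₁} K] [Preadditive K] [Linear k K]
  [MonoidalRightAction (HMod k H) K]
  {F G : RLex k (HMod k H) (Dual k H (RComod k C)) K}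

lemma IsCoactHom.symm {a : F.functor.obj (forgetDual k H C) ≅ G.functor.obj (forgetDual k H C)}
    (h : IsCoactHom a.hom) : IsCoactHom a.inv := by
  have e : actExt a.inv (coalgMod k H C) ≫ actExt a.hom (coalgMod k H C) = 𝟙 _ := by
    rw [← cancel_epi (μᵣ G.functor _ _), reassoc_of% μ_actExt, μ_actExt, ← comp_actionHomLeft_assoc]
    simp
  have e' : actExt a.hom (coalgMod k H C) ≫ actExt a.inv (coalgMod k H C) = 𝟙 _ := by
    rw [← cancel_epi (μᵣ F.functor _ _), reassoc_of% μ_actExt, μ_actExt, ← comp_actionHomLeft_assoc]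
    simp
  unfold IsCoactHom at h ⊢
  rw [← cancel_epi a.hom, Iso.hom_inv_id_assoc, ← Category.assoc, ← h, Category.assoc, e',
    Category.comp_id]

/-- The isomorphism of module functors induced by an isomorphism `F(U) ≅ G(U)`. -/
def IsCoactHom.iso {a : F.functor.obj (forgetDual k H C) ≅ G.functor.obj (forgetDual k H C)}
    (h : IsCoactHom a.hom) : F ≅ G where
  hom := h.hom
  inv := h.symm.hom
  hom_inv_id := rlex_hom_ext (by
    rw [nat_comp, NatTrans.comp_app, h.nat_hom, h.symm.nat_hom, a.hom_inv_id]
    rfl)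
  inv_hom_id := rlex_hom_ext (by
    rw [nat_comp, NatTrans.comp_app, h.nat_hom, h.symm.nat_hom, a.inv_hom_id]
    rfl)

end

lemma isCoaction_forgetCoact : IsCoaction (forgetCoact k H C) where
  coassoc := LLax.hom_ext fun m => by
    apply ModuleCat.hom_ext
    refine LinearMap.ext fun x => ?_
    have h : m.coact.rTensor C (m.coact x) = (TensorProduct.assoc k m.V C C).symm
        ((Coalgebra.comul (R := k) (A := C)).lTensor m.V (m.coact x)) :=
      (LinearEquiv.eq_symm_apply _).2 (LinearMap.congr_fun m.coassoc x)
    exact h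
  counit := LLax.hom_ext fun m => by
    apply ModuleCat.hom_ext
    exact m.counit

variable {M : Type w₁} [Category.{v₁} M] [Preadditive M] [Linear k M]
  [MonoidalLeftAction (RComod k H) M]

section

variable (F : RLex k (HMod k H) (Dual k H (RComod k C)) (Dual k H M))

/-- The coaction on `F(U)` for a module functor `F`. -/
def imageCoact : F.functor.obj (forgetDual k H C) ⟶
    F.functor.obj (forgetDual k H C) ⊙ᵣ coalgMod k H C :=
  F.functor.map (forgetCoact k H C) ≫ inv (μᵣ F.functor (forgetDual k H C) (coalgMod k H C))

lemma imageCoact_μ : imageCoact F ≫ μᵣ F.functor (forgetDual k H C) (coalgMod k H C) =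
    F.functor.map (forgetCoact k H C) := by
  simp [imageCoact]

lemma isCoaction_imageCoact : IsCoaction (imageCoact F) where
  coassoc := by
    rw [← cancel_mono (μᵣ F.functor (forgetDual k H C) (coalgMod k H C) ⊵ᵣ coalgMod k H C ≫
      μᵣ F.functor (forgetDual k H C ⊙ᵣ coalgMod k H C) (coalgMod k H C))]
    simp only [Category.assoc]
    rw [← comp_actionHomLeft_assoc, imageCoact_μ, μᵣ_naturality_left, reassoc_of% imageCoact_μ F,
      ← μᵣ_associativity, μᵣ_naturality_right_assoc, reassoc_of% imageCoact_μ F, ← Functor.map_comp,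
      ← Functor.map_comp, ← Functor.map_comp, isCoaction_forgetCoact.coassoc]
  counit := by
    rw [μᵣ_unitality, μᵣ_naturality_right_assoc, reassoc_of% imageCoact_μ F, ← Functor.map_comp,
      ← Functor.map_comp, isCoaction_forgetCoact.counit, CategoryTheory.Functor.map_id]

/-- A module functor from the dual of `𝔐^C` to the dual of `M` as a functor from `M` to `𝔐^C`. -/
def predual : LLax k (RComod k H) M (RComod k C) :=
  (isCoaction_imageCoact F).llax

/-- The dual of `predual F` takes the value `F(U)` at the forgetful functor `U`. -/
def predualForget : (dualRLex (predual F) (dualMap_preservesFiniteLimits _)).functor.obj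
    (forgetDual k H C) ≅ F.functor.obj (forgetDual k H C) :=
  (isCoaction_imageCoact F).llaxForget

lemma predual_isCoactHom : IsCoactHom (predualForget F).hom := by
  unfold IsCoactHom
  have h : (dualRLex (predual F) (dualMap_preservesFiniteLimits _)).functor.map
        (forgetCoact k H C) =
      ((predualForget F).hom ≫ imageCoact F ≫ (predualForget F).inv ⊵ᵣ coalgMod k H C) ≫
      μᵣ (dualRLex (predual F) (dualMap_preservesFiniteLimits _)).functor
        (forgetDual k H C) (coalgMod k H C) := by
    refine LLax.hom_ext fun m => ?_
    apply ModuleCat.hom_ext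
    refine LinearMap.ext fun x => ?_
    exact (LinearMap.congr_fun (LinearMap.rTensor_id C
      ((F.functor.obj (forgetDual k H C)).functor.obj m)) (coactionApp (imageCoact F) m x)).symm
  rw [h]
  simp only [Category.assoc]
  rw [μ_actExt, ← comp_actionHomLeft_assoc, Iso.inv_hom_id, id_actionHomLeft, Category.id_comp,
    imageCoact_μ]

/-- Every module functor from the dual of `𝔐^C` to the dual of `M` is a dual. -/
def predualIso : dualRLex (predual F) (dualMap_preservesFiniteLimits _) ≅ F :=
  (predual_isCoactHom F).iso

end

section

variable {F G : LLax k (RComod k H) M (RComod k C)}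

lemma dualMap₂_injective {α β : F ⟶ G} (h : dualMap₂ α = dualMap₂ β) : α = β :=
  LLax.hom_ext fun m => RComod.hom_ext
    (congrArg (fun θ : (dualMap F).toLaxRModFun ⟶ (dualMap G).toLaxRModFun =>
      ModuleCat.Hom.hom ((LLax.nat (θ.1.app (forgetDual k H C))).app m)) h)

variable (θ : dualRLex F (dualMap_preservesFiniteLimits _) ⟶
  dualRLex G (dualMap_preservesFiniteLimits _))

/-- The component at the forgetful functor of a module transformation between duals. -/
def predualApp (m : M) : (F.functor.obj m).V →ₗ[k] (G.functor.obj m).V :=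
  ((LLax.nat ((RLex.nat θ).app (forgetDual k H C))).app m).hom

lemma predualApp_coact (m : M) (x : (F.functor.obj m).V) :
    (G.functor.obj m).coact (predualApp θ m x) =
      (predualApp θ m).rTensor C ((F.functor.obj m).coact x) := by
  have h₁ := congrArg (fun α => ModuleCat.Hom.hom ((LLax.nat α).app m))
    ((RLex.nat θ).naturality (forgetCoact k H C))
  have h₂ := congrArg (fun α => ModuleCat.Hom.hom ((LLax.nat α).app m))
    (RLex.nat_comm θ (forgetDual k H C) (coalgMod k H C))
  refine (LinearMap.congr_fun h₁ x).symm.trans ?_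
  exact (LinearMap.congr_fun h₂ ((F.functor.obj m).coact x)).symm

/-- The module transformation inducing a given one between the duals. -/
def predualMap : F ⟶ G :=
  LLax.mkHom
    { app m := RComod.mkHom (predualApp θ m) (predualApp_coact θ m)
      naturality _ _ f := RComod.hom_ext (congrArg ModuleCat.Hom.hom
        ((LLax.nat ((RLex.nat θ).app (forgetDual k H C))).naturality f)) }
    fun Y m => RComod.hom_ext (congrArg ModuleCat.Hom.hom
      (LLax.nat_comm ((RLex.nat θ).app (forgetDual k H C)) Y m))

lemma dualMap₂_predualMap : dualMap₂ (predualMap θ) = θ :=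
  rlex_hom_ext (F := dualRLex F (dualMap_preservesFiniteLimits _))
    (G := dualRLex G (dualMap_preservesFiniteLimits _)) (LLax.hom_ext fun _ => rfl)

end

end Dual

end HopfDual

end

noncomputable section

namespace HopfDual

/-! ### Equivalences of hom-categories -/

section

open Bicategory

variable {B : Type w₁} [Bicategory.{v₁, v₂} B] {D : Type w₂} [Bicategory.{v₃, v₄} D]

lemma isEquivalence_postcomp {b c : B} {f : b ⟶ c} {g : c ⟶ b} (η : f ≫ g ≅ 𝟙 b)
    (θ' : g ≫ f ≅ 𝟙 c) (a : B) : (postcomp a f).IsEquivalence :=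
  (CategoryTheory.Equivalence.mk (postcomp a f) (postcomp a g)
    (associatorNatIsoLeft a f g ≪≫ (postcomposing a b b).mapIso η ≪≫ rightUnitorNatIso a b).symm
    (associatorNatIsoLeft a g f ≪≫ (postcomposing a c c).mapIso θ' ≪≫
      rightUnitorNatIso a c)).isEquivalence_functor

lemma isEquivalence_mapFunctor (P : Pseudofunctor B D) {b c : B} {f : b ⟶ c} {g : c ⟶ b}
    (η : f ≫ g ≅ 𝟙 b) (θ' : g ≫ f ≅ 𝟙 c) (a : B) (h : (P.mapFunctor a c).IsEquivalence) :
    (P.mapFunctor a b).IsEquivalence := by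
  have := isEquivalence_postcomp η θ' a
  have := isEquivalence_postcomp ((P.mapComp f g).symm ≪≫ P.map₂Iso η ≪≫ P.mapId b)
    ((P.mapComp g f).symm ≪≫ P.map₂Iso θ' ≪≫ P.mapId c) (P.obj a)
  let i : postcomp a f ⋙ P.mapFunctor a c ≅ P.mapFunctor a b ⋙ postcomp (P.obj a) (P.map f) :=
    NatIso.ofComponents (fun x => P.mapComp x f) fun {x y} α => by
      change P.map₂ (α ▷ f) ≫ (P.mapComp y f).hom = (P.mapComp x f).hom ≫ P.map₂ α ▷ P.map f
      simp
  have := Functor.isEquivalence_of_iso i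
  exact Functor.isEquivalence_of_comp_right _ (postcomp (P.obj a) (P.map f))

end

variable {k : Type u} [Field k] {H : Type u} [Ring H] [Bialgebra k H]

variable (k H) in
/-- The category `𝔐^C` as a 0-cell. -/
def LeftModCat.rcomod (C : ModuleCoalg k H) : LeftModCat k H where
  carrier := RComod k C.carrier
  equiv := ⟨C, LaxModFun.id, LaxModFun.id, (LLax.id k (RComod k H) _).typeL.toIsLinearFunctor,
    (LLax.id k (RComod k H) _).typeL.toIsLinearFunctor,
    ⟨(⟨(LLax.leftUnitor (LLax.id k (RComod k H) (RComod k C.carrier))).hom,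
      (LLax.leftUnitor (LLax.id k (RComod k H) (RComod k C.carrier))).inv,
      (LLax.leftUnitor (LLax.id k (RComod k H) (RComod k C.carrier))).hom_inv_id,
      (LLax.leftUnitor (LLax.id k (RComod k H) (RComod k C.carrier))).inv_hom_id⟩)⟩,
    ⟨(⟨(LLax.leftUnitor (LLax.id k (RComod k H) (RComod k C.carrier))).hom,
      (LLax.leftUnitor (LLax.id k (RComod k H) (RComod k C.carrier))).inv,
      (LLax.leftUnitor (LLax.id k (RComod k H) (RComod k C.carrier))).hom_inv_id,
      (LLax.leftUnitor (LLax.id k (RComod k H) (RComod k C.carrier))).inv_hom_id⟩)⟩⟩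

/-- The dual as a pseudofunctor. -/
abbrev dualPseudofunctor : Pseudofunctor (LeftModCat k H) (RightModCat k H)ᵒᵖ :=
  dualFunctor LeftModCat.dual fun F => dualMap_preservesFiniteLimits F

open Opposite Bicategory.Opposite

lemma isEquivalence_mapFunctor_rcomod (M : LeftModCat k H) (C : ModuleCoalg k H) :
    (dualPseudofunctor.mapFunctor M (LeftModCat.rcomod k H C)).IsEquivalence where
  faithful := ⟨fun {_ _} _ _ h => Dual.dualMap₂_injective (congrArg Hom2.unop2 h)⟩
  full := ⟨fun {_ _} θ => ⟨Dual.predualMap θ.unop2,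
    hom₂_ext fun T => congrArg (fun α => (RLex.nat α).app T) (Dual.dualMap₂_predualMap θ.unop2)⟩⟩
  essSurj := ⟨fun F =>
    let e : ((dualPseudofunctor.mapFunctor M (LeftModCat.rcomod k H C)).obj (Dual.predual F.unop)).unop ≅
      F.unop := Dual.predualIso F.unop
    ⟨Dual.predual F.unop, ⟨e.op2_unop⟩⟩⟩

lemma isEquivalence_mapFunctor_dual (M N : LeftModCat k H) :
    (dualPseudofunctor.mapFunctor M N).IsEquivalence := by
  obtain ⟨C, h⟩ := N.equiv
  obtain ⟨F, G, ⟨e⟩, ⟨e'⟩⟩ := h.exists_llax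
  exact isEquivalence_mapFunctor (b := N) (c := LeftModCat.rcomod k H C) dualPseudofunctor e e' M
    (isEquivalence_mapFunctor_rcomod M C)

lemma RightModEquivalent.exists_rlex {𝒜 : Type w₁} [Category.{v₁} 𝒜] [MonoidalCategory 𝒜]
    {M : Type w₂} [Category.{v₂} M] [Preadditive M] [Linear k M] [MonoidalRightAction 𝒜 M]
    {N : Type w₃} [Category.{v₃} N] [Preadditive N] [Linear k N] [MonoidalRightAction 𝒜 N]
    (h : RightModEquivalent k 𝒜 M N) :
    ∃ (F : RLex k 𝒜 M N) (G : RLex k 𝒜 N M), Nonempty (F.comp G ≅ RLex.id k 𝒜 M) ∧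
      Nonempty (G.comp F ≅ RLex.id k 𝒜 N) := by
  obtain ⟨F, G, hF, hG, ⟨e⟩, ⟨e'⟩⟩ := h
  have := LaxRModFun.isEquivalence_of_inverse e e'
  have := LaxRModFun.isEquivalence_of_inverse e' e
  exact ⟨⟨⟨F, hF, LaxRModFun.isIso_μ_of_inverse e e'⟩, inferInstance⟩,
    ⟨⟨G, hG, LaxRModFun.isIso_μ_of_inverse e' e⟩, inferInstance⟩,
    ⟨⟨e.hom, e.inv, e.hom_inv_id, e.inv_hom_id⟩⟩, ⟨⟨e'.hom, e'.inv, e'.hom_inv_id, e'.inv_hom_id⟩⟩⟩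

lemma exists_dual_equivalence (d : (RightModCat k H)ᵒᵖ) :
    ∃ M : LeftModCat k H, Nonempty (Bicategory.Equivalence (dualPseudofunctor.obj M) d) := by
  obtain ⟨C, h⟩ := d.unop.equiv
  obtain ⟨F, G, ⟨e⟩, ⟨e'⟩⟩ := (h.trans (dual_rcomod k H C).symm).exists_rlex
  let D : RightModCat k H := (dualPseudofunctor.obj (LeftModCat.rcomod k H C)).unop
  let f : d.unop ⟶ D := F
  let g : D ⟶ d.unop := G
  let η : f ≫ g ≅ 𝟙 d.unop := e
  let θ' : g ≫ f ≅ 𝟙 D := e'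
  exact ⟨LeftModCat.rcomod k H C, ⟨Bicategory.Equivalence.mkOfAdjointifyCounit
    (f := f.op) (g := g.op) θ'.op2.symm η.op2⟩⟩

end HopfDual

end

theorem mainTheorem7 (k : Type u) [Field k] (H : Type u) [Ring H] [Bialgebra k H] :
    ∃ (h₀ : ∀ M : HopfDual.LeftModCat k H, ∃ C : HopfDual.ModuleCoalg k H,
        HopfDual.RightModEquivalent k (HopfDual.HMod k H) (HopfDual.Dual k H M.carrier)
          (HopfDual.LHComod k H C.carrier))
      (h₁ : ∀ {M N : HopfDual.LeftModCat k H}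
        (F : HopfDual.LLax k (HopfDual.RComod k H) M.carrier N.carrier),
        CategoryTheory.Limits.PreservesFiniteLimits (HopfDual.dualMap F).functor),
      HopfDual.IsTwoEquivalence (HopfDual.dualFunctor h₀ h₁) :=
  ⟨HopfDual.LeftModCat.dual, fun F => HopfDual.dualMap_preservesFiniteLimits F,
    HopfDual.isEquivalence_mapFunctor_dual, HopfDual.exists_dual_equivalence⟩
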